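/- Let $\phi\in C^\infty(\mathbb R^{2n};\mathbb R)$, and let $\kappa:\mathbb R^{2n}\to\mathbb R^{2n}$ be a canonical transformation (a diffeomorphism preserving the standard symplectic form) such that $\kappa(y,\eta)=(x,\xi)$ if and only if $\xi=d_x\phi(x,\eta)$ and $y=d_\eta\phi(x,\eta)$. For $h\in(0,1]$ let $$(Sf)(x)=\frac{1}{(2\pi h)^n}\iint_{\mathbb R^{2n}} e^{\frac ih(\phi(x,\eta)-\langle y,\eta\rangle)}a(x,\eta)f(y)\,dy\,d\eta ,$$ where $a$ is smooth, supported in a fixed compact set, with $|\partial^\alpha a|\lesssim_\alpha 1$ (that is, $a\in S(1)$), and let $S^*$ be the adjoint of $S$. Let $\theta=h^{\frac12-\delta}$ with $\delta\in[0,\frac12]$, and let $B$ be the $h$-pseudodifferential operator $$(Bf)(x)=\frac1{(2\pi h)^n}\iint_{\mathbb R^{2n}} e^{\frac ih\langle x-y,\xi\rangle}b(x,\xi)f(y)\,dy\,d\xi$$ whose symbol $b\in C^\infty(\mathbb R^{2n};\mathbb{C})$ satisfies $$|\partial^\alpha b|\lesssim_\alpha\theta^{-|\alpha|}\quad\text{on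 }\mathbb R^{2n}\text{ for all }\alpha. \tag{1}$$ Then $C=SBS^*$ is (on Schwartz functions) an $h$-pseudodifferential operator, in the same quantization, with a smooth symbol $c(x,\rho)$ that also satisfies (1). If in addition $\operatorname{supp} b\subset\mathscr D$ for some compact set $\mathscr D\subset\mathbb R^{2n}$, then for every $N\ge0$ and every $\alpha$ $$|\partial^\alpha c(x,\rho)|\lesssim_{\alpha,N}\theta^{-|\alpha|}\bigl(1+h^{-1}\theta\, d(x,\rho;\kappa(\mathscr D))\bigr)^{-N},$$ where $d(\cdot\,;\kappa(\mathscr D))$ is the Euclidean distance to the image $\kappa(\mathscr D)$. Furthermore, for every integer $M\ge0$ there is a symbol $c_M$ satisfying (1), with constants that may depend on $M$, such that $\operatorname{supp} c_M\subset\kappa(\mathscr D)$ and, for every $N\ge0$ and every $\alpha$, $$|\partial^\alpha(c-c_M)(y,\eta)|\lesssim_{\alpha,N,M}\theta^{-|\alpha|}(h\theta^{-2})^M\bigl(1+h^{-1}\theta\, d(y,\eta;\kappa(\mathscr D))\bigr)^{-N}.$$ Here $a$, $b$ and $\mathscr D$ may depend on $h$ and $\delta$. Apart from the indices shown and $n$,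 the implicit constants depend only on $\phi$, $\kappa$, a compact set containing $\operatorname{supp}a$, the constants in the bounds for $a$ and in (1) for $b$, and, in the last two estimates, the radius of a ball about $0$ containing $\mathscr D$. In particular they do not depend on $h$ or $\delta$. -/

import Mathlib

open MeasureTheory
open scoped ContDiff InnerProductSpace ComplexConjugate

noncomputable section

/-- Configuration space `ℝⁿ`, with its Euclidean norm and Lebesgue measure. -/
abbrev Config (n : ℕ) : Type := EuclideanSpace ℝ (Fin n)

/-- Phase space `ℝ²ⁿ = ℝⁿ × ℝⁿ`, whose points are pairs (position, momentum). -/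
abbrev Phase (n : ℕ) : Type := Config n × Config n

/-- Euclidean distance in `ℝ²ⁿ` from the point `z` to the set `s` (the product type `Phase n` by
itself carries the sup distance, hence the passage to `WithLp 2`). -/
def phaseDist {n : ℕ} (z : Phase n) (s : Set (Phase n)) : ℝ :=
  Metric.infDist (WithLp.toLp 2 z) (WithLp.toLp 2 '' s)

/-- `b` is smooth on `ℝ²ⁿ` and `|∂^α b| ≤ C_{|α|} θ^{-|α|}` everywhere, for all `α`. The partial
derivatives of order `k` are controlled together, through the norm of the `k`-th derivative. For
`θ = 1` and `C` independent of `h` this is the class `S(1)`. -/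
def IsSymbol {n : ℕ} (θ : ℝ) (C : ℕ → ℝ) (b : Phase n → ℂ) : Prop :=
  ContDiff ℝ ∞ b ∧ ∀ (k : ℕ) (z : Phase n), ‖iteratedFDeriv ℝ k b z‖ ≤ C k * θ⁻¹ ^ k

/-- The standard quantization of `b`:
`(Bf)(x) = (2πh)^{-n} ∬ e^{i⟨x - y, ξ⟩/h} b(x, ξ) f(y) dy dξ`. -/
def standardQuantization {n : ℕ} (h : ℝ) (b : Phase n → ℂ) (f : Config n → ℂ) : Config n → ℂ :=
  fun x => (((2 * Real.pi * h) ^ n : ℝ) : ℂ)⁻¹ *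
    ∫ ξ : Config n, ∫ y : Config n,
      Complex.exp (Complex.I / h * ((⟪x - y, ξ⟫_ℝ : ℝ) : ℂ)) * b (x, ξ) * f y

/-- The `h`-Fourier integral operator with phase `φ` and amplitude `a`:
`(Sf)(x) = (2πh)^{-n} ∬ e^{i(φ(x, η) - ⟨y, η⟩)/h} a(x, η) f(y) dy dη`. -/
def fourierIntegralOp {n : ℕ} (h : ℝ) (φ : Phase n → ℝ) (a : Phase n → ℂ) (f : Config n → ℂ) :
    Config n → ℂ :=
  fun x => (((2 * Real.pi * h) ^ n : ℝ) : ℂ)⁻¹ *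
    ∫ η : Config n, ∫ y : Config n,
      Complex.exp (Complex.I / h * ((φ (x, η) - ⟪y, η⟫_ℝ : ℝ) : ℂ)) * a (x, η) * f y

/-- The adjoint `S*` of the operator above:
`(S*g)(y) = (2πh)^{-n} ∬ e^{-i(φ(x, η) - ⟨y, η⟩)/h} conj(a(x, η)) g(x) dx dη`.
See `inner_fourierIntegralOp` for the duality `⟨Sf, g⟩ = ⟨f, S*g⟩`. -/
def fourierIntegralOpAdjoint {n : ℕ} (h : ℝ) (φ : Phase n → ℝ) (a : Phase n → ℂ)
    (g : Config n → ℂ) : Config n → ℂ :=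
  fun y => (((2 * Real.pi * h) ^ n : ℝ) : ℂ)⁻¹ *
    ∫ η : Config n, ∫ x : Config n,
      Complex.exp (-(Complex.I / h * ((φ (x, η) - ⟪y, η⟫_ℝ : ℝ) : ℂ))) * conj (a (x, η)) * g x

/-- The standard symplectic form `σ((u, μ), (v, ν)) = ⟨μ, v⟩ - ⟨u, ν⟩` on `ℝ²ⁿ`. -/
def symplecticForm {n : ℕ} (u v : Phase n) : ℝ := ⟪u.2, v.1⟫_ℝ - ⟪u.1, v.2⟫_ℝ

/-- `κ : ℝ²ⁿ → ℝ²ⁿ` is a canonical transformation: a diffeomorphism that preserves the standard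
symplectic form. -/
structure IsCanonicalTransformation {n : ℕ} (κ : Phase n → Phase n) : Prop where
  smooth : ContDiff ℝ ∞ κ
  smooth_inverse : ∃ κinv : Phase n → Phase n,
    ContDiff ℝ ∞ κinv ∧ Function.LeftInverse κinv κ ∧ Function.RightInverse κinv κ
  symplectic : ∀ p u v : Phase n,
    symplecticForm (fderiv ℝ κ p u) (fderiv ℝ κ p v) = symplecticForm u v

/-- `φ` generates `κ`: one has `κ(y, η) = (x, ξ)` if and only if `ξ = d_x φ(x, η)` and
`y = d_η φ(x, η)`. -/
def Generates {n : ℕ} (φ : Phase n → ℝ) (κ : Phase n → Phase n) : Prop :=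
  ∀ y η x ξ : Config n, κ (y, η) = (x, ξ) ↔
    ξ = gradient (fun x' : Config n => φ (x', η)) x ∧
    y = gradient (fun η' : Config n => φ (x, η')) η

/-- `SBS*` for the Fourier integral operator `S` with phase `φ` and amplitude `a`, and the
`h`-pseudodifferential operator `B` with symbol `b`. -/
def conjugatedOp {n : ℕ} (h : ℝ) (φ : Phase n → ℝ) (a b : Phase n → ℂ) (g : Config n → ℂ) :
    Config n → ℂ :=
  fourierIntegralOp h φ a (standardQuantization h b (fourierIntegralOpAdjoint h φ a g))

/-- The two operators are adjoint to each other for the `L²` pairing. -/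
theorem inner_fourierIntegralOp {n : ℕ} (h : ℝ) (φ : Phase n → ℝ) (hφ : Continuous φ)
    (a : Phase n → ℂ) (ha : Continuous a) (hac : HasCompactSupport a)
    (f g : Config n → ℂ) (hf : Integrable f) (hg : Integrable g) :
    ∫ x, fourierIntegralOp h φ a f x * conj (g x) =
      ∫ y, f y * conj (fourierIntegralOpAdjoint h φ a g y) := by
  obtain ⟨M, hM⟩ := hac.exists_bound_of_continuous ha
  have hK : IsCompact (Prod.snd '' tsupport a) := hac.isCompact.image continuous_snd
  set B : Set (Config n) := Prod.snd '' tsupport a with hB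
  have hM0 : 0 ≤ M := (norm_nonneg _).trans (hM 0)
  have hle : ∀ x η, ‖a (x, η)‖ ≤ ‖B.indicator (fun _ => (M : ℂ)) η‖ := by
    intro x η
    by_cases hη : η ∈ B
    · rw [Set.indicator_of_mem hη]
      simpa [abs_of_nonneg hM0] using hM (x, η)
    · have : a (x, η) = 0 := by
        by_contra hne
        exact hη ⟨(x, η), subset_tsupport a hne, rfl⟩
      simp [this]
  have hind : Integrable (B.indicator (fun _ => (M : ℂ))) :=
    (integrable_indicator_iff hK.measurableSet).2 (integrableOn_const hK.measure_lt_top.ne)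
  set e : Config n → Config n → Config n → ℂ := fun x η y =>
    Complex.exp (Complex.I / h * ((φ (x, η) - ⟪y, η⟫_ℝ : ℝ) : ℂ)) with he
  have henorm : ∀ x η y, ‖e x η y‖ = 1 := by
    intro x η y
    have : Complex.I / h * ((φ (x, η) - ⟪y, η⟫_ℝ : ℝ) : ℂ) =
        (((φ (x, η) - ⟪y, η⟫_ℝ) / h : ℝ) : ℂ) * Complex.I := by push_cast; ring
    simp only [he, this, Complex.norm_exp_ofReal_mul_I]
  have hecont : Continuous fun p : Config n × Config n × Config n => e p.1 p.2.1 p.2.2 := by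
    simp only [he]; fun_prop
  set F : Config n → Config n → Config n → ℂ := fun x η y =>
    e x η y * a (x, η) * f y * conj (g x) with hF
  have hgc : Integrable fun x => conj (g x) :=
    hg.mono (Complex.continuous_conj.comp_aestronglyMeasurable hg.1) (by simp)
  have hint : Integrable (fun p : Config n × Config n × Config n => F p.1 p.2.1 p.2.2)
      (volume.prod (volume.prod volume)) := by
    have hdom := hgc.mul_prod (hind.mul_prod hf)
    refine hdom.mono ?_ (Filter.Eventually.of_forall ?_)
    · have h1 := (hf.1.comp_snd (μ := (volume : Measure (Config n)))).comp_snd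
        (μ := (volume : Measure (Config n)))
      have h2 := hgc.1.comp_fst (ν := (volume : Measure (Config n × Config n)))
      have h3 : Continuous fun p : Config n × Config n × Config n => a (p.1, p.2.1) := by fun_prop
      exact ((hecont.mul h3).aestronglyMeasurable.mul h1).mul h2
    · rintro ⟨x, η, y⟩
      simp only [hF, norm_mul, henorm, one_mul]
      have := mul_le_mul_of_nonneg_right (mul_le_mul_of_nonneg_right (hle x η)
        (norm_nonneg (f y))) (norm_nonneg (conj (g x)))
      linarith
  have hswap : ∫ x, ∫ η, ∫ y, F x η y = ∫ y, ∫ η, ∫ x, F x η y := by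
    have e1 : ∫ x, ∫ η, ∫ y, F x η y = ∫ x, ∫ q : Config n × Config n, F x q.1 q.2 := by
      refine integral_congr_ae ?_
      filter_upwards [hint.prod_right_ae] with x hx
      exact (integral_prod _ hx).symm
    rw [e1, integral_integral_swap hint]
    have h2 : Integrable (fun q : Config n × Config n => ∫ x, F x q.1 q.2)
      (volume.prod volume) := hint.integral_prod_right
    exact integral_prod_symm _ h2
  have hL : ∀ x, fourierIntegralOp h φ a f x * conj (g x) =
      (((2 * Real.pi * h) ^ n : ℝ) : ℂ)⁻¹ * ∫ η, ∫ y, F x η y := by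
    intro x
    simp only [fourierIntegralOp, hF, integral_mul_const, he]
    ring
  have hR : ∀ y, f y * conj (fourierIntegralOpAdjoint h φ a g y) =
      (((2 * Real.pi * h) ^ n : ℝ) : ℂ)⁻¹ * ∫ η, ∫ x, F x η y := by
    intro y
    have hpt : ∀ x η, F x η y = f y * conj (Complex.exp
        (-(Complex.I / h * ((φ (x, η) - ⟪y, η⟫_ℝ : ℝ) : ℂ))) * conj (a (x, η)) * g x) := by
      intro x η
      simp only [hF, he, map_mul, ← Complex.exp_conj, map_neg, map_div₀, Complex.conj_I,
        Complex.conj_ofReal, Complex.conj_conj]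
      rw [neg_div, neg_mul, neg_neg]
      ring
    simp only [hpt, integral_const_mul, integral_conj]
    simp only [fourierIntegralOpAdjoint, map_mul (starRingEnd ℂ) (((2 * Real.pi * h) ^ n : ℝ) : ℂ)⁻¹,
      map_inv₀, Complex.conj_ofReal]
    ring
  simp only [hL, hR, integral_const_mul, hswap]

end

/-! Testing `SBS*` on plane waves suggests the symbol c(x,ρ) = (2πh)^{-2n} ∫ e^{iΦ/h} a(x,η) conj
a(x',ξ) b(y,ξ) dy dξ dη dx' with Φ = φ(x,η) - φ(x',ξ) + ⟨y, ξ-η⟩ - ⟨x-x', ρ⟩. That its quantization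
really is `SBS*` is `conjugatedOp_eq_standardQuantization`, a matter of Fourier inversion, Parseval
and Fubini. What remains is to estimate an oscillatory integral whose amplitude varies on the scale
θ ≥ √h.

Write p = (x,ρ) and z = ((y,ξ),(η,x')). The equations ∂_zΦ = 0 say ξ = η, y = d_ηφ(x,η) = d_ηφ(x',ξ)
and ρ = d_xφ(x',ξ), so by the generating property of φ the only critical point has (y,ξ) = κ⁻¹(x,ρ),
η = ξ, x' = x. More is true (`exists_critPhase`): both z - crit(p) and ∂_pΦ are linear in ∂_zΦ with
smooth coefficients. This global algebraic statement replaces nondegeneracy of the Hessian and the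
Morse lemma; every estimate below comes from integration by parts in z. Three consequences carry the
proof.

(1) Some field B₀ turns dΦ into |z - crit(p)|². The operator built from it that fixes e^{iΦ/h}
gains, at each use, hσ⁻¹(θ⁻¹ + σ⁻¹) with σ = √(h + |z - crit(p)|²). As θ ≥ √h, this is at most
2√h/σ. Enough uses localize the integral to |z - crit(p)| ≲ √h and give the size h^{2n} (the fiber
has dimension 4n), cancelling the prefactor. Further uses give powers of h/(θr) when the amplitude
lives at distance r ≥ θ from the critical point (`CritPhase.norm_oscIntegral_le`).

(2) A derivative in p that falls on e^{iΦ/h} brings down ∂_pΦ/h, which is linear in ∂_zΦ and is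
integrated by parts without loss in h. Each derivative therefore costs only θ⁻¹
(`CritPhase.norm_iteratedFDeriv_oscIntegral_le`).

(3) An amplitude is its value at the critical point times a fixed cutoff, plus an f vanishing on the
critical set. Such an f is a multiple of z - crit(p), hence of ∂_zΦ, and one integration by parts
gains h/θ². Iterating gives c_M, supported where the critical point meets the support of the
amplitude, that is, in κ(D) (`CritPhase.exists_expansion`).

For the decay in d = d(p; κ(D)), two regimes are combined in
`CritPhase.exists_norm_iteratedFDeriv_error_le`. If d ≳ θ, (1) applies directly. If d ≲ θ and p is
outside κ(D), the expansion of order M + N vanishes near p, and its error (h/θ²)^{M+N} suffices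
because (h/θ²)(h⁻¹θd) = d/θ ≲ 1. The bound on c itself is the case M = 0 with c₀ = 0.

The variables y and ρ are not confined by a. A cutoff in (y,ρ) restores compactness, and the
complement is O(h^N(1+|p|)^{-N}) with all derivatives, since the kernel of S decays rapidly in y
where |y| exceeds the range of d_ηφ on the support of a, and the kernel of S* likewise in ρ
(`exists_symbolIntegral_remainder`).

All bounds are stated for families over an arbitrary index type, uniformly in the index. Taking the
index to be the set of all admissible data (h,θ,a,b) makes the constants independent of them. -/

noncomputable section

/-! ### Calculus of symbol families with uniform bounds. -/

section SymbolClasses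

variable {ι ι' X Y F G H : Type*} [NormedAddCommGroup X] [NormedSpace ℝ X]
  [NormedAddCommGroup Y] [NormedSpace ℝ Y] [NormedAddCommGroup F] [NormedSpace ℝ F]
  [NormedAddCommGroup G] [NormedSpace ℝ G] [NormedAddCommGroup H] [NormedSpace ℝ H]

/-- The `k`-th derivatives of the family `f` are bounded by a multiple of `w * m ^ k` on `s`,
uniformly in the index. -/
def OrderBound (s : Set X) (w m : ι → X → ℝ) (f : ι → X → F) (k : ℕ) : Prop :=
  ∃ C, 0 ≤ C ∧ ∀ i, ∀ x ∈ s, ‖iteratedFDeriv ℝ k (f i) x‖ ≤ C * (w i x * m i x ^ k)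

/-- A family of smooth functions with `‖∂^k f‖ ≤ C_k w m ^ k` on `s`, uniformly in the index. -/
structure SymbolOn (s : Set X) (w m : ι → X → ℝ) (f : ι → X → F) : Prop where
  contDiff : ∀ i, ContDiff ℝ ∞ (f i)
  bound : ∀ k, OrderBound s w m f k

variable {s t : Set X} {w w₁ w₂ w' m m' : ι → X → ℝ}

/-- Leibniz rule. It is kept at one order k, with input only up to order k, so that inductions which
do not yet know the higher derivatives can use it. -/
theorem OrderBound.bilinear (B : F →L[ℝ] G →L[ℝ] H) {f : ι → X → F} {g : ι → X → G}
    (hf : ∀ i, ContDiff ℝ ∞ (f i)) (hg : ∀ i, ContDiff ℝ ∞ (g i)) {k : ℕ}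
    (hfk : ∀ j ≤ k, OrderBound s w₁ m f j) (hgk : ∀ j ≤ k, OrderBound s w₂ m g j) :
    OrderBound s (fun i x => w₁ i x * w₂ i x) m (fun i x => B (f i x) (g i x)) k := by
  choose! C hC0 hC using hfk
  choose! D hD0 hD using hgk
  refine ⟨‖B‖ * ∑ j ∈ Finset.range (k + 1), (k.choose j : ℝ) * (C j * D (k - j)), ?_, ?_⟩
  · refine mul_nonneg (by positivity) (Finset.sum_nonneg fun j hj => ?_)
    have hjk : j ≤ k := Nat.lt_succ_iff.1 (Finset.mem_range.1 hj)
    have := hC0 j hjk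
    have := hD0 (k - j) (Nat.sub_le _ _)
    positivity
  · intro i x hx
    refine (B.norm_iteratedFDeriv_le_of_bilinear (hf i) (hg i) x (n := k)
      (by exact_mod_cast le_top)).trans ?_
    simp only [mul_assoc ‖B‖, Finset.sum_mul]
    refine mul_le_mul_of_nonneg_left (Finset.sum_le_sum fun j hj => ?_) (by positivity)
    have hjk : j ≤ k := Nat.lt_succ_iff.1 (Finset.mem_range.1 hj)
    have h1 := hC j hjk i x hx
    have h2 := hD (k - j) (Nat.sub_le _ _) i x hx
    calc (k.choose j : ℝ) * ‖iteratedFDeriv ℝ j (f i) x‖ * ‖iteratedFDeriv ℝ (k - j) (g i) x‖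
        = (k.choose j : ℝ) * (‖iteratedFDeriv ℝ j (f i) x‖ *
            ‖iteratedFDeriv ℝ (k - j) (g i) x‖) := by ring
      _ ≤ (k.choose j : ℝ) * ((C j * (w₁ i x * m i x ^ j)) *
            (D (k - j) * (w₂ i x * m i x ^ (k - j)))) := by
          gcongr
          exact (norm_nonneg _).trans h1
      _ = (k.choose j : ℝ) * (C j * D (k - j)) * (w₁ i x * w₂ i x * m i x ^ k) := by
          rw [← Nat.add_sub_of_le hjk, pow_add, Nat.add_sub_cancel_left]
          ring

theorem OrderBound.mono_weight {f : ι → X → F} {k : ℕ} (hf : OrderBound s w m f k)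
    (hm : ∀ i, ∀ x ∈ s, 0 ≤ m i x) {c : ℝ} (hc : 0 ≤ c)
    (h : ∀ i, ∀ x ∈ s, w i x ≤ c * w' i x) : OrderBound s w' m f k := by
  obtain ⟨C, hC0, hC⟩ := hf
  refine ⟨C * c, mul_nonneg hC0 hc, fun i x hx => (hC i x hx).trans ?_⟩
  have := h i x hx
  have := pow_nonneg (hm i x hx) k
  calc C * (w i x * m i x ^ k) ≤ C * (c * w' i x * m i x ^ k) := by gcongr
    _ = _ := by ring

theorem OrderBound.fderiv {f : ι → X → F} {k : ℕ} (hf : OrderBound s w m f (k + 1)) :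
    OrderBound s (fun i x => w i x * m i x) m (fun i => fderiv ℝ (f i)) k := by
  obtain ⟨C, hC0, hC⟩ := hf
  refine ⟨C, hC0, fun i x hx => ?_⟩
  rw [norm_iteratedFDeriv_fderiv]
  refine (hC i x hx).trans (le_of_eq ?_)
  ring

theorem OrderBound.of_fderiv {f : ι → X → F} {k : ℕ}
    (hf : OrderBound s (fun i x => w i x * m i x) m (fun i => _root_.fderiv ℝ (f i)) k) :
    OrderBound s w m f (k + 1) := by
  obtain ⟨C, hC0, hC⟩ := hf
  refine ⟨C, hC0, fun i x hx => ?_⟩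
  rw [← norm_iteratedFDeriv_fderiv]
  refine (hC i x hx).trans (le_of_eq ?_)
  ring

namespace SymbolOn

theorem mono_weight {f : ι → X → F} (hf : SymbolOn s w m f) (hm : ∀ i, ∀ x ∈ s, 0 ≤ m i x)
    {c : ℝ} (hc : 0 ≤ c) (h : ∀ i, ∀ x ∈ s, w i x ≤ c * w' i x) : SymbolOn s w' m f :=
  ⟨hf.contDiff, fun k => (hf.bound k).mono_weight hm hc h⟩

theorem congr_weight {f : ι → X → F} (hf : SymbolOn s w m f)
    (h : ∀ i, ∀ x ∈ s, w i x = w' i x) : SymbolOn s w' m f := by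
  refine ⟨hf.contDiff, fun k => ?_⟩
  obtain ⟨C, hC0, hC⟩ := hf.bound k
  exact ⟨C, hC0, fun i x hx => by rw [← h i x hx]; exact hC i x hx⟩

theorem mono_scale {f : ι → X → F} (hf : SymbolOn s w m f) (hw : ∀ i, ∀ x ∈ s, 0 ≤ w i x)
    (hm : ∀ i, ∀ x ∈ s, 0 ≤ m i x) (h : ∀ i, ∀ x ∈ s, m i x ≤ m' i x) : SymbolOn s w m' f := by
  refine ⟨hf.contDiff, fun k => ?_⟩
  obtain ⟨C, hC0, hC⟩ := hf.bound k
  refine ⟨C, hC0, fun i x hx => (hC i x hx).trans ?_⟩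
  have := h i x hx
  have := hm i x hx
  have := hw i x hx
  gcongr

theorem mono_set {f : ι → X → F} (hf : SymbolOn s w m f) (h : t ⊆ s) : SymbolOn t w m f := by
  refine ⟨hf.contDiff, fun k => ?_⟩
  obtain ⟨C, hC0, hC⟩ := hf.bound k
  exact ⟨C, hC0, fun i x hx => hC i x (h hx)⟩

theorem reindex {f : ι → X → F} (hf : SymbolOn s w m f) (r : ι' → ι) :
    SymbolOn s (fun i => w (r i)) (fun i => m (r i)) (fun i => f (r i)) := by
  refine ⟨fun i => hf.contDiff _, fun k => ?_⟩
  obtain ⟨C, hC0, hC⟩ := hf.bound k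
  exact ⟨C, hC0, fun i x hx => hC (r i) x hx⟩

theorem of_isCompact {f : X → F} (hf : ContDiff ℝ ∞ f) (hs : IsCompact s) :
    SymbolOn s (fun _ _ => 1) (fun _ _ => 1) (fun _ : ι => f) := by
  refine ⟨fun _ => hf, fun k => ?_⟩
  have hc : Continuous (iteratedFDeriv ℝ k f) :=
    hf.continuous_iteratedFDeriv (by exact_mod_cast le_top)
  obtain ⟨C, hC⟩ := hs.exists_bound_of_continuousOn hc.continuousOn
  exact ⟨max C 0, le_max_right _ _, fun _ x hx => by
    simpa using Or.inl (hC x hx)⟩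

/-- A fixed smooth function on a compact set belongs to every class of scale at least one. -/
theorem of_isCompact_of_one_le {f : X → F} (hf : ContDiff ℝ ∞ f) (hs : IsCompact s)
    (hm : ∀ i, ∀ x ∈ s, 1 ≤ m i x) : SymbolOn s (fun _ _ => 1) m (fun _ : ι => f) :=
  (of_isCompact hf hs).mono_scale (fun _ _ _ => zero_le_one) (fun _ _ _ => zero_le_one) hm

theorem bilinear (B : F →L[ℝ] G →L[ℝ] H) {f : ι → X → F} {g : ι → X → G}
    (hf : SymbolOn s w₁ m f) (hg : SymbolOn s w₂ m g) :
    SymbolOn s (fun i x => w₁ i x * w₂ i x) m (fun i x => B (f i x) (g i x)) :=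
  ⟨fun i => (B.isBoundedBilinearMap.contDiff.comp ((hf.contDiff i).prodMk (hg.contDiff i)) :),
    fun _ => OrderBound.bilinear B hf.contDiff hg.contDiff (fun j _ => hf.bound j)
      fun j _ => hg.bound j⟩

theorem smul {𝕜 : Type*} [NontriviallyNormedField 𝕜] [NormedAlgebra ℝ 𝕜] [NormedSpace 𝕜 F]
    [IsScalarTower ℝ 𝕜 F] {f : ι → X → 𝕜} {g : ι → X → F}
    (hf : SymbolOn s w₁ m f) (hg : SymbolOn s w₂ m g) :
    SymbolOn s (fun i x => w₁ i x * w₂ i x) m (fun i x => f i x • g i x) :=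
  hf.bilinear (ContinuousLinearMap.lsmul ℝ 𝕜) hg

theorem mul {A : Type*} [NormedRing A] [NormedAlgebra ℝ A] {f g : ι → X → A}
    (hf : SymbolOn s w₁ m f) (hg : SymbolOn s w₂ m g) :
    SymbolOn s (fun i x => w₁ i x * w₂ i x) m (fun i x => f i x * g i x) :=
  hf.bilinear (ContinuousLinearMap.mul ℝ A) hg

theorem smulRight {f : ι → X → F →L[ℝ] ℝ} {g : ι → X → G}
    (hf : SymbolOn s w₁ m f) (hg : SymbolOn s w₂ m g) :
    SymbolOn s (fun i x => w₁ i x * w₂ i x) m (fun i x => (f i x).smulRight (g i x)) :=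
  hf.bilinear (H := F →L[ℝ] G) (ContinuousLinearMap.smulRightL ℝ F G) hg

theorem clm_comp {f : ι → X → G →L[ℝ] H} {g : ι → X → F →L[ℝ] G}
    (hf : SymbolOn s w₁ m f) (hg : SymbolOn s w₂ m g) :
    SymbolOn s (fun i x => w₁ i x * w₂ i x) m (fun i x => (f i x).comp (g i x)) :=
  hf.bilinear (ContinuousLinearMap.compL ℝ F G H) hg

theorem add {f g : ι → X → F} (hf : SymbolOn s w m f) (hg : SymbolOn s w m g) :
    SymbolOn s w m (fun i x => f i x + g i x) := by
  refine ⟨fun i => (hf.contDiff i).add (hg.contDiff i), fun k => ?_⟩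
  obtain ⟨C, hC0, hC⟩ := hf.bound k
  obtain ⟨D, hD0, hD⟩ := hg.bound k
  refine ⟨C + D, add_nonneg hC0 hD0, fun i x hx => ?_⟩
  have hfk : ContDiff ℝ k (f i) := (hf.contDiff i).of_le (by exact_mod_cast le_top)
  have hgk : ContDiff ℝ k (g i) := (hg.contDiff i).of_le (by exact_mod_cast le_top)
  have : iteratedFDeriv ℝ k (fun x => f i x + g i x) x =
      iteratedFDeriv ℝ k (f i) x + iteratedFDeriv ℝ k (g i) x :=
    iteratedFDeriv_add_apply hfk.contDiffAt hgk.contDiffAt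
  rw [this, add_mul]
  exact (norm_add_le _ _).trans (add_le_add (hC i x hx) (hD i x hx))

theorem const_clm (L : F →L[ℝ] G) {f : ι → X → F} (hf : SymbolOn s w m f) :
    SymbolOn s w m (fun i x => L (f i x)) := by
  refine ⟨fun i => L.contDiff.comp (hf.contDiff i), fun k => ?_⟩
  obtain ⟨C, hC0, hC⟩ := hf.bound k
  refine ⟨‖L‖ * C, by positivity, fun i x hx => ?_⟩
  refine (L.norm_iteratedFDeriv_comp_left (f := f i) (x := x) (N := ∞) (n := k)
    (hf.contDiff i).contDiffAt (by exact_mod_cast le_top)).trans ?_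
  rw [mul_assoc]
  exact mul_le_mul_of_nonneg_left (hC i x hx) (by positivity)

theorem neg {f : ι → X → F} (hf : SymbolOn s w m f) : SymbolOn s w m (fun i x => - f i x) :=
  hf.const_clm (-ContinuousLinearMap.id ℝ F)

theorem sub {f g : ι → X → F} (hf : SymbolOn s w m f) (hg : SymbolOn s w m g) :
    SymbolOn s w m (fun i x => f i x - g i x) := by
  simpa only [sub_eq_add_neg] using hf.add hg.neg

theorem zero :
    SymbolOn s w m (fun _ _ => (0 : F)) := by
  refine ⟨fun i => contDiff_const, fun k => ⟨0, le_rfl, fun i x hx => ?_⟩⟩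
  have : iteratedFDeriv ℝ k (fun _ : X => (0 : F)) x = 0 := by
    rw [iteratedFDeriv_fun_zero]; rfl
  simp [this]

theorem sum {κ : Type*} (S : Finset κ) {f : κ → ι → X → F} (hf : ∀ j ∈ S, SymbolOn s w m (f j)) :
    SymbolOn s w m (fun i x => ∑ j ∈ S, f j i x) := by
  classical
  induction S using Finset.induction_on with
  | empty => simpa using zero
  | insert a S ha ih =>
    simp only [Finset.sum_insert ha]
    exact (hf a (Finset.mem_insert_self _ _)).add
      (ih fun j hj => hf j (Finset.mem_insert_of_mem hj))

theorem fderiv {f : ι → X → F} (hf : SymbolOn s w m f) :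
    SymbolOn s (fun i x => w i x * m i x) m (fun i => fderiv ℝ (f i)) :=
  ⟨fun i => (hf.contDiff i).fderiv_right (by exact_mod_cast le_top),
    fun k => (hf.bound (k + 1)).fderiv⟩

/-- The scalar may depend on the index; this is how powers of h and θ enter and leave the weights.
-/
theorem const_smul {𝕜 : Type*} [NormedField 𝕜] [NormedSpace 𝕜 F] [SMulCommClass ℝ 𝕜 F]
    (c : ι → 𝕜) {f : ι → X → F} (hf : SymbolOn s w m f) :
    SymbolOn s (fun i x => ‖c i‖ * w i x) m (fun i x => c i • f i x) := by
  refine ⟨fun i => (hf.contDiff i).const_smul _, fun k => ?_⟩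
  obtain ⟨C, hC0, hC⟩ := hf.bound k
  refine ⟨C, hC0, fun i x hx => ?_⟩
  have hfk : ContDiff ℝ k (f i) := (hf.contDiff i).of_le (by exact_mod_cast le_top)
  have : iteratedFDeriv ℝ k (fun x => c i • f i x) x = c i • iteratedFDeriv ℝ k (f i) x :=
    iteratedFDeriv_const_smul_apply hfk.contDiffAt
  rw [this, norm_smul]
  calc ‖c i‖ * ‖iteratedFDeriv ℝ k (f i) x‖ ≤ ‖c i‖ * (C * (w i x * m i x ^ k)) := by
        gcongr; exact hC i x hx
    _ = _ := by ring

/-- A family solving a linear differential equation whose coefficient obeys symbol bounds, given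
bounds of at most that order for the family itself, is a symbol. -/
theorem of_fderiv_eq (B : F →L[ℝ] G →L[ℝ] (X →L[ℝ] F)) {f : ι → X → F} {g : ι → X → G}
    (hf : ∀ i, ContDiff ℝ ∞ (f i)) (hg : ∀ i, ContDiff ℝ ∞ (g i))
    (hf0 : OrderBound s w m f 0) (h : ∀ i x, _root_.fderiv ℝ (f i) x = B (f i x) (g i x))
    (hgk : ∀ k, (∀ j ≤ k, OrderBound s w m f j) → OrderBound s m m g k) :
    SymbolOn s w m f := by
  refine ⟨hf, fun k => ?_⟩
  induction k using Nat.strong_induction_on with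
  | _ k ih =>
    cases k with
    | zero => exact hf0
    | succ k =>
      -- The equation writes the derivative of order k + 1 through derivatives of order at most k of
      -- f and g, and the latter are controlled by `hgk`.
      refine OrderBound.of_fderiv ?_
      have hfun : (fun i => _root_.fderiv ℝ (f i)) = fun i x => B (f i x) (g i x) := by
        funext i x; exact h i x
      rw [hfun]
      exact OrderBound.bilinear B hf hg (fun j hj => ih j (by omega))
        fun j hj => hgk j fun l hl => ih l (by omega)

/-- The reciprocal u = 1/f solves du = -u·(u df). The coefficient u df has weight w⁻¹·(wm) = m, and
its k-th derivative involves u only up to order k, so `of_fderiv_eq` applies. -/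
theorem inv {f : ι → X → ℝ} (hf : SymbolOn s w m f) (hpos : ∀ i x, 0 < f i x)
    (hm : ∀ i, ∀ x ∈ s, 0 ≤ m i x) (hw : ∀ i, ∀ x ∈ s, 0 < w i x) {c : ℝ} (hc : 0 < c)
    (hlow : ∀ i, ∀ x ∈ s, c * w i x ≤ f i x) :
    SymbolOn s (fun i x => (w i x)⁻¹) m (fun i x => (f i x)⁻¹) := by
  have hsm : ∀ i, ContDiff ℝ ∞ (fun x => (f i x)⁻¹) := fun i =>
    (hf.contDiff i).inv fun x => (hpos i x).ne'
  have hfd : ∀ i, ContDiff ℝ ∞ (_root_.fderiv ℝ (f i)) := fun i =>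
    (hf.contDiff i).fderiv_right (by exact_mod_cast le_top)
  refine of_fderiv_eq (G := X →L[ℝ] ℝ)
    (-(ContinuousLinearMap.lsmul ℝ ℝ : ℝ →L[ℝ] (X →L[ℝ] ℝ) →L[ℝ] (X →L[ℝ] ℝ)))
    (g := fun i x => (f i x)⁻¹ • _root_.fderiv ℝ (f i) x) hsm
    (fun i => (hsm i).smul (hfd i)) ?_ ?_ ?_
  · refine ⟨c⁻¹, by positivity, fun i x hx => ?_⟩
    have h1 := hlow i x hx
    have h2 := hw i x hx
    rw [norm_iteratedFDeriv_zero, Real.norm_of_nonneg (inv_pos.2 (hpos i x)).le, pow_zero, mul_one,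
      ← mul_inv]
    exact inv_anti₀ (by positivity) h1
  · intro i x
    have hd : DifferentiableAt ℝ (f i) x := (hf.contDiff i).differentiable (by simp) x
    have h1 := ((hasDerivAt_inv (hpos i x).ne').comp_hasFDerivAt x hd.hasFDerivAt).fderiv
    simp only [Function.comp_def] at h1
    ext v
    rw [h1]
    simp
    ring
  · intro k hk
    have := OrderBound.bilinear (k := k)
      (ContinuousLinearMap.lsmul ℝ ℝ : ℝ →L[ℝ] (X →L[ℝ] ℝ) →L[ℝ] (X →L[ℝ] ℝ)) hsm hfd hk
      (fun j _ => hf.fderiv.bound j)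
    refine this.mono_weight hm zero_le_one fun i x hx => le_of_eq ?_
    have := hw i x hx
    field_simp

/-- The exponential u solves du = u·(i df), so only the derivative of the exponent has to be
bounded, not the exponent. -/
theorem cexp {f : ι → X → ℝ} (hf : ∀ i, ContDiff ℝ ∞ (f i))
    (hfd : SymbolOn s m m (fun i => _root_.fderiv ℝ (f i))) :
    SymbolOn s (fun _ _ => 1) m (fun i x => Complex.exp (Complex.I * (f i x : ℂ))) := by
  have hsm : ∀ i, ContDiff ℝ ∞ (fun x => Complex.exp (Complex.I * (f i x : ℂ))) := fun i =>
    (contDiff_const.mul (Complex.ofRealCLM.contDiff.comp (hf i))).cexp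
  refine of_fderiv_eq (G := X →L[ℝ] ℂ)
    (ContinuousLinearMap.lsmul ℝ ℂ : ℂ →L[ℝ] (X →L[ℝ] ℂ) →L[ℝ] (X →L[ℝ] ℂ))
    (g := fun i x => Complex.I • (Complex.ofRealCLM.comp (_root_.fderiv ℝ (f i) x))) hsm
    ?_ ?_ ?_ ?_
  · intro i
    have h1 : ContDiff ℝ ∞ (_root_.fderiv ℝ (f i)) :=
      (hf i).fderiv_right (by exact_mod_cast le_top)
    exact ((ContinuousLinearMap.compL ℝ X ℝ ℂ Complex.ofRealCLM).contDiff.comp h1).const_smul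
      Complex.I
  · refine ⟨1, zero_le_one, fun i x hx => ?_⟩
    rw [norm_iteratedFDeriv_zero]
    simp [Complex.norm_exp]
  · intro i x
    have hd : HasFDerivAt (f i) (_root_.fderiv ℝ (f i) x) x :=
      ((hf i).differentiable (by simp) x).hasFDerivAt
    have h1 : HasFDerivAt (fun x => Complex.I * (f i x : ℂ))
        (Complex.I • (Complex.ofRealCLM.comp (_root_.fderiv ℝ (f i) x))) x :=
      (Complex.ofRealCLM.hasFDerivAt.comp x hd).const_mul Complex.I
    exact h1.cexp.fderiv
  · intro k _
    have h1 := (hfd.const_clm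
      (ContinuousLinearMap.compL ℝ X ℝ ℂ Complex.ofRealCLM)).const_smul
      (fun _ => Complex.I)
    have h2 : SymbolOn s m m (fun i x => Complex.I •
      (Complex.ofRealCLM.comp (_root_.fderiv ℝ (f i) x))) := by
      refine h1.congr_weight fun i x _ => by simp
    exact h2.bound k

/-- Composition on the right with a family of maps with bounded derivatives. -/
theorem comp {t : Set Y} {f : ι → X → F} {g : ι → Y → X} {μ v : ι → ℝ}
    (hf : SymbolOn s (fun i _ => v i) (fun i _ => μ i) f)
    (hg : SymbolOn t (fun _ _ => 1) (fun _ _ => 1) g) (hμ : ∀ i, 1 ≤ μ i) (hv : ∀ i, 0 ≤ v i)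
    (hst : ∀ i, Set.MapsTo (g i) t s) :
    SymbolOn t (fun i _ => v i) (fun i _ => μ i) (fun i y => f i (g i y)) := by
  refine ⟨fun i => (hf.contDiff i).comp (hg.contDiff i), fun k => ?_⟩
  choose C hC0 hC using hf.bound
  choose D hD0 hD using hg.bound
  set C' := ∑ j ∈ Finset.range (k + 1), C j with hC'
  -- The bound for compositions asks that the j-th derivative of g be at most D'^j. Adding 1 makes
  -- D' ≥ 1, hence D' ≤ D'^j for j ≥ 1.
  set D' := 1 + ∑ j ∈ Finset.range (k + 1), D j with hD'
  have hD'1 : 1 ≤ D' := by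
    rw [hD']; linarith [Finset.sum_nonneg fun j (_ : j ∈ Finset.range (k + 1)) => hD0 j]
  have hC'0 : 0 ≤ C' := Finset.sum_nonneg fun j _ => hC0 j
  refine ⟨k.factorial * C' * D' ^ k, by positivity, fun i y hy => ?_⟩
  have := norm_iteratedFDeriv_comp_le (n := k) (N := ∞) (hf.contDiff i) (hg.contDiff i)
    (by exact_mod_cast le_top) y (C := C' * (v i * μ i ^ k)) (D := D') ?_ ?_
  · refine this.trans (le_of_eq ?_)
    ring
  · intro j hj
    refine (hC j i _ (hst i hy)).trans ?_
    have h1 : C j ≤ C' := Finset.single_le_sum (fun j _ => hC0 j)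
      (Finset.mem_range.2 (Nat.lt_succ_of_le hj))
    have h2 : μ i ^ j ≤ μ i ^ k := pow_le_pow_right₀ (hμ i) hj
    have := hv i
    have := hC0 j
    have : 0 ≤ μ i := zero_le_one.trans (hμ i)
    gcongr
  · intro j hj1 hj
    refine (hD j i y hy).trans ?_
    have h1 : D j ≤ ∑ j ∈ Finset.range (k + 1), D j := Finset.single_le_sum (fun j _ => hD0 j)
      (Finset.mem_range.2 (Nat.lt_succ_of_le hj))
    have h2 : D' ≤ D' ^ j := le_self_pow₀ hD'1 (by omega)
    simp only [one_pow, mul_one]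
    linarith

/-- Off the support all derivatives vanish, so bounds on a set containing the support are global. -/
theorem extend {f : ι → X → F} (hf : SymbolOn s w m f) (hw : ∀ i x, 0 ≤ w i x)
    (hm : ∀ i x, 0 ≤ m i x) (hs : ∀ i, tsupport (f i) ⊆ s) : SymbolOn Set.univ w m f := by
  refine ⟨hf.contDiff, fun k => ?_⟩
  obtain ⟨C, hC0, hC⟩ := hf.bound k
  refine ⟨C, hC0, fun i x _ => ?_⟩
  by_cases hx : x ∈ s
  · exact hC i x hx
  · have : iteratedFDeriv ℝ k (f i) x = 0 := by
      by_contra hne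
      exact hx (hs i (support_iteratedFDeriv_subset k hne))
    rw [this, norm_zero]
    have := hw i x
    have := hm i x
    positivity

end SymbolOn

end SymbolClasses

/-! ### Differentiation under the integral sign. -/

section ParametricIntegrals

open Topology

variable {X Y F : Type*} [NormedAddCommGroup X] [NormedSpace ℝ X]
  [NormedAddCommGroup F] [NormedSpace ℝ F]

/-- Smoothness of a parametric integral under local domination of all derivatives. -/
theorem contDiff_integral_and_iteratedFDeriv [CompleteSpace F] [MeasurableSpace Y]
    {μ : Measure Y} {f : X → Y → F} (hf : ∀ y, ContDiff ℝ ∞ (fun x => f x y))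
    (hmeas : ∀ k x, AEStronglyMeasurable (fun y => iteratedFDeriv ℝ k (fun x => f x y) x) μ)
    (hdom : ∀ k x₀, ∃ g : Y → ℝ, Integrable g μ ∧ ∃ U ∈ 𝓝 x₀, ∀ᵐ y ∂μ, ∀ x ∈ U,
      ‖iteratedFDeriv ℝ k (fun x => f x y) x‖ ≤ g y) :
    ContDiff ℝ ∞ (fun x => ∫ y, f x y ∂μ) ∧ ∀ k x,
      iteratedFDeriv ℝ k (fun x => ∫ y, f x y ∂μ) x =
        ∫ y, iteratedFDeriv ℝ k (fun x => f x y) x ∂μ := by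
  have hint : ∀ k x, Integrable (fun y => iteratedFDeriv ℝ k (fun x => f x y) x) μ := by
    intro k x
    obtain ⟨g, hg, U, hU, hb⟩ := hdom k x
    exact hg.mono' (hmeas k x) (hb.mono fun y hy => hy x (mem_of_mem_nhds hU))
  -- The integrated derivatives form a Taylor series of the integral; this gives smoothness and the
  -- formula for all orders at once.
  have key : HasFTaylorSeriesUpTo ∞ (fun x => ∫ y, f x y ∂μ)
      (fun x k => ∫ y, iteratedFDeriv ℝ k (fun x => f x y) x ∂μ) := by
    refine (hasFTaylorSeriesUpTo_top_iff' le_rfl).2 ⟨fun x => ?_, fun m x => ?_⟩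
    · have := (continuousMultilinearCurryFin0 ℝ X F).toContinuousLinearEquiv.integral_comp_comm
        (μ := μ) (fun y => iteratedFDeriv ℝ 0 (fun x => f x y) x)
      refine Eq.trans this.symm ?_
      rfl
    · obtain ⟨g, hg, U, hU, hb⟩ := hdom (m + 1) x
      let L : (X [×(m + 1)]→L[ℝ] F) →L[ℝ] (X →L[ℝ] (X [×m]→L[ℝ] F)) :=
        ((continuousMultilinearCurryLeftEquiv ℝ (fun _ : Fin (m + 1) => X)
          F).toContinuousLinearEquiv : _ →L[ℝ] _)
      have := ContinuousLinearMap.integral_comp_comm (𝕜 := ℝ) (E := X [×(m + 1)]→L[ℝ] F)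
        (Fₗ := X →L[ℝ] (X [×m]→L[ℝ] F)) L (hint (m + 1) x)
      have h2 := hasFDerivAt_integral_of_dominated_of_fderiv_le (𝕜 := ℝ) (μ := μ)
        (F := fun x y => iteratedFDeriv ℝ m (fun x => f x y) x)
        (F' := fun x y => (iteratedFDeriv ℝ (m + 1) (fun x => f x y) x).curryLeft)
        (x₀ := x) (bound := g) hU (Filter.Eventually.of_forall fun x => hmeas m x) (hint m x)
        ((continuousMultilinearCurryLeftEquiv ℝ (fun _ : Fin (m + 1) => X)
          F).continuous.comp_aestronglyMeasurable (hmeas (m + 1) x))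
        (hb.mono fun y hy x hx => ?_) hg
        (Filter.Eventually.of_forall fun y x _ => ?_)
      · refine h2.congr_fderiv ?_
        exact this
      · refine le_trans (le_of_eq ?_) (hy x hx)
        exact (continuousMultilinearCurryLeftEquiv ℝ (fun _ : Fin (m + 1) => X)
          F).norm_map _
      · have := (hf y).ftaylorSeries (𝕜 := ℝ)
        exact this.fderiv m (by exact_mod_cast WithTop.coe_lt_top _) x
  refine ⟨key.contDiff, fun k x => ?_⟩
  exact (key.eq_iteratedFDeriv (m := k) (by exact_mod_cast le_top) x).symm

variable [NormedAddCommGroup Y] [NormedSpace ℝ Y]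

theorem iteratedFDeriv_prodMk_left {f : X × Y → F} (hf : ContDiff ℝ ∞ f) (k : ℕ) (x : X) (y : Y) :
    iteratedFDeriv ℝ k (fun x => f (x, y)) x =
      (iteratedFDeriv ℝ k f (x, y)).compContinuousLinearMap
        (fun _ => ContinuousLinearMap.inl ℝ X Y) := by
  have h1 : (fun x => f (x, y)) = (fun z => f (z + (0, y))) ∘ ContinuousLinearMap.inl ℝ X Y := by
    funext x; simp
  have h2 : ContDiff ℝ ∞ (fun z => f (z + (0, y))) := hf.comp (contDiff_id.add contDiff_const)
  rw [h1, (ContinuousLinearMap.inl ℝ X Y).iteratedFDeriv_comp_right h2 x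
    (by exact_mod_cast le_top), iteratedFDeriv_comp_add_right]
  simp

theorem continuous_iteratedFDeriv_prodMk_left {f : X × Y → F} (hf : ContDiff ℝ ∞ f) (k : ℕ) :
    Continuous (fun z : X × Y => iteratedFDeriv ℝ k (fun x => f (x, z.2)) z.1) := by
  simp only [iteratedFDeriv_prodMk_left hf]
  have h1 : Continuous (iteratedFDeriv ℝ k f) :=
    hf.continuous_iteratedFDeriv (by exact_mod_cast le_top)
  exact (ContinuousMultilinearMap.compContinuousLinearMapL (F := F)
    (fun _ : Fin k => ContinuousLinearMap.inl ℝ X Y)).continuous.comp h1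

/-- Smoothness of the integral of a jointly smooth function over a compact set. -/
theorem contDiff_setIntegral_and_iteratedFDeriv [CompleteSpace F] [FiniteDimensional ℝ X]
    [FiniteDimensional ℝ Y] [MeasurableSpace Y] [BorelSpace Y] {μ : Measure Y}
    [IsFiniteMeasureOnCompacts μ] {f : X × Y → F} (hf : ContDiff ℝ ∞ f) {K : Set Y}
    (hK : IsCompact K) :
    ContDiff ℝ ∞ (fun x => ∫ y in K, f (x, y) ∂μ) ∧ ∀ k x,
      iteratedFDeriv ℝ k (fun x => ∫ y in K, f (x, y) ∂μ) x =
        ∫ y in K, iteratedFDeriv ℝ k (fun x => f (x, y)) x ∂μ := by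
  have : ProperSpace X := FiniteDimensional.proper ℝ X
  have : ProperSpace Y := FiniteDimensional.proper ℝ Y
  have hc := fun k => continuous_iteratedFDeriv_prodMk_left hf k
  refine contDiff_integral_and_iteratedFDeriv (f := fun x y => f (x, y))
    (fun y => hf.comp (contDiff_id.prodMk contDiff_const)) (fun k x => ?_) fun k x₀ => ?_
  · exact ((hc k).comp (Continuous.prodMk_right x)).aestronglyMeasurable
  · obtain ⟨C, hC⟩ := ((isCompact_closedBall x₀ 1).prod hK).exists_bound_of_continuousOn
      (hc k).continuousOn
    refine ⟨fun _ => C, integrableOn_const hK.measure_lt_top.ne, _,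
      Metric.closedBall_mem_nhds x₀ one_pos, ?_⟩
    filter_upwards [ae_restrict_mem hK.measurableSet] with y hy x hx
    exact hC (x, y) ⟨hx, hy⟩

/-- Integrating a family of symbols over `[0, 1]`. -/
theorem SymbolOn.integral_Icc {ι : Type*} [CompleteSpace F] [FiniteDimensional ℝ X] {s : Set X}
    {w m : ι → X → ℝ} {f : ι → X × ℝ → F} (hf : ∀ i, ContDiff ℝ ∞ (f i))
    (h : SymbolOn s (fun j : ι × Set.Icc (0 : ℝ) 1 => w j.1) (fun j => m j.1)
      (fun j x => f j.1 (x, (j.2 : ℝ)))) :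
    SymbolOn s w m (fun i x => ∫ t in Set.Icc (0 : ℝ) 1, f i (x, t)) := by
  refine ⟨fun i => (contDiff_setIntegral_and_iteratedFDeriv (hf i) isCompact_Icc).1, fun k => ?_⟩
  obtain ⟨C, hC0, hC⟩ := h.bound k
  refine ⟨C, hC0, fun i x hx => ?_⟩
  rw [(contDiff_setIntegral_and_iteratedFDeriv (hf i) isCompact_Icc).2]
  refine (norm_setIntegral_le_of_norm_le_const (C := C * (w i x * m i x ^ k))
    (by simp) fun t ht => hC (i, ⟨t, ht⟩) x hx).trans ?_
  simp

end ParametricIntegrals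

/-! ### Hadamard's lemma. -/

section Hadamard

variable {V W : Type*} [NormedAddCommGroup V] [NormedSpace ℝ V]
  [NormedAddCommGroup W] [NormedSpace ℝ W] [CompleteSpace W]

/-- Mean value formula along the segment from `b` to `a`. -/
theorem sub_eq_setIntegral_fderiv {f : V → W} (hf : ContDiff ℝ ∞ f) (a b : V) :
    f a - f b = (∫ t in Set.Icc (0 : ℝ) 1, fderiv ℝ f (b + t • (a - b))) (a - b) := by
  have hcont : Continuous (fun t : ℝ => fderiv ℝ f (b + t • (a - b))) :=
    ((hf.continuous_fderiv (by simp)).comp (by fun_prop))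
  have hd : ∀ t : ℝ, HasDerivAt (fun t : ℝ => f (b + t • (a - b)))
      (fderiv ℝ f (b + t • (a - b)) (a - b)) t := by
    intro t
    have h1 : HasDerivAt (fun t : ℝ => b + t • (a - b)) (a - b) t := by
      simpa using ((hasDerivAt_id t).smul_const (a - b)).const_add b
    exact ((hf.differentiable (by simp) _).hasFDerivAt).comp_hasDerivAt t h1
  have h2 := intervalIntegral.integral_eq_sub_of_hasDerivAt (a := 0) (b := 1)
    (fun t _ => hd t) ((hcont.clm_apply continuous_const).intervalIntegrable _ _)
  rw [ContinuousLinearMap.integral_apply (hcont.integrableOn_Icc)]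
  rw [MeasureTheory.integral_Icc_eq_integral_Ioc, ← intervalIntegral.integral_of_le zero_le_one, h2]
  simp

/-- Hadamard's lemma: `f a - f b` factors smoothly through `a - b`. -/
theorem ContDiff.exists_sub_eq_clm [FiniteDimensional ℝ V] {f : V → W} (hf : ContDiff ℝ ∞ f) :
    ∃ g : V × V → (V →L[ℝ] W), ContDiff ℝ ∞ g ∧ ∀ a b, f a - f b = g (a, b) (a - b) := by
  have h1 : ContDiff ℝ ∞ (fun z : (V × V) × ℝ =>
      fderiv ℝ f (z.1.2 + z.2 • (z.1.1 - z.1.2))) :=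
    (hf.fderiv_right (m := ∞) (by exact_mod_cast le_top)).comp (by fun_prop)
  exact ⟨_, (contDiff_setIntegral_and_iteratedFDeriv (μ := volume) h1
    (isCompact_Icc (a := (0 : ℝ)) (b := 1))).1, fun a b => sub_eq_setIntegral_fderiv hf a b⟩

end Hadamard

/-! ### Oscillatory integrals and integration by parts in the fiber. -/

section OscillatoryIntegrals

set_option linter.unusedSectionVars false

variable {ι P E : Type*} [NormedAddCommGroup P] [NormedSpace ℝ P]
  [NormedAddCommGroup E] [NormedSpace ℝ E]

/-- The oscillating factor `e^{iΦ/h}`. -/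
def oscFactor (h : ℝ) (Φ : P × E → ℝ) (x : P × E) : ℂ := Complex.exp (Complex.I / h * (Φ x : ℂ))

/-- The oscillatory integral `∫ e^{iΦ(p, z)/h} A(p, z) dz`. -/
def oscIntegral [MeasureSpace E] (h : ℝ) (Φ : P × E → ℝ) (A : P × E → ℂ) (p : P) : ℂ :=
  ∫ z, oscFactor h Φ (p, z) * A (p, z)

/-- The derivative of `Φ` in the integration variable. -/
def fiberDeriv (Φ : P × E → ℝ) (x : P × E) : E →L[ℝ] ℝ :=
  (fderiv ℝ Φ x).comp (ContinuousLinearMap.inr ℝ P E)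

theorem norm_oscFactor (h : ℝ) (Φ : P × E → ℝ) (x : P × E) : ‖oscFactor h Φ x‖ = 1 := by
  have : Complex.I / h * (Φ x : ℂ) = ((Φ x / h : ℝ) : ℂ) * Complex.I := by push_cast; ring
  rw [oscFactor, this, Complex.norm_exp_ofReal_mul_I]

theorem contDiff_oscFactor (h : ℝ) {Φ : P × E → ℝ} (hΦ : ContDiff ℝ ∞ Φ) :
    ContDiff ℝ ∞ (oscFactor h Φ) :=
  (contDiff_const.mul (Complex.ofRealCLM.contDiff.comp hΦ)).cexp

theorem fderiv_oscFactor (h : ℝ) {Φ : P × E → ℝ} (hΦ : ContDiff ℝ ∞ Φ) (x v : P × E) :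
    fderiv ℝ (oscFactor h Φ) x v =
      oscFactor h Φ x * (Complex.I / h * (fderiv ℝ Φ x v : ℂ)) := by
  have h1 : HasFDerivAt (fun x => Complex.I / h * (Φ x : ℂ))
      ((Complex.I / h) • (Complex.ofRealCLM.comp (fderiv ℝ Φ x))) x :=
    (Complex.ofRealCLM.hasFDerivAt.comp x (hΦ.differentiable (by simp) x).hasFDerivAt).const_mul _
  have h2 : HasFDerivAt (oscFactor h Φ) _ x := h1.cexp
  rw [h2.fderiv]
  simp [oscFactor]

variable [FiniteDimensional ℝ E]

/-- The covectors dual to a fixed basis of `E`. -/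
def dualCoord (k : Fin (Module.finrank ℝ E)) : E →L[ℝ] ℝ :=
  LinearMap.toContinuousLinearMap ((Module.finBasis ℝ E).coord k)

theorem eq_sum_dualCoord (l : E →L[ℝ] ℝ) :
    l = ∑ k, l (Module.finBasis ℝ E k) • dualCoord k := by
  ext v
  have h := congrArg l ((Module.finBasis ℝ E).sum_repr v)
  rw [map_sum] at h
  rw [← h]
  simp [dualCoord, mul_comm]

/-- The divergence, in the integration variable, of a field of functionals on covectors. -/
def fiberDiv (B : P × E → (E →L[ℝ] ℝ) →L[ℝ] ℂ) (x : P × E) : ℂ :=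
  ∑ k, fderiv ℝ B x (0, Module.finBasis ℝ E k) (dualCoord k)

theorem contDiff_fiberDiv {B : P × E → (E →L[ℝ] ℝ) →L[ℝ] ℂ} (hB : ContDiff ℝ ∞ B) :
    ContDiff ℝ ∞ (fiberDiv B) :=
  ContDiff.sum fun k _ => (((hB.fderiv_right (m := ∞) (by exact_mod_cast le_top)).clm_apply
    contDiff_const).clm_apply contDiff_const)

theorem tsupport_fiberDiv_subset (B : P × E → (E →L[ℝ] ℝ) →L[ℝ] ℂ) :
    tsupport (fiberDiv B) ⊆ tsupport B := by
  refine closure_minimal (fun x hx => ?_) (isClosed_tsupport B)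
  by_contra hxB
  have h0 : fderiv ℝ B x = 0 := by
    by_contra hne
    exact hxB (support_fderiv_subset ℝ hne)
  exact hx (by simp [fiberDiv, h0])

theorem SymbolOn.fiberDiv {s : Set (P × E)} {w m : ι → P × E → ℝ}
    {B : ι → P × E → (E →L[ℝ] ℝ) →L[ℝ] ℂ} (hB : SymbolOn s w m B) :
    SymbolOn s (fun i x => w i x * m i x) m (fun i => fiberDiv (B i)) := by
  unfold _root_.fiberDiv
  refine SymbolOn.sum _ fun k _ => ?_
  exact hB.fderiv.const_clm
    ((ContinuousLinearMap.apply ℝ ℂ (dualCoord k)).comp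
      (ContinuousLinearMap.apply ℝ ((E →L[ℝ] ℝ) →L[ℝ] ℂ)
        ((0, Module.finBasis ℝ E k) : P × E)))

variable [MeasureSpace E] [BorelSpace E] [(volume : Measure E).IsAddHaarMeasure]

theorem hasCompactSupport_fiber {F : Type*} [Zero F] {B : P × E → F}
    {K : Set E} (hK : IsCompact K) (hB : tsupport B ⊆ Prod.snd ⁻¹' K) (p : P) :
    HasCompactSupport (fun z => B (p, z)) := by
  refine HasCompactSupport.intro hK fun z hz => ?_
  by_contra hne
  exact hz (hB (subset_tsupport B hne))

theorem integrable_fiber {F : Type*} [NormedAddCommGroup F] {B : P × E → F}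
    (hBc : Continuous B)
    {K : Set E} (hK : IsCompact K) (hB : tsupport B ⊆ Prod.snd ⁻¹' K) (p : P) :
    Integrable (fun z => B (p, z)) :=
  (hBc.comp (Continuous.prodMk_right p)).integrable_of_hasCompactSupport
    (hasCompactSupport_fiber hK hB p)

theorem integrable_oscFactor_mul {h : ℝ} {Φ : P × E → ℝ} (hΦ : ContDiff ℝ ∞ Φ)
    {A : P × E → ℂ} (hA : ContDiff ℝ ∞ A) {K : Set E} (hK : IsCompact K)
    (hAK : tsupport A ⊆ Prod.snd ⁻¹' K) (p : P) :
    Integrable (fun z => oscFactor h Φ (p, z) * A (p, z)) :=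
  integrable_fiber (B := fun x => oscFactor h Φ x * A x)
    ((contDiff_oscFactor h hΦ).continuous.mul hA.continuous) hK
    ((tsupport_mul_subset_right).trans hAK) p

theorem oscIntegral_add {h : ℝ} {Φ : P × E → ℝ} (hΦ : ContDiff ℝ ∞ Φ)
    {A A' : P × E → ℂ} (hA : ContDiff ℝ ∞ A) (hA' : ContDiff ℝ ∞ A') {K : Set E}
    (hK : IsCompact K) (hAK : tsupport A ⊆ Prod.snd ⁻¹' K) (hAK' : tsupport A' ⊆ Prod.snd ⁻¹' K)
    (p : P) : oscIntegral h Φ (fun x => A x + A' x) p =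
      oscIntegral h Φ A p + oscIntegral h Φ A' p := by
  simp only [oscIntegral, mul_add]
  exact integral_add (integrable_oscFactor_mul hΦ hA hK hAK p)
    (integrable_oscFactor_mul hΦ hA' hK hAK' p)

theorem oscIntegral_const_mul {h : ℝ} {Φ : P × E → ℝ} (c : P → ℂ) (A : P × E → ℂ) (p : P) :
    oscIntegral h Φ (fun x => c x.1 * A x) p = c p * oscIntegral h Φ A p := by
  simp only [oscIntegral, ← integral_const_mul]
  congr 1; funext z; ring

/-- Integration by parts in the integration variable. -/
theorem oscIntegral_clm_fiberDeriv {h : ℝ} (hh : h ≠ 0) {Φ : P × E → ℝ} (hΦ : ContDiff ℝ ∞ Φ)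
    {B : P × E → (E →L[ℝ] ℝ) →L[ℝ] ℂ} (hB : ContDiff ℝ ∞ B) {K : Set E} (hK : IsCompact K)
    (hBK : tsupport B ⊆ Prod.snd ⁻¹' K) (p : P) :
    oscIntegral h Φ (fun x => B x (fiberDeriv Φ x)) p =
      Complex.I * h * oscIntegral h Φ (fiberDiv B) p := by
  set b := Module.finBasis ℝ E with hb
  have hi : ∀ z : E, HasFDerivAt (fun z : E => ((p, z) : P × E))
      (ContinuousLinearMap.inr ℝ P E) z := fun z => hasFDerivAt_prodMk_right p z
  -- the derivatives of the two factors along the fiber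
  have he : ∀ z v, fderiv ℝ (fun z => oscFactor h Φ (p, z)) z v =
      oscFactor h Φ (p, z) * (Complex.I / h * (fiberDeriv Φ (p, z) v : ℂ)) := by
    intro z v
    have h1 := (((contDiff_oscFactor h hΦ).differentiable (by simp)
      (p, z)).hasFDerivAt.comp z (hi z)).fderiv
    simp only [Function.comp_def] at h1
    rw [h1, ContinuousLinearMap.comp_apply, fderiv_oscFactor h hΦ]
    rfl
  have hg : ∀ k z v, fderiv ℝ (fun z => B (p, z) (dualCoord k)) z v =
      fderiv ℝ B (p, z) (0, v) (dualCoord k) := by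
    intro k z v
    have h1 := ((hB.differentiable (by simp) (p, z)).hasFDerivAt.comp z (hi z)).clm_apply
      (hasFDerivAt_const (dualCoord (E := E) k) z)
    have h2 : HasFDerivAt (fun z => B (p, z) (dualCoord k)) _ z := h1
    rw [h2.fderiv]
    simp
  have hgs : ∀ k, ContDiff ℝ ∞ (fun z => B (p, z) (dualCoord k)) := fun k =>
    (hB.comp (contDiff_const.prodMk contDiff_id)).clm_apply contDiff_const
  have hes : ContDiff ℝ ∞ (fun z => oscFactor h Φ (p, z)) :=
    (contDiff_oscFactor h hΦ).comp (contDiff_const.prodMk contDiff_id)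
  have hgc : ∀ k, HasCompactSupport (fun z => B (p, z) (dualCoord k)) := fun k =>
    (hasCompactSupport_fiber hK hBK p).comp_left (g := fun L : (E →L[ℝ] ℝ) →L[ℝ] ℂ =>
      L (dualCoord k)) (by simp)
  have hgc' : ∀ k, HasCompactSupport
      (fun z => fderiv ℝ (fun z => B (p, z) (dualCoord k)) z (b k)) := fun k =>
    (hgc k).fderiv_apply (𝕜 := ℝ) (b k)
  have hgs' : ∀ k, Continuous
      (fun z => fderiv ℝ (fun z => B (p, z) (dualCoord k)) z (b k)) := fun k =>
    ((hgs k).continuous_fderiv (by simp)).clm_apply continuous_const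
  have hes' : ∀ k, Continuous
      (fun z => fderiv ℝ (fun z => oscFactor h Φ (p, z)) z (b k)) := fun k =>
    (hes.continuous_fderiv (by simp)).clm_apply continuous_const
  have ibp : ∀ k, ∫ z, oscFactor h Φ (p, z) *
        fderiv ℝ (fun z => B (p, z) (dualCoord k)) z (b k) =
      - ∫ z, fderiv ℝ (fun z => oscFactor h Φ (p, z)) z (b k) * B (p, z) (dualCoord k) := by
    intro k
    refine integral_mul_fderiv_eq_neg_fderiv_mul_of_integrable ?_ ?_ ?_
      (fun z _ => hes.differentiable (by simp) z) (fun z _ => (hgs k).differentiable (by simp) z)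
    · exact ((hes' k).mul (hgs k).continuous).integrable_of_hasCompactSupport (hgc k).mul_left
    · exact (hes.continuous.mul (hgs' k)).integrable_of_hasCompactSupport (hgc' k).mul_left
    · exact (hes.continuous.mul (hgs k).continuous).integrable_of_hasCompactSupport
        (hgc k).mul_left
  have hsum : oscIntegral h Φ (fiberDiv B) p = ∑ k, ∫ z, oscFactor h Φ (p, z) *
        fderiv ℝ (fun z => B (p, z) (dualCoord k)) z (b k) := by
    rw [← integral_finsetSum]
    · simp only [oscIntegral, fiberDiv, Finset.mul_sum, hg, hb]
    · intro k _
      exact (hes.continuous.mul (hgs' k)).integrable_of_hasCompactSupport (hgc' k).mul_left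
  rw [hsum, Finset.mul_sum]
  -- Differentiating the exponential gives the factor i/h, and ih·(i/h) = -1 cancels the sign of the
  -- integration by parts.
  have hterm : ∀ k, Complex.I * h * ∫ z, oscFactor h Φ (p, z) *
        fderiv ℝ (fun z => B (p, z) (dualCoord k)) z (b k) =
      ∫ z, oscFactor h Φ (p, z) * ((fiberDeriv Φ (p, z) (b k) : ℂ) * B (p, z) (dualCoord k)) := by
    intro k
    rw [ibp k, ← integral_neg, ← integral_const_mul]
    congr 1; funext z
    rw [he]
    have hh' : (h : ℂ) ≠ 0 := by exact_mod_cast hh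
    field_simp
    linear_combination (-(oscFactor h Φ (p, z) * (fiberDeriv Φ (p, z) (b k) : ℂ) *
      B (p, z) (dualCoord k))) * Complex.I_sq
  simp only [hterm]
  rw [← integral_finsetSum]
  · simp only [oscIntegral]
    congr 1; funext z
    rw [← Finset.mul_sum]
    congr 1
    conv_lhs => rw [eq_sum_dualCoord (fiberDeriv Φ (p, z))]
    simp [hb]
  · intro k _
    have hc : Continuous (fun z => (fiberDeriv Φ (p, z) (b k) : ℂ)) := by
      have := (hΦ.continuous_fderiv (by simp)).comp (Continuous.prodMk_right p)
      exact Complex.continuous_ofReal.comp (this.clm_apply continuous_const)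
    exact (hes.continuous.mul (hc.mul (hgs k).continuous)).integrable_of_hasCompactSupport
      ((hgc k).mul_left.mul_left)

variable [FiniteDimensional ℝ P]

/-- The new amplitude still contains the factor 1/h. For phases with a good critical point this loss
is removed afterwards, in `CritPhase.fderiv_oscIntegral`. -/
theorem contDiff_oscIntegral {h : ℝ} {Φ : P × E → ℝ} (hΦ : ContDiff ℝ ∞ Φ)
    {A : P × E → ℂ} (hA : ContDiff ℝ ∞ A) {K : Set E} (hK : IsCompact K)
    (hAK : tsupport A ⊆ Prod.snd ⁻¹' K) :
    ContDiff ℝ ∞ (oscIntegral h Φ A) ∧ ∀ p e, fderiv ℝ (oscIntegral h Φ A) p e =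
      oscIntegral h Φ (fun x => Complex.I / h * (fderiv ℝ Φ x (e, 0) : ℂ) * A x +
        fderiv ℝ A x (e, 0)) p := by
  have hs : ContDiff ℝ ∞ (fun x => oscFactor h Φ x * A x) := (contDiff_oscFactor h hΦ).mul hA
  have hA0 : ∀ x : P × E, x.2 ∉ K → A x = 0 := fun x hx => by
    by_contra hne
    exact hx (hAK (subset_tsupport A hne))
  have hA1 : ∀ x : P × E, x.2 ∉ K → fderiv ℝ A x = 0 := fun x hx => by
    by_contra hne
    exact hx (hAK (support_fderiv_subset ℝ hne))
  have heq : oscIntegral h Φ A = fun p => ∫ z in K, oscFactor h Φ (p, z) * A (p, z) := by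
    funext p
    refine (setIntegral_eq_integral_of_forall_compl_eq_zero fun z hz => ?_).symm
    rw [hA0 (p, z) hz, mul_zero]
  obtain ⟨h1, h2⟩ := contDiff_setIntegral_and_iteratedFDeriv (μ := (volume : Measure E)) hs hK
  rw [heq]
  refine ⟨h1, fun p e => ?_⟩
  have h3 := h2 1 p
  have h4 : Integrable (fun z => iteratedFDeriv ℝ 1 (fun p => oscFactor h Φ (p, z) * A (p, z)) p)
      (volume.restrict K) := by
    have := ((continuous_iteratedFDeriv_prodMk_left hs 1).comp
      (Continuous.prodMk_right p)).continuousOn (s := K)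
    exact this.integrableOn_compact hK
  have h5 := ContinuousLinearMap.integral_comp_comm (𝕜 := ℝ)
    (ContinuousMultilinearMap.apply ℝ (fun _ : Fin 1 => P) ℂ (fun _ => e)) h4
  have h6 : fderiv ℝ (fun p => ∫ z in K, oscFactor h Φ (p, z) * A (p, z)) p e =
      iteratedFDeriv ℝ 1 (fun p => ∫ z in K, oscFactor h Φ (p, z) * A (p, z)) p (fun _ => e) := by
    rw [iteratedFDeriv_one_apply]
  rw [h6, h3]
  refine h5.symm.trans ?_
  have h7 : ∀ z, ContinuousMultilinearMap.apply ℝ (fun _ : Fin 1 => P) ℂ (fun _ => e)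
      (iteratedFDeriv ℝ 1 (fun p => oscFactor h Φ (p, z) * A (p, z)) p) =
      oscFactor h Φ (p, z) * (Complex.I / h * (fderiv ℝ Φ (p, z) (e, 0) : ℂ) * A (p, z) +
        fderiv ℝ A (p, z) (e, 0)) := by
    intro z
    have hd : HasFDerivAt (fun x => oscFactor h Φ x * A x) _ (p, z) :=
      ((contDiff_oscFactor h hΦ).differentiable (by simp) (p, z)).hasFDerivAt.mul
        (hA.differentiable (by simp) (p, z)).hasFDerivAt
    have hd' : HasFDerivAt (fun p => oscFactor h Φ (p, z) * A (p, z)) _ p :=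
      HasFDerivAt.comp (g := fun x => oscFactor h Φ x * A x) p hd
        (hasFDerivAt_prodMk_left (𝕜 := ℝ) p z)
    rw [ContinuousMultilinearMap.apply_apply, iteratedFDeriv_one_apply, hd'.fderiv]
    simp [fderiv_oscFactor h hΦ]
    ring
  simp only [h7]
  refine setIntegral_eq_integral_of_forall_compl_eq_zero fun z hz => ?_
  rw [hA0 (p, z) hz, hA1 (p, z) hz]
  simp

end OscillatoryIntegrals

/-! ### Repeated integration by parts with a gain away from the critical set. -/

section Damping

set_option linter.unusedSectionVars false

variable {ι P E : Type*} [NormedAddCommGroup P] [NormedSpace ℝ P]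
  [NormedAddCommGroup E] [NormedSpace ℝ E] [FiniteDimensional ℝ E]

theorem contDiff_fiberDeriv {Φ : P × E → ℝ} (hΦ : ContDiff ℝ ∞ Φ) :
    ContDiff ℝ ∞ (fiberDeriv Φ) :=
  ((ContinuousLinearMap.compL ℝ E (P × E) ℝ).flip (ContinuousLinearMap.inr ℝ P E)).contDiff.comp
    (hΦ.fderiv_right (m := ∞) (by exact_mod_cast le_top))

/-- The transpose of the first order operator that fixes `e^{iΦ/h}` and gains decay away from the
zeros of `B₀(dΦ)`. -/
def damp (h : ℝ) (Φ : P × E → ℝ) (B₀ : P × E → (E →L[ℝ] ℝ) →L[ℝ] ℝ) (A : P × E → ℂ)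
    (x : P × E) : ℂ :=
  h • ((h + B₀ x (fiberDeriv Φ x))⁻¹ • A x) + Complex.I * h * fiberDiv (fun x =>
    (B₀ x).smulRight ((h + B₀ x (fiberDeriv Φ x))⁻¹ • A x)) x

variable {h : ℝ} {Φ : P × E → ℝ} {B₀ : P × E → (E →L[ℝ] ℝ) →L[ℝ] ℝ} {A : P × E → ℂ}

theorem contDiff_dampWeight (hh : 0 < h) (hΦ : ContDiff ℝ ∞ Φ) (hB : ContDiff ℝ ∞ B₀)
    (hq : ∀ x, 0 ≤ B₀ x (fiberDeriv Φ x)) (hA : ContDiff ℝ ∞ A) :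
    ContDiff ℝ ∞ (fun x => (h + B₀ x (fiberDeriv Φ x))⁻¹ • A x) :=
  ((contDiff_const.add (hB.clm_apply (contDiff_fiberDeriv hΦ))).inv
    fun x => (add_pos_of_pos_of_nonneg hh (hq x)).ne').smul hA

theorem contDiff_dampField (hh : 0 < h) (hΦ : ContDiff ℝ ∞ Φ) (hB : ContDiff ℝ ∞ B₀)
    (hq : ∀ x, 0 ≤ B₀ x (fiberDeriv Φ x)) (hA : ContDiff ℝ ∞ A) :
    ContDiff ℝ ∞ (fun x => (B₀ x).smulRight ((h + B₀ x (fiberDeriv Φ x))⁻¹ • A x)) :=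
  hB.smulRight (contDiff_dampWeight hh hΦ hB hq hA)

theorem tsupport_dampField_subset : tsupport (fun x =>
    (B₀ x).smulRight ((h + B₀ x (fiberDeriv Φ x))⁻¹ • A x)) ⊆ tsupport A := by
  refine closure_mono fun x hx => ?_
  contrapose! hx
  rw [Function.notMem_support] at hx ⊢
  ext
  simp [hx]

theorem tsupport_damp_subset : tsupport (damp h Φ B₀ A) ⊆ tsupport A := by
  refine closure_minimal (fun x hx => ?_) (isClosed_tsupport A)
  contrapose! hx
  have h1 : A x = 0 := image_eq_zero_of_notMem_tsupport hx
  have h2 : fiberDiv (fun x =>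
      (B₀ x).smulRight ((h + B₀ x (fiberDeriv Φ x))⁻¹ • A x)) x = 0 :=
    image_eq_zero_of_notMem_tsupport fun hx' =>
      hx (tsupport_dampField_subset (tsupport_fiberDiv_subset _ hx'))
  rw [Function.notMem_support, damp, h1, h2]
  simp

/-- With q = B₀(dΦ) ≥ 0 one has A = h·A/(h+q) + B₀(dΦ)·A/(h+q), and the second term is integrated by
parts. The summand h keeps the denominator positive where q vanishes. -/
theorem oscIntegral_damp [MeasureSpace E] [BorelSpace E]
    [(volume : Measure E).IsAddHaarMeasure] (hh : 0 < h) (hΦ : ContDiff ℝ ∞ Φ)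
    (hB : ContDiff ℝ ∞ B₀) (hq : ∀ x, 0 ≤ B₀ x (fiberDeriv Φ x)) (hA : ContDiff ℝ ∞ A)
    {K : Set E} (hK : IsCompact K) (hAK : tsupport A ⊆ Prod.snd ⁻¹' K) (p : P) :
    oscIntegral h Φ (damp h Φ B₀ A) p = oscIntegral h Φ A p := by
  have hF := contDiff_dampField hh hΦ hB hq hA
  have hFK := (tsupport_dampField_subset (h := h) (Φ := Φ) (B₀ := B₀) (A := A)).trans hAK
  have hWK : tsupport (fun x => h • ((h + B₀ x (fiberDeriv Φ x))⁻¹ • A x)) ⊆ tsupport A := by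
    refine closure_mono fun x hx => ?_
    contrapose! hx
    simp [Function.notMem_support.1 hx]
  have h1 : oscIntegral h Φ (damp h Φ B₀ A) p =
      oscIntegral h Φ (fun x => h • ((h + B₀ x (fiberDeriv Φ x))⁻¹ • A x)) p +
      oscIntegral h Φ (fun x => (B₀ x).smulRight ((h + B₀ x (fiberDeriv Φ x))⁻¹ • A x)
        (fiberDeriv Φ x)) p := by
    rw [oscIntegral_clm_fiberDeriv hh.ne' hΦ hF hK hFK,
      ← oscIntegral_const_mul (fun _ => Complex.I * h)]
    exact oscIntegral_add hΦ ((contDiff_dampWeight hh hΦ hB hq hA).const_smul h)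
      (contDiff_const.mul (contDiff_fiberDiv hF)) hK (hWK.trans hAK)
      ((tsupport_mul_subset_right).trans ((tsupport_fiberDiv_subset _).trans hFK)) p
  rw [h1, ← oscIntegral_add hΦ ((contDiff_dampWeight hh hΦ hB hq hA).const_smul h)
    (hF.clm_apply (contDiff_fiberDeriv hΦ)) hK (hWK.trans hAK)]
  · congr 1
    funext x
    have : h + B₀ x (fiberDeriv Φ x) ≠ 0 := (add_pos_of_pos_of_nonneg hh (hq x)).ne'
    have h2 : ((h + B₀ x (fiberDeriv Φ x) : ℝ) : ℂ) ≠ 0 := by exact_mod_cast this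
    simp only [ContinuousLinearMap.smulRight_apply, Complex.real_smul, Complex.ofReal_inv]
    field_simp
    push_cast
    ring
  · refine subset_trans (closure_mono fun x hx => ?_) hFK
    contrapose! hx
    have h3 := Function.notMem_support.1 hx
    simp only [Function.mem_support, ne_eq, not_not]
    rw [h3]; rfl

/-- Counting weights: B₀ has size σ and h + q has size σ², so the field B₀A/(h+q) has weight w/σ.
Its divergence costs m and comes with a factor h, for a total gain of hσ⁻¹m. -/
theorem SymbolOn.damp {s : Set (P × E)} {w m σ : ι → P × E → ℝ} {h : ι → ℝ}
    {A : ι → P × E → ℂ} (hA : SymbolOn s w m A) (hh : ∀ i, 0 < h i)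
    (hB : SymbolOn s σ m (fun _ : ι => B₀))
    (hqs : SymbolOn s (fun i x => σ i x ^ 2) m (fun i x => h i + B₀ x (fiberDeriv Φ x)))
    (hq : ∀ x, 0 ≤ B₀ x (fiberDeriv Φ x)) {c : ℝ} (hc : 0 < c)
    (hlow : ∀ i, ∀ x ∈ s, c * σ i x ^ 2 ≤ h i + B₀ x (fiberDeriv Φ x))
    (hσ : ∀ i, ∀ x ∈ s, 0 < σ i x) (hm : ∀ i, ∀ x ∈ s, 0 ≤ m i x)
    (hσm : ∀ i, ∀ x ∈ s, 1 ≤ σ i x * m i x) (hw : ∀ i, ∀ x ∈ s, 0 ≤ w i x) :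
    SymbolOn s (fun i x => w i x * (h i * (σ i x)⁻¹ * m i x)) m
      (fun i => damp (h i) Φ B₀ (A i)) := by
  have hinv := hqs.inv (fun i x => add_pos_of_pos_of_nonneg (hh i) (hq x)) hm
    (fun i x hx => pow_pos (hσ i x hx) 2) hc hlow
  have hW := hinv.smul hA
  have hF := hB.smulRight hW
  have h1 := hW.const_smul h
  have h2 := (hF.fiberDiv.const_smul (fun i => Complex.I * (h i : ℂ)))
  refine SymbolOn.add (h1.mono_weight hm zero_le_one fun i x hx => ?_)
    (h2.mono_weight hm zero_le_one fun i x hx => ?_)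
  -- The term without derivative has size h/σ², which is at most hσ⁻¹m because σm ≥ 1.
  · have hs := hσ i x hx
    have hs1 := hσm i x hx
    have hw1 := hw i x hx
    have hh1 := hh i
    rw [Real.norm_of_nonneg hh1.le, one_mul]
    calc h i * ((σ i x ^ 2)⁻¹ * w i x) = w i x * (h i * (σ i x)⁻¹ * (σ i x)⁻¹) := by ring
      _ ≤ w i x * (h i * (σ i x)⁻¹ * m i x) := by
        gcongr
        rw [inv_le_iff_one_le_mul₀ hs, mul_comm]
        exact hs1
  · have hs := hσ i x hx
    have hh1 := hh i
    refine le_of_eq ?_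
    rw [norm_mul, Complex.norm_I, one_mul, Complex.norm_real, Real.norm_of_nonneg hh1.le]
    field_simp

variable [MeasureSpace E] [BorelSpace E] [(volume : Measure E).IsAddHaarMeasure]

/-- The bound on an oscillatory integral obtained after `N` integrations by parts. -/
theorem SymbolOn.norm_oscIntegral_le {s : Set (P × E)} {w m σ : ι → P × E → ℝ} {h : ι → ℝ}
    {A : ι → P × E → ℂ} (hA : SymbolOn s w m A) (hh : ∀ i, 0 < h i) (hΦ : ContDiff ℝ ∞ Φ)
    (hBc : ContDiff ℝ ∞ B₀) (hB : SymbolOn s σ m (fun _ : ι => B₀))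
    (hqs : SymbolOn s (fun i x => σ i x ^ 2) m (fun i x => h i + B₀ x (fiberDeriv Φ x)))
    (hq : ∀ x, 0 ≤ B₀ x (fiberDeriv Φ x)) {c : ℝ} (hc : 0 < c)
    (hlow : ∀ i, ∀ x ∈ s, c * σ i x ^ 2 ≤ h i + B₀ x (fiberDeriv Φ x))
    (hσ : ∀ i, ∀ x ∈ s, 0 < σ i x) (hm : ∀ i, ∀ x ∈ s, 0 ≤ m i x)
    (hσm : ∀ i, ∀ x ∈ s, 1 ≤ σ i x * m i x) (hw : ∀ i, ∀ x ∈ s, 0 ≤ w i x)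
    {K : Set E} (hK : IsCompact K) (hAK : ∀ i, tsupport (A i) ⊆ Prod.snd ⁻¹' K) (N : ℕ) :
    ∃ C, 0 ≤ C ∧ ∀ i p, (∀ z, (p, z) ∈ tsupport (A i) → (p, z) ∈ s) → ∀ g : E → ℝ,
      Integrable g → (∀ z, 0 ≤ g z) → (∀ z, (p, z) ∈ tsupport (A i) →
        w i (p, z) * (h i * (σ i (p, z))⁻¹ * m i (p, z)) ^ N ≤ g z) →
      ‖oscIntegral (h i) Φ (A i) p‖ ≤ C * ∫ z, g z := by
  -- Each step replaces the amplitude and its weight by the damped ones; the integral itself does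
  -- not change.
  induction N generalizing A w with
  | zero =>
    obtain ⟨C, hC0, hC⟩ := hA.bound 0
    refine ⟨C, hC0, fun i p hs g hg hg0 hwg => ?_⟩
    rw [← integral_const_mul]
    refine norm_integral_le_of_norm_le (hg.const_mul C) (Filter.Eventually.of_forall fun z => ?_)
    rw [norm_mul, norm_oscFactor, one_mul]
    by_cases hz : (p, z) ∈ tsupport (A i)
    · have h1 := hC i (p, z) (hs z hz)
      rw [norm_iteratedFDeriv_zero, pow_zero, mul_one] at h1
      refine h1.trans ?_
      have := hwg z hz
      rw [pow_zero, mul_one] at this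
      gcongr
    · rw [image_eq_zero_of_notMem_tsupport hz, norm_zero]
      exact mul_nonneg hC0 (hg0 z)
  | succ N ih =>
    have hD := hA.damp hh hB hqs hq hc hlow hσ hm hσm hw
    obtain ⟨C, hC0, hC⟩ := ih hD (fun i x hx => by
      have := hw i x hx
      have := hh i
      have := hσ i x hx
      have := hm i x hx
      positivity) (fun i => tsupport_damp_subset.trans (hAK i))
    refine ⟨C, hC0, fun i p hs g hg hg0 hwg => ?_⟩
    rw [← oscIntegral_damp (hh i) hΦ hBc hq (hA.contDiff i) hK (hAK i)]
    refine hC i p (fun z hz => hs z (tsupport_damp_subset hz)) g hg hg0 fun z hz => ?_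
    refine le_trans (le_of_eq ?_) (hwg z (tsupport_damp_subset hz))
    ring

end Damping

/-! ### The integrable weight that localizes to the scale √h. -/

section Localization

variable {E : Type*} [NormedAddCommGroup E] [NormedSpace ℝ E] [FiniteDimensional ℝ E]

/-- The norm of E need not be smooth, so distances to the critical point are measured by a sum of
squared coordinates; S is the price of the comparison. -/
theorem exists_norm_sq_le_sum_dualCoord_sq :
    ∃ S : ℝ, 1 ≤ S ∧ ∀ v : E, ‖v‖ ^ 2 ≤ S * ∑ k, dualCoord k v ^ 2 := by
  set b := Module.finBasis ℝ E
  have h0 : 0 ≤ ∑ k, ‖b k‖ ^ 2 := Finset.sum_nonneg fun _ _ => by positivity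
  refine ⟨1 + ∑ k, ‖b k‖ ^ 2, by linarith, fun v => ?_⟩
  have h1 : ‖v‖ ≤ ∑ k, |dualCoord k v| * ‖b k‖ := by
    conv_lhs => rw [← b.sum_repr v]
    refine (norm_sum_le _ _).trans (Finset.sum_le_sum fun k _ => ?_)
    rw [norm_smul]
    rfl
  have h2 := Finset.sum_mul_sq_le_sq_mul_sq Finset.univ (fun k => |dualCoord (E := E) k v|)
    (fun k => ‖b k‖)
  simp only [sq_abs] at h2
  have h3 : 0 ≤ ∑ k, dualCoord k v ^ 2 := Finset.sum_nonneg fun _ _ => by positivity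
  calc ‖v‖ ^ 2 ≤ (∑ k, |dualCoord k v| * ‖b k‖) ^ 2 := by gcongr
    _ ≤ _ := h2
    _ ≤ _ := by nlinarith

variable [MeasureSpace E] [BorelSpace E] [(volume : Measure E).IsAddHaarMeasure]

/-- The substitution z = z₀ + √h·w removes h from the integrand and leaves the Jacobian √h^d. The
exponent d + 1 makes the rescaled integrand integrable. -/
theorem exists_integral_localizer {S : ℝ} (hS : 1 ≤ S) :
    ∃ C, 0 ≤ C ∧ ∀ h : ℝ, 0 < h → ∀ z₀ : E,
      Integrable (fun z : E => (h / (h + ‖z - z₀‖ ^ 2 / S)) ^ (Module.finrank ℝ E + 1)) ∧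
      ∫ z : E, (h / (h + ‖z - z₀‖ ^ 2 / S)) ^ (Module.finrank ℝ E + 1) =
        C * √h ^ Module.finrank ℝ E := by
  set d := Module.finrank ℝ E
  have hS0 : 0 < S := by linarith
  set G : E → ℝ := fun z => (1 / (1 + ‖z‖ ^ 2 / S)) ^ (d + 1) with hG
  have hGc : Continuous G := by
    refine (Continuous.div continuous_const (by fun_prop) fun z => ?_).pow _
    positivity
  have hGi : Integrable G := by
    have h1 := (integrable_one_add_norm (E := E) (μ := volume) (r := (d + 1 : ℕ))
      (by push_cast; linarith)).const_mul ((2 * S) ^ (d + 1))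
    refine h1.mono' hGc.aestronglyMeasurable (Filter.Eventually.of_forall fun z => ?_)
    rw [Real.norm_of_nonneg (by positivity), Real.rpow_neg (by positivity), Real.rpow_natCast,
      ← div_eq_mul_inv, ← div_pow]
    refine pow_le_pow_left₀ (by positivity) ?_ _
    rw [div_le_div_iff₀ (by positivity) (by positivity)]
    have h2 : 2 * S * (1 + ‖z‖ ^ 2 / S) = 2 * S + 2 * ‖z‖ ^ 2 := by field_simp
    rw [h2]
    nlinarith [sq_nonneg (‖z‖ - 1), norm_nonneg z]
  refine ⟨∫ z, G z, integral_nonneg fun z => by positivity, fun h hh z₀ => ?_⟩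
  have hs : (0 : ℝ) < √h := Real.sqrt_pos.2 hh
  have heq : (fun z : E => (h / (h + ‖z - z₀‖ ^ 2 / S)) ^ (d + 1)) =
      fun z => G ((√h)⁻¹ • (z - z₀)) := by
    funext z
    simp only [hG]
    congr 1
    rw [norm_smul, Real.norm_of_nonneg (by positivity), mul_pow, inv_pow, Real.sq_sqrt hh.le]
    field_simp
  rw [heq]
  constructor
  · exact (hGi.comp_smul (inv_ne_zero hs.ne')).comp_sub_right z₀
  · rw [integral_sub_right_eq_self (fun z => G ((√h)⁻¹ • z)) z₀, Measure.integral_comp_smul]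
    rw [inv_pow, inv_inv, abs_of_nonneg (by positivity), smul_eq_mul, mul_comm]

end Localization

/-! ### Phases with one critical point per fiber: size and decay of the integral. -/

section Phases

theorem ContDiff.smul_clm {X V W : Type*} [NormedAddCommGroup X] [NormedSpace ℝ X]
    [NormedAddCommGroup V] [NormedSpace ℝ V] [NormedAddCommGroup W] [NormedSpace ℝ W]
    {f : X → ℝ} {g : X → V →L[ℝ] W} (hf : ContDiff ℝ ∞ f) (hg : ContDiff ℝ ∞ g) :
    ContDiff ℝ ∞ (fun x => f x • g x) :=
  hf.smul hg

set_option linter.unusedSectionVars false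

variable {ι P E : Type*} [NormedAddCommGroup P] [NormedSpace ℝ P]
  [NormedAddCommGroup E] [NormedSpace ℝ E]

/-- A phase function `Φ(p, z)` whose fiber derivative generates, with smooth coefficients, the
displacement from the critical point `crit p` and the derivative in the parameter. -/
structure CritPhase (P E : Type*) [NormedAddCommGroup P] [NormedSpace ℝ P]
    [NormedAddCommGroup E] [NormedSpace ℝ E] where
  phase : P × E → ℝ
  crit : P → E
  fiberCoeff : P × E → (E →L[ℝ] ℝ) →L[ℝ] E
  paramCoeff : P × E → (E →L[ℝ] ℝ) →L[ℝ] (P →L[ℝ] ℝ)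
  contDiff_phase : ContDiff ℝ ∞ phase
  contDiff_crit : ContDiff ℝ ∞ crit
  contDiff_fiberCoeff : ContDiff ℝ ∞ fiberCoeff
  contDiff_paramCoeff : ContDiff ℝ ∞ paramCoeff
  sub_crit : ∀ x : P × E, x.2 - crit x.1 = fiberCoeff x (fiberDeriv phase x)
  fderiv_param : ∀ (x : P × E) (e : P), fderiv ℝ phase x (e, 0) =
    paramCoeff x (fiberDeriv phase x) e

namespace CritPhase

variable [FiniteDimensional ℝ E] (Ψ : CritPhase P E)

/-- The squared distance to the critical point, measured in coordinates. -/
def distSq (x : P × E) : ℝ := ∑ k, dualCoord k (x.2 - Ψ.crit x.1) ^ 2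

theorem distSq_nonneg (x : P × E) : 0 ≤ Ψ.distSq x :=
  Finset.sum_nonneg fun _ _ => by positivity

/-- The field of functionals turning `dΦ` into the squared distance to the critical point. -/
def radialField (x : P × E) : (E →L[ℝ] ℝ) →L[ℝ] ℝ :=
  ∑ k, dualCoord k (x.2 - Ψ.crit x.1) • (dualCoord k).comp (Ψ.fiberCoeff x)

theorem contDiff_displacement (k : Fin (Module.finrank ℝ E)) :
    ContDiff ℝ ∞ (fun x : P × E => dualCoord k (x.2 - Ψ.crit x.1)) :=
  (dualCoord k).contDiff.comp (contDiff_snd.sub (Ψ.contDiff_crit.comp contDiff_fst))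

theorem contDiff_radialCoeff (k : Fin (Module.finrank ℝ E)) :
    ContDiff ℝ ∞ (fun x : P × E => (dualCoord k).comp (Ψ.fiberCoeff x)) :=
  contDiff_const.clm_comp Ψ.contDiff_fiberCoeff

theorem contDiff_radialField : ContDiff ℝ ∞ Ψ.radialField := 
  ContDiff.sum fun k _ => (Ψ.contDiff_displacement k).smul_clm (Ψ.contDiff_radialCoeff k)

/-- Since `fiberCoeff` maps the fiber derivative to z - crit(p), pairing its coordinates with those
of z - crit(p) gives a sum of squares, which is the positivity that damping requires. -/
theorem radialField_apply (x : P × E) :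
    Ψ.radialField x (fiberDeriv Ψ.phase x) = Ψ.distSq x := by
  simp only [radialField, distSq, _root_.sum_apply, _root_.smul_apply,
    ContinuousLinearMap.comp_apply, ← Ψ.sub_crit, smul_eq_mul, sq]

/-- The length scale `√(h + |z - crit p|²)`. -/
def radius (h : ℝ) (x : P × E) : ℝ := √(h + Ψ.distSq x)

theorem radius_sq {h : ℝ} (hh : 0 < h) (x : P × E) : Ψ.radius h x ^ 2 = h + Ψ.distSq x :=
  Real.sq_sqrt (add_nonneg hh.le (Ψ.distSq_nonneg x))

theorem radius_pos {h : ℝ} (hh : 0 < h) (x : P × E) : 0 < Ψ.radius h x :=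
  Real.sqrt_pos.2 (add_pos_of_pos_of_nonneg hh (Ψ.distSq_nonneg x))

theorem sqrt_le_radius (h : ℝ) (x : P × E) : √h ≤ Ψ.radius h x :=
  Real.sqrt_le_sqrt (by linarith [Ψ.distSq_nonneg x])

theorem abs_displacement_le_radius {h : ℝ} (hh : 0 < h) (x : P × E)
    (k : Fin (Module.finrank ℝ E)) : |dualCoord k (x.2 - Ψ.crit x.1)| ≤ Ψ.radius h x := by
  refine Real.abs_le_sqrt ?_
  have := Finset.single_le_sum (f := fun k => dualCoord k (x.2 - Ψ.crit x.1) ^ 2)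
    (fun _ _ => by positivity) (Finset.mem_univ k)
  simp only [distSq]
  linarith

/-- The inverse length scale on which amplitudes are allowed to vary during the damping. -/
def dampScale (h θ : ℝ) (x : P × E) : ℝ := θ⁻¹ + (Ψ.radius h x)⁻¹

variable {h θ : ι → ℝ}

/-- Only order zero needs the hypothesis |f| ≤ σ. Derivatives of order k ≥ 1 are bounded on the
compact set, and σm^k ≥ 1 because σm ≥ 1 and m ≥ 1. -/
theorem symbolOn_radius_of_abs_le {s : Set (P × E)} (hs : IsCompact s) (hh : ∀ i, 0 < h i)
    (hθ : ∀ i, 0 < θ i) (hθ1 : ∀ i, θ i ≤ 1) {f : P × E → ℝ} (hf : ContDiff ℝ ∞ f)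
    (hfr : ∀ i x, |f x| ≤ Ψ.radius (h i) x) :
    SymbolOn s (fun i => Ψ.radius (h i)) (fun i => Ψ.dampScale (h i) (θ i))
      (fun _ : ι => f) := by
  refine ⟨fun _ => hf, fun k => ?_⟩
  obtain ⟨C, hC0, hC⟩ := (SymbolOn.of_isCompact (ι := ι) hf hs).bound k
  refine ⟨max C 1, by positivity, fun i x hx => ?_⟩
  have hr := Ψ.radius_pos (hh i) x
  have h1 : 1 ≤ Ψ.dampScale (h i) (θ i) x := by
    have : 1 ≤ (θ i)⁻¹ := (one_le_inv₀ (hθ i)).2 (hθ1 i)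
    have : 0 < (Ψ.radius (h i) x)⁻¹ := inv_pos.2 hr
    rw [dampScale]; linarith
  have h2 : 1 ≤ Ψ.radius (h i) x * Ψ.dampScale (h i) (θ i) x := by
    have : 0 < (θ i)⁻¹ := inv_pos.2 (hθ i)
    rw [dampScale, mul_add, mul_inv_cancel₀ hr.ne']
    nlinarith
  cases k with
  | zero =>
    rw [norm_iteratedFDeriv_zero, pow_zero, mul_one, Real.norm_eq_abs]
    refine (hfr i x).trans ?_
    nlinarith [le_max_right C 1]
  | succ k =>
    refine (hC i x hx).trans ?_
    have h3 : 1 ≤ Ψ.radius (h i) x * Ψ.dampScale (h i) (θ i) x ^ (k + 1) := by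
      rw [pow_succ', ← mul_assoc]
      exact one_le_mul_of_one_le_of_one_le h2 (one_le_pow₀ h1)
    simp only [one_pow, mul_one]
    calc C ≤ max C 1 * 1 := by rw [mul_one]; exact le_max_left _ _
      _ ≤ _ := by gcongr

variable [MeasureSpace E] [BorelSpace E] [(volume : Measure E).IsAddHaarMeasure]

/-- Oscillatory integrals with amplitudes at scale `θ ≥ √h`: size, and decay in the distance from
the support to the critical point. -/
theorem norm_oscIntegral_le {s : Set (P × E)} (hs : IsCompact s) (hh : ∀ i, 0 < h i)
    (hhθ : ∀ i, h i ≤ θ i ^ 2) (hθ : ∀ i, 0 < θ i) (hθ1 : ∀ i, θ i ≤ 1)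
    {A : ι → P × E → ℂ} (hA : SymbolOn s (fun _ _ => 1) (fun i _ => (θ i)⁻¹) A)
    (hAs : ∀ i, tsupport (A i) ⊆ s) (N : ℕ) :
    ∃ C, 0 ≤ C ∧ ∀ i p r, (N = 0 ∨ (θ i ≤ r ∧
        ∀ z, (p, z) ∈ tsupport (A i) → r ≤ ‖z - Ψ.crit p‖)) →
      ‖oscIntegral (h i) Ψ.phase (A i) p‖ ≤
        C * (√(h i) ^ Module.finrank ℝ E * (h i / (θ i * r)) ^ N) := by
  obtain ⟨S, hS1, hS⟩ := exists_norm_sq_le_sum_dualCoord_sq (E := E)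
  have hS0 : 0 < S := by linarith
  obtain ⟨C₁, hC₁0, hC₁⟩ := exists_integral_localizer (E := E) hS1
  set d := Module.finrank ℝ E
  have hm1 : ∀ i x, 1 ≤ Ψ.dampScale (h i) (θ i) x := fun i x => by
    have : 1 ≤ (θ i)⁻¹ := (one_le_inv₀ (hθ i)).2 (hθ1 i)
    have : 0 < (Ψ.radius (h i) x)⁻¹ := inv_pos.2 (Ψ.radius_pos (hh i) x)
    rw [dampScale]; linarith
  have hσm : ∀ i x, 1 ≤ Ψ.radius (h i) x * Ψ.dampScale (h i) (θ i) x := fun i x => by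
    have hr := Ψ.radius_pos (hh i) x
    have : 0 < (θ i)⁻¹ := inv_pos.2 (hθ i)
    rw [dampScale, mul_add, mul_inv_cancel₀ hr.ne']
    nlinarith
  have hdisp : ∀ k, SymbolOn s (fun i => Ψ.radius (h i)) (fun i => Ψ.dampScale (h i) (θ i))
      (fun (_ : ι) x => dualCoord k (x.2 - Ψ.crit x.1)) := fun k =>
    Ψ.symbolOn_radius_of_abs_le hs hh hθ hθ1 (Ψ.contDiff_displacement k)
      fun i x => Ψ.abs_displacement_le_radius (hh i) x k
  have hB : SymbolOn s (fun i => Ψ.radius (h i)) (fun i => Ψ.dampScale (h i) (θ i))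
      (fun _ : ι => Ψ.radialField) := by
    have : SymbolOn s (fun i => Ψ.radius (h i)) (fun i => Ψ.dampScale (h i) (θ i))
        (fun (_ : ι) x => ∑ k, dualCoord k (x.2 - Ψ.crit x.1) •
          (dualCoord k).comp (Ψ.fiberCoeff x)) := by
      refine SymbolOn.sum _ fun k _ => ?_
      exact ((hdisp k).smul (SymbolOn.of_isCompact_of_one_le (Ψ.contDiff_radialCoeff k) hs
        fun i x _ => hm1 i x)).congr_weight fun i x _ => mul_one _
    exact this
  have hqs : SymbolOn s (fun i x => Ψ.radius (h i) x ^ 2) (fun i => Ψ.dampScale (h i) (θ i))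
      (fun i x => h i + Ψ.radialField x (fiberDeriv Ψ.phase x)) := by
    simp only [radialField_apply]
    refine SymbolOn.add ?_ ?_
    · have h1 := (SymbolOn.of_isCompact_of_one_le (ι := ι) (X := P × E) (F := ℝ) (s := s)
        (m := fun i => Ψ.dampScale (h i) (θ i))
        (contDiff_const (c := (1 : ℝ))) hs fun i x _ => hm1 i x).const_smul h
      have h2 := h1.mono_weight (w' := fun i x => Ψ.radius (h i) x ^ 2)
        (fun i x _ => zero_le_one.trans (hm1 i x)) zero_le_one fun i x _ => by
        rw [Ψ.radius_sq (hh i), Real.norm_of_nonneg (hh i).le]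
        linarith [Ψ.distSq_nonneg x]
      simpa using h2
    · refine SymbolOn.sum _ fun k _ => ?_
      have := ((hdisp k).mul (hdisp k))
      simpa only [← sq] using this
  have hq : ∀ x, 0 ≤ Ψ.radialField x (fiberDeriv Ψ.phase x) := fun x => by
    rw [radialField_apply]; exact Ψ.distSq_nonneg x
  have hA' : SymbolOn s (fun _ _ => 1) (fun i => Ψ.dampScale (h i) (θ i)) A :=
    hA.mono_scale (fun _ _ _ => zero_le_one) (fun i _ _ => (inv_pos.2 (hθ i)).le)
      fun i x _ => by
        have : 0 < (Ψ.radius (h i) x)⁻¹ := inv_pos.2 (Ψ.radius_pos (hh i) x)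
        rw [dampScale]; linarith
  -- Of the N + 2(d+1) dampings, 2(d+1) produce the power d + 1 of the localizer (two for each
  -- factor) and N produce the decay in r.
  obtain ⟨C, hC0, hC⟩ := hA'.norm_oscIntegral_le hh Ψ.contDiff_phase Ψ.contDiff_radialField hB hqs
    hq one_pos (fun i x _ => by rw [radialField_apply, one_mul, Ψ.radius_sq (hh i)])
    (fun i x _ => Ψ.radius_pos (hh i) x) (fun i x _ => zero_le_one.trans (hm1 i x))
    (fun i x _ => hσm i x) (fun _ _ _ => zero_le_one) (hs.image continuous_snd)
    (fun i x hx => Set.mem_image_of_mem _ (hAs i hx)) (N + 2 * (d + 1))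
  refine ⟨C * ((2 * S) ^ N * 4 ^ (d + 1) * C₁), by positivity, fun i p r hr => ?_⟩
  have hhi := hh i
  have hθi := hθ i
  have hsq : √(h i) ≤ θ i := Real.sqrt_le_left hθi.le |>.2 (hhθ i)
  have hsp : 0 < √(h i) := Real.sqrt_pos.2 hhi
  obtain ⟨hint, hval⟩ := hC₁ (h i) hhi (Ψ.crit p)
  have hrat : 0 ≤ (h i / (θ i * r)) ^ N := by
    rcases hr with rfl | ⟨hr, -⟩
    · simp
    · have : 0 < r := hθi.trans_le hr
      positivity
  -- Here θ ≥ √h is used: the scale θ⁻¹ + σ⁻¹ is at most 2/√h.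
  have hlam : ∀ x, h i * (Ψ.radius (h i) x)⁻¹ * Ψ.dampScale (h i) (θ i) x ≤
      2 * (√(h i) / Ψ.radius (h i) x) := fun x => by
    have hrp := Ψ.radius_pos hhi x
    have h1 : Ψ.dampScale (h i) (θ i) x ≤ 2 * (√(h i))⁻¹ := by
      rw [dampScale, two_mul]
      exact add_le_add (inv_anti₀ hsp hsq) (inv_anti₀ hsp (Ψ.sqrt_le_radius _ _))
    calc h i * (Ψ.radius (h i) x)⁻¹ * Ψ.dampScale (h i) (θ i) x
        ≤ h i * (Ψ.radius (h i) x)⁻¹ * (2 * (√(h i))⁻¹) := by gcongr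
      _ = (√(h i) * √(h i)) * (Ψ.radius (h i) x)⁻¹ * (2 * (√(h i))⁻¹) := by
          rw [Real.mul_self_sqrt hhi.le]
      _ = _ := by field_simp
  have hlam0 : ∀ x, 0 ≤ h i * (Ψ.radius (h i) x)⁻¹ * Ψ.dampScale (h i) (θ i) x := fun x => by
    have := Ψ.radius_pos hhi x
    have := hm1 i x
    positivity
  have hdist : ∀ z, ‖z - Ψ.crit p‖ ^ 2 / S ≤ Ψ.distSq (p, z) := fun z => by
    rw [div_le_iff₀ hS0, mul_comm]
    exact hS _
  have hbound := hC i p (fun z hz => hAs i hz)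
    (fun z => (2 * S) ^ N * 4 ^ (d + 1) * (h i / (θ i * r)) ^ N *
      (h i / (h i + ‖z - Ψ.crit p‖ ^ 2 / S)) ^ (d + 1))
    (hint.const_mul _) (fun z => by positivity) ?_
  · refine hbound.trans (le_of_eq ?_)
    rw [integral_const_mul, hval]
    ring
  · intro z hz
    rw [one_mul, pow_add, pow_mul]
    have hrp := Ψ.radius_pos hhi (p, z)
    have h1 : (h i * (Ψ.radius (h i) (p, z))⁻¹ * Ψ.dampScale (h i) (θ i) (p, z)) ^ 2 ≤
        4 * (h i / (h i + ‖z - Ψ.crit p‖ ^ 2 / S)) := by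
      calc _ ≤ (2 * (√(h i) / Ψ.radius (h i) (p, z))) ^ 2 :=
            pow_le_pow_left₀ (hlam0 _) (hlam _) 2
        _ = 4 * (h i / (h i + Ψ.distSq (p, z))) := by
            rw [mul_pow, div_pow, Real.sq_sqrt hhi.le, Ψ.radius_sq hhi]
            ring
        _ ≤ _ := by
            have := hdist z
            gcongr
    -- On the support σ is at least r/S and σ² at least r²/S. With r ≥ θ, both terms of hσ⁻¹m =
    -- h/(θσ) + h/σ² are at most S·h/(θr).
    have h2 : (h i * (Ψ.radius (h i) (p, z))⁻¹ * Ψ.dampScale (h i) (θ i) (p, z)) ^ N ≤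
        (2 * S) ^ N * (h i / (θ i * r)) ^ N := by
      rcases hr with rfl | ⟨hr, hrz⟩
      · simp
      rw [← mul_pow]
      refine pow_le_pow_left₀ (hlam0 _) ?_ N
      have hr0 : 0 < r := hθi.trans_le hr
      set σ := Ψ.radius (h i) (p, z) with hσ
      have h3 : r ^ 2 / S ≤ σ ^ 2 := by
        rw [hσ, Ψ.radius_sq hhi]
        have := hdist z
        have : r ^ 2 / S ≤ ‖z - Ψ.crit p‖ ^ 2 / S := by
          have := hrz z hz
          gcongr
        linarith
      have h4 : r ≤ S * σ := by
        rw [div_le_iff₀ hS0] at h3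
        refine abs_le_of_sq_le_sq' ?_ (by positivity) |>.2
        rw [mul_pow]
        nlinarith [sq_nonneg σ]
      have h5 : σ⁻¹ ≤ S / r := by
        rw [inv_le_iff_one_le_mul₀ hrp, div_mul_eq_mul_div, le_div_iff₀ hr0, one_mul]
        exact h4
      have h6 : (σ ^ 2)⁻¹ ≤ S / (θ i * r) := by
        rw [inv_le_iff_one_le_mul₀ (by positivity), div_mul_eq_mul_div,
          le_div_iff₀ (by positivity), one_mul]
        rw [div_le_iff₀ hS0] at h3
        nlinarith
      have h7 : h i * σ⁻¹ * Ψ.dampScale (h i) (θ i) (p, z) =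
          h i / θ i * σ⁻¹ + h i * (σ ^ 2)⁻¹ := by
        rw [dampScale, ← hσ, sq, mul_inv]
        ring
      rw [h7]
      calc h i / θ i * σ⁻¹ + h i * (σ ^ 2)⁻¹ ≤ h i / θ i * (S / r) + h i * (S / (θ i * r)) := by
            gcongr
        _ = _ := by field_simp; ring
    have h8 : ((h i * (Ψ.radius (h i) (p, z))⁻¹ * Ψ.dampScale (h i) (θ i) (p, z)) ^ 2) ^ (d + 1) ≤
        4 ^ (d + 1) * (h i / (h i + ‖z - Ψ.crit p‖ ^ 2 / S)) ^ (d + 1) := by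
      rw [← mul_pow]
      exact pow_le_pow_left₀ (sq_nonneg _) h1 _
    calc _ ≤ ((2 * S) ^ N * (h i / (θ i * r)) ^ N) *
          (4 ^ (d + 1) * (h i / (h i + ‖z - Ψ.crit p‖ ^ 2 / S)) ^ (d + 1)) :=
          mul_le_mul h2 h8 (by positivity) (by positivity)
      _ = _ := by ring

end CritPhase

end Phases

/-! ### Derivatives in the parameter without loss in h. -/

section ParameterDerivatives

set_option linter.unusedSectionVars false

/-- Directional derivatives of an oscillatory integral are again scalar oscillatory integrals;
expanding in a basis lets the induction on the order stay among them. -/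
theorem exists_norm_iteratedFDeriv_succ_le {P : Type*} [NormedAddCommGroup P] [NormedSpace ℝ P]
    [FiniteDimensional ℝ P] (k : ℕ) :
    ∃ C : Fin (Module.finrank ℝ P) → ℝ, (∀ j, 0 ≤ C j) ∧ ∀ f : P → ℂ, ContDiff ℝ ∞ f → ∀ p,
      ‖iteratedFDeriv ℝ (k + 1) f p‖ ≤ ∑ j, C j *
        ‖iteratedFDeriv ℝ k (fun p => fderiv ℝ f p (Module.finBasis ℝ P j)) p‖ := by
  set b := Module.finBasis ℝ P
  let L : Fin (Module.finrank ℝ P) → (ℂ →L[ℝ] (P →L[ℝ] ℂ)) := fun j =>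
    ContinuousLinearMap.smulRightL ℝ P ℂ (dualCoord j)
  refine ⟨fun j => ‖L j‖, fun j => by positivity, fun f hf p => ?_⟩
  have hfd : ContDiff ℝ ∞ (fderiv ℝ f) := hf.fderiv_right (by exact_mod_cast le_top)
  have hj : ∀ j, ContDiff ℝ ∞ (fun p => fderiv ℝ f p (b j)) := fun j =>
    hfd.clm_apply contDiff_const
  have heq : fderiv ℝ f = fun p => ∑ j, L j (fderiv ℝ f p (b j)) := by
    funext p
    ext v
    have h := congrArg (fderiv ℝ f p) (b.sum_repr v)
    rw [map_sum] at h
    rw [← h]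
    simp [L, dualCoord, b]
  rw [← norm_iteratedFDeriv_fderiv]
  conv_lhs => rw [heq]
  have hsum : iteratedFDeriv ℝ k (fun p => ∑ j, L j (fderiv ℝ f p (b j))) p =
      ∑ j, iteratedFDeriv ℝ k (fun p => L j (fderiv ℝ f p (b j))) p := by
    refine iteratedFDeriv_fun_sum_apply fun j _ => ?_
    exact (((L j).contDiff.comp (hj j)).of_le (by exact_mod_cast le_top)).contDiffAt
  rw [hsum]
  refine (norm_sum_le _ _).trans (Finset.sum_le_sum fun j _ => ?_)
  exact (L j).norm_iteratedFDeriv_comp_left (N := ∞) (hj j).contDiffAt (by exact_mod_cast le_top)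

variable {ι P E : Type*} [NormedAddCommGroup P] [NormedSpace ℝ P]
  [NormedAddCommGroup E] [NormedSpace ℝ E] [FiniteDimensional ℝ E]

namespace CritPhase

variable (Ψ : CritPhase P E)

/-- The vector field of the integration by parts that compensates the parameter derivative of the
phase in the direction `e`. -/
def paramField (e : P) (A : P × E → ℂ) (x : P × E) : (E →L[ℝ] ℝ) →L[ℝ] ℂ :=
  ((ContinuousLinearMap.apply ℝ ℝ e).comp (Ψ.paramCoeff x)).smulRight (A x)

/-- The amplitude of the parameter derivative in the direction `e`. -/
def paramDeriv (e : P) (A : P × E → ℂ) (x : P × E) : ℂ :=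
  fderiv ℝ A x (e, 0) - fiberDiv (Ψ.paramField e A) x

theorem contDiff_paramCoeff_apply (e : P) :
    ContDiff ℝ ∞ (fun x => (ContinuousLinearMap.apply ℝ ℝ e).comp (Ψ.paramCoeff x)) :=
  contDiff_const.clm_comp Ψ.contDiff_paramCoeff

theorem contDiff_paramField (e : P) {A : P × E → ℂ} (hA : ContDiff ℝ ∞ A) :
    ContDiff ℝ ∞ (Ψ.paramField e A) :=
  (Ψ.contDiff_paramCoeff_apply e).smulRight hA

theorem tsupport_paramField_subset (e : P) (A : P × E → ℂ) :
    tsupport (Ψ.paramField e A) ⊆ tsupport A := by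
  refine closure_mono fun x hx => ?_
  contrapose! hx
  rw [Function.notMem_support] at hx ⊢
  ext
  simp [paramField, hx]

theorem tsupport_fderiv_apply_subset (A : P × E → ℂ) (v : P × E) :
    tsupport (fun x => fderiv ℝ A x v) ⊆ tsupport A := by
  refine closure_minimal (fun x hx => ?_) (isClosed_tsupport A)
  by_contra hxB
  have h0 : fderiv ℝ A x = 0 := by
    by_contra hne
    exact hxB (support_fderiv_subset ℝ hne)
  exact hx (by simp [h0])

theorem tsupport_paramDeriv_subset (e : P) (A : P × E → ℂ) :
    tsupport (Ψ.paramDeriv e A) ⊆ tsupport A := by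
  refine closure_minimal (fun x hx => ?_) (isClosed_tsupport A)
  contrapose! hx
  have h1 : fderiv ℝ A x (e, 0) = 0 := image_eq_zero_of_notMem_tsupport (f := fun x =>
    fderiv ℝ A x (e, 0)) fun h => hx (tsupport_fderiv_apply_subset A _ h)
  have h2 : fiberDiv (Ψ.paramField e A) x = 0 := image_eq_zero_of_notMem_tsupport fun h =>
    hx (Ψ.tsupport_paramField_subset e A (tsupport_fiberDiv_subset _ h))
  rw [Function.notMem_support, paramDeriv, h1, h2, sub_zero]

theorem symbolOn_paramDeriv {s : Set (P × E)} (hs : IsCompact s) {w m : ι → P × E → ℝ}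
    (hm : ∀ i, ∀ x ∈ s, 1 ≤ m i x) {A : ι → P × E → ℂ} (hA : SymbolOn s w m A) (e : P) :
    SymbolOn s (fun i x => w i x * m i x) m (fun i => Ψ.paramDeriv e (A i)) := by
  have h1 := hA.fderiv.const_clm (ContinuousLinearMap.apply ℝ ℂ ((e, 0) : P × E))
  have h2 := ((SymbolOn.of_isCompact_of_one_le (Ψ.contDiff_paramCoeff_apply e) hs hm).smulRight
    hA).fiberDiv
  exact h1.sub (h2.congr_weight fun i x _ => by rw [one_mul])

variable [MeasureSpace E] [BorelSpace E] [(volume : Measure E).IsAddHaarMeasure]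
  [FiniteDimensional ℝ P]

/-- The factor (i/h)∂_eΦ·A is `paramField` applied to the fiber derivative. Integrating it by parts
multiplies by ih, and (i/h)(ih) = -1 leaves minus a divergence free of h. -/
theorem fderiv_oscIntegral {h : ℝ} (hh : h ≠ 0) {A : P × E → ℂ} (hA : ContDiff ℝ ∞ A) {K : Set E}
    (hK : IsCompact K) (hAK : tsupport A ⊆ Prod.snd ⁻¹' K) (p e : P) :
    fderiv ℝ (oscIntegral h Ψ.phase A) p e = oscIntegral h Ψ.phase (Ψ.paramDeriv e A) p := by
  rw [(contDiff_oscIntegral Ψ.contDiff_phase hA hK hAK).2]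
  have hF := Ψ.contDiff_paramField e hA
  have hFK := (Ψ.tsupport_paramField_subset e A).trans hAK
  have hfs : ContDiff ℝ ∞ (fun x => fderiv ℝ A x (e, 0)) :=
    (hA.fderiv_right (m := ∞) (by exact_mod_cast le_top)).clm_apply contDiff_const
  have hfK := (tsupport_fderiv_apply_subset A ((e, 0) : P × E)).trans hAK
  have h1 := oscIntegral_clm_fiberDeriv hh Ψ.contDiff_phase hF hK hFK p
  have h2 : (fun x => Complex.I / h * (fderiv ℝ Ψ.phase x (e, 0) : ℂ) * A x +
      fderiv ℝ A x (e, 0)) = fun x => (fun _ : P => Complex.I / (h : ℂ)) x.1 *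
        (Ψ.paramField e A x (fiberDeriv Ψ.phase x)) + fderiv ℝ A x (e, 0) := by
    funext x
    simp only [paramField, ContinuousLinearMap.smulRight_apply, ContinuousLinearMap.comp_apply,
      ContinuousLinearMap.apply_apply, ← Ψ.fderiv_param, Complex.real_smul]
    ring
  have hBK : tsupport (fun x => Ψ.paramField e A x (fiberDeriv Ψ.phase x)) ⊆ Prod.snd ⁻¹' K := by
    refine subset_trans (closure_mono fun x hx => ?_) hFK
    contrapose! hx
    rw [Function.notMem_support] at hx ⊢
    rw [hx]; rfl
  rw [h2, oscIntegral_add Ψ.contDiff_phase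
    (contDiff_const.mul (hF.clm_apply (contDiff_fiberDeriv Ψ.contDiff_phase))) hfs hK
    (tsupport_mul_subset_right.trans hBK) hfK,
    oscIntegral_const_mul (fun _ => Complex.I / (h : ℂ)), h1]
  have hD : Ψ.paramDeriv e A = fun x => fderiv ℝ A x (e, 0) +
      (fun _ : P => (-1 : ℂ)) x.1 * fiberDiv (Ψ.paramField e A) x := by
    funext x
    simp only [paramDeriv]
    ring
  rw [hD, oscIntegral_add Ψ.contDiff_phase hfs (contDiff_const.mul (contDiff_fiberDiv hF)) hK hfK
    (tsupport_mul_subset_right.trans ((tsupport_fiberDiv_subset _).trans hFK)),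
    oscIntegral_const_mul (fun _ => (-1 : ℂ))]
  have hh' : (h : ℂ) ≠ 0 := by exact_mod_cast hh
  have h3 : Complex.I / (h : ℂ) * (Complex.I * h *
      oscIntegral h Ψ.phase (fiberDiv (Ψ.paramField e A)) p) =
      -oscIntegral h Ψ.phase (fiberDiv (Ψ.paramField e A)) p := by
    field_simp
    rw [Complex.I_sq]
    ring
  rw [h3]
  ring

theorem contDiff_oscIntegral {h : ℝ} {A : P × E → ℂ} (hA : ContDiff ℝ ∞ A) {s : Set (P × E)}
    (hs : IsCompact s) (hAs : tsupport A ⊆ s) : ContDiff ℝ ∞ (oscIntegral h Ψ.phase A) :=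
  (_root_.contDiff_oscIntegral Ψ.contDiff_phase hA (hs.image continuous_snd)
    fun _ hx => Set.mem_image_of_mem _ (hAs hx)).1

/-- Derivatives of oscillatory integrals with amplitudes at scale `θ ≥ √h`: size, and decay in the
distance from the support to the critical point. -/
theorem norm_iteratedFDeriv_oscIntegral_le {s : Set (P × E)} (hs : IsCompact s) {h θ : ι → ℝ}
    (hh : ∀ i, 0 < h i) (hhθ : ∀ i, h i ≤ θ i ^ 2) (hθ : ∀ i, 0 < θ i) (hθ1 : ∀ i, θ i ≤ 1)
    {A : ι → P × E → ℂ} (hA : SymbolOn s (fun _ _ => 1) (fun i _ => (θ i)⁻¹) A)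
    (hAs : ∀ i, tsupport (A i) ⊆ s) (k N : ℕ) :
    ∃ C, 0 ≤ C ∧ ∀ i p r, (N = 0 ∨ (θ i ≤ r ∧
        ∀ z, (p, z) ∈ tsupport (A i) → r ≤ ‖z - Ψ.crit p‖)) →
      ‖iteratedFDeriv ℝ k (oscIntegral (h i) Ψ.phase (A i)) p‖ ≤
        C * (√(h i) ^ Module.finrank ℝ E * (θ i)⁻¹ ^ k * (h i / (θ i * r)) ^ N) := by
  induction k generalizing A with
  | zero =>
    obtain ⟨C, hC0, hC⟩ := Ψ.norm_oscIntegral_le hs hh hhθ hθ hθ1 hA hAs N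
    refine ⟨C, hC0, fun i p r hr => ?_⟩
    rw [norm_iteratedFDeriv_zero, pow_zero, mul_one]
    exact hC i p r hr
  | succ k ih =>
    obtain ⟨c, hc0, hc⟩ := exists_norm_iteratedFDeriv_succ_le (P := P) k
    set b := Module.finBasis ℝ P
    have hm1 : ∀ i, ∀ x ∈ s, 1 ≤ (fun i (_ : P × E) => (θ i)⁻¹) i x := fun i _ _ =>
      (one_le_inv₀ (hθ i)).2 (hθ1 i)
    -- Multiplying by θ returns the differentiated amplitude to weight one, so the induction
    -- hypothesis applies; the factor θ⁻¹ is restored at the end.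
    have hD : ∀ j, SymbolOn s (fun _ _ => 1) (fun i _ => (θ i)⁻¹)
        (fun i x => (θ i : ℂ) • Ψ.paramDeriv (b j) (A i) x) := fun j => by
      refine ((Ψ.symbolOn_paramDeriv hs hm1 hA (b j)).const_smul
        (fun i => (θ i : ℂ))).congr_weight fun i x _ => ?_
      rw [Complex.norm_real, Real.norm_of_nonneg (hθ i).le, one_mul,
        mul_inv_cancel₀ (hθ i).ne']
    have hDs : ∀ j i, tsupport (fun x => (θ i : ℂ) • Ψ.paramDeriv (b j) (A i) x) ⊆
        tsupport (A i) := fun j i =>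
      (tsupport_smul_subset_right _ _).trans (Ψ.tsupport_paramDeriv_subset _ _)
    choose C hC0 hC using fun j => ih (hD j) fun i => (hDs j i).trans (hAs i)
    refine ⟨∑ j, c j * C j, Finset.sum_nonneg fun j _ => mul_nonneg (hc0 j) (hC0 j),
      fun i p r hr => ?_⟩
    refine (hc _ (Ψ.contDiff_oscIntegral (hA.contDiff i) hs (hAs i)) p).trans ?_
    rw [Finset.sum_mul]
    refine Finset.sum_le_sum fun j _ => ?_
    have hθc : (θ i : ℂ) ≠ 0 := by exact_mod_cast (hθ i).ne'
    have heq : (fun p => fderiv ℝ (oscIntegral (h i) Ψ.phase (A i)) p (b j)) =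
        fun p => (θ i : ℂ)⁻¹ • oscIntegral (h i) Ψ.phase
          (fun x => (θ i : ℂ) • Ψ.paramDeriv (b j) (A i) x) p := by
      funext p
      rw [Ψ.fderiv_oscIntegral (hh i).ne' (hA.contDiff i) (hs.image continuous_snd)
        (fun _ hx => Set.mem_image_of_mem _ (hAs i hx))]
      have := oscIntegral_const_mul (h := h i) (Φ := Ψ.phase) (fun _ => (θ i : ℂ))
        (Ψ.paramDeriv (b j) (A i)) p
      simp only [smul_eq_mul]
      rw [this]
      field_simp
    have hsm := Ψ.contDiff_oscIntegral (h := h i) ((hD j).contDiff i) hs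
      ((hDs j i).trans (hAs i))
    have heq2 := iteratedFDeriv_const_smul_apply (𝕜 := ℝ) (a := (θ i : ℂ)⁻¹) (x := p)
      (hsm.of_le (m := (k : ℕ∞ω)) (by exact_mod_cast le_top)).contDiffAt
    have heq3 : iteratedFDeriv ℝ k
        (fun p => fderiv ℝ (oscIntegral (h i) Ψ.phase (A i)) p (b j)) p =
        (θ i : ℂ)⁻¹ • iteratedFDeriv ℝ k (oscIntegral (h i) Ψ.phase
          (fun x => (θ i : ℂ) • Ψ.paramDeriv (b j) (A i) x)) p := by
      rw [heq]; exact heq2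
    have hCj := hC j i p r (hr.imp_right fun h => ⟨h.1, fun z hz => h.2 z (hDs j i hz)⟩)
    rw [heq3, norm_smul, norm_inv, Complex.norm_real, Real.norm_of_nonneg (hθ i).le, mul_assoc]
    refine mul_le_mul_of_nonneg_left ?_ (hc0 j)
    have hθi := hθ i
    calc (θ i)⁻¹ * ‖iteratedFDeriv ℝ k (oscIntegral (h i) Ψ.phase
          (fun x => (θ i : ℂ) • Ψ.paramDeriv (b j) (A i) x)) p‖ ≤ (θ i)⁻¹ * (C j *
          (√(h i) ^ Module.finrank ℝ E * (θ i)⁻¹ ^ k * (h i / (θ i * r)) ^ N)) := by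
          gcongr
      _ = _ := by rw [pow_succ]; ring

end CritPhase

end ParameterDerivatives

/-! ### Expansion in powers of h/θ² about the critical point. -/

section Expansion

set_option linter.unusedSectionVars false

open Topology

variable {ι P E : Type*} [NormedAddCommGroup P] [NormedSpace ℝ P] [FiniteDimensional ℝ P]
  [NormedAddCommGroup E] [NormedSpace ℝ E] [FiniteDimensional ℝ E]

theorem exists_contDiff_eq_one_on_closedBall (V : Type*) [NormedAddCommGroup V] [NormedSpace ℝ V]
    [FiniteDimensional ℝ V] {r : ℝ} (hr : 0 < r) :
    ∃ χ : V → ℝ, ContDiff ℝ ∞ χ ∧ (∀ v, ‖v‖ ≤ r → χ v = 1) ∧ (∀ v, r + 1 < ‖v‖ → χ v = 0) ∧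
      tsupport χ ⊆ Metric.closedBall 0 (r + 1) := by
  let f : ContDiffBump (0 : V) := ⟨r, r + 1, hr, by linarith⟩
  refine ⟨f, f.contDiff, fun v hv => f.one_of_mem_closedBall (by simpa using hv),
    fun v hv => f.zero_of_le_dist (by rw [dist_zero_right]; exact hv.le), ?_⟩
  rw [f.tsupport_eq]

namespace CritPhase

variable (Ψ : CritPhase P E)

/-- The segment from the critical point to `z`, in the fiber over `p`. -/
def segment (t : ℝ) (x : P × E) : P × E := (x.1, Ψ.crit x.1 + t • (x.2 - Ψ.crit x.1))

theorem contDiff_segment : ContDiff ℝ ∞ (fun y : (P × E) × ℝ => Ψ.segment y.2 y.1) := by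
  have h1 : ContDiff ℝ ∞ (fun y : (P × E) × ℝ => Ψ.crit y.1.1) :=
    Ψ.contDiff_crit.comp (contDiff_fst.comp contDiff_fst)
  exact (contDiff_fst.comp contDiff_fst).prodMk
    (h1.add (contDiff_snd.smul ((contDiff_snd.comp contDiff_fst).sub h1)))

/-- The segment parameter t is made part of the index, so the bounds are uniform in t and survive
integration over [0, 1]. -/
theorem symbolOn_segment {κ : Type*} {s : Set (P × E)} (hs : IsCompact s) :
    SymbolOn s (fun _ _ => 1) (fun _ _ => 1)
      (fun j : κ × Set.Icc (0 : ℝ) 1 => Ψ.segment (j.2 : ℝ)) := by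
  have hc : ContDiff ℝ ∞ (fun x : P × E => Ψ.crit x.1) := Ψ.contDiff_crit.comp contDiff_fst
  have h1 : SymbolOn s (fun _ _ => 1) (fun _ _ => 1)
      (fun (_ : κ × Set.Icc (0 : ℝ) 1) (x : P × E) => (x.1, Ψ.crit x.1)) :=
    SymbolOn.of_isCompact (contDiff_fst.prodMk hc) hs
  have h2 : SymbolOn s (fun _ _ => 1) (fun _ _ => 1)
      (fun (j : κ × Set.Icc (0 : ℝ) 1) (x : P × E) =>
        (j.2 : ℝ) • ((0 : P), x.2 - Ψ.crit x.1)) := by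
    refine ((SymbolOn.of_isCompact (contDiff_const.prodMk (contDiff_snd.sub hc))
      hs).const_smul fun j : κ × Set.Icc (0 : ℝ) 1 => (j.2 : ℝ)).mono_weight
      (fun _ _ _ => zero_le_one) zero_le_one fun j x _ => ?_
    have := j.2.2
    rw [Real.norm_of_nonneg this.1]
    simpa using this.2
  have h3 : (fun (j : κ × Set.Icc (0 : ℝ) 1) => Ψ.segment (j.2 : ℝ)) = fun j x =>
      (x.1, Ψ.crit x.1) + (j.2 : ℝ) • ((0 : P), x.2 - Ψ.crit x.1) := by
    funext j x
    simp [segment]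
  rw [h3]
  exact h1.add h2

/-- The coefficient in the expansion of `f` along the fibers about the critical point. -/
def fiberQuotient (f : P × E → ℂ) (x : P × E) : E →L[ℝ] ℂ :=
  ∫ t in Set.Icc (0 : ℝ) 1,
    (fderiv ℝ f (Ψ.segment t x)).comp (ContinuousLinearMap.inr ℝ P E)

theorem contDiff_fderiv_comp_inr {f : P × E → ℂ} (hf : ContDiff ℝ ∞ f) :
    ContDiff ℝ ∞ (fun x => (fderiv ℝ f x).comp (ContinuousLinearMap.inr ℝ P E)) :=
  (hf.fderiv_right (m := ∞) (by exact_mod_cast le_top)).clm_comp contDiff_const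

theorem contDiff_fiberQuotient_integrand {f : P × E → ℂ} (hf : ContDiff ℝ ∞ f) :
    ContDiff ℝ ∞ (fun y : (P × E) × ℝ =>
      (fderiv ℝ f (Ψ.segment y.2 y.1)).comp (ContinuousLinearMap.inr ℝ P E)) :=
  (contDiff_fderiv_comp_inr hf).comp Ψ.contDiff_segment

theorem eq_fiberQuotient_apply {f : P × E → ℂ} (hf : ContDiff ℝ ∞ f) {p : P}
    (h0 : f (p, Ψ.crit p) = 0) (z : E) :
    f (p, z) = Ψ.fiberQuotient f (p, z) (z - Ψ.crit p) := by
  have hs : ContDiff ℝ ∞ (fun z => f (p, z)) := hf.comp (contDiff_const.prodMk contDiff_id)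
  have h1 := sub_eq_setIntegral_fderiv hs z (Ψ.crit p)
  rw [h0, sub_zero] at h1
  rw [h1, fiberQuotient]
  congr 2
  funext t
  exact ((hf.differentiable (by simp) _).hasFDerivAt.comp _
    (hasFDerivAt_prodMk_right (𝕜 := ℝ) p (Ψ.crit p + t • (z - Ψ.crit p)))).fderiv

/-- The quotient is an average of first derivatives along segments. The segment may leave s, which
is why f is assumed bounded everywhere. -/
theorem symbolOn_fiberQuotient {s : Set (P × E)} (hs : IsCompact s) {θ : ι → ℝ}
    (hθ : ∀ i, 0 < θ i) (hθ1 : ∀ i, θ i ≤ 1) {f : ι → P × E → ℂ}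
    (hf : SymbolOn Set.univ (fun _ _ => 1) (fun i _ => (θ i)⁻¹) f) :
    SymbolOn s (fun i _ => (θ i)⁻¹) (fun i _ => (θ i)⁻¹) (fun i => Ψ.fiberQuotient (f i)) := by
  have h1 : SymbolOn Set.univ (fun i _ => (θ i)⁻¹) (fun i _ => (θ i)⁻¹)
      (fun i x => (fderiv ℝ (f i) x).comp (ContinuousLinearMap.inr ℝ P E)) :=
    (hf.fderiv.const_clm ((ContinuousLinearMap.compL ℝ E (P × E) ℂ).flip
      (ContinuousLinearMap.inr ℝ P E))).congr_weight fun i x _ => one_mul _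
  refine SymbolOn.integral_Icc (f := fun i y =>
      (fderiv ℝ (f i) (Ψ.segment y.2 y.1)).comp (ContinuousLinearMap.inr ℝ P E))
    (fun i => Ψ.contDiff_fiberQuotient_integrand (hf.contDiff i)) ?_
  exact (h1.reindex (Prod.fst : ι × Set.Icc (0 : ℝ) 1 → ι)).comp (Ψ.symbolOn_segment hs)
    (fun j => (one_le_inv₀ (hθ j.1)).2 (hθ1 j.1)) (fun j => (inv_pos.2 (hθ j.1)).le)
    fun j => Set.mapsTo_univ _ _

theorem fiberQuotient_eq_zero {f : P × E → ℂ} {x : P × E}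
    (h : ∀ t ∈ Set.Icc (0 : ℝ) 1, Ψ.segment t x ∉ tsupport f) : Ψ.fiberQuotient f x = 0 := by
  refine setIntegral_eq_zero_of_forall_eq_zero fun t ht => ?_
  have : fderiv ℝ f (Ψ.segment t x) = 0 := by
    by_contra hne
    exact h t ht (support_fderiv_subset ℝ hne)
  rw [this, ContinuousLinearMap.zero_comp]

/-- Restriction of an amplitude to the critical set. -/
def atCrit (A : P × E → ℂ) (p : P) : ℂ := A (p, Ψ.crit p)

theorem contDiff_graph : ContDiff ℝ ∞ (fun p => (p, Ψ.crit p)) :=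
  contDiff_id.prodMk Ψ.contDiff_crit

theorem notMem_tsupport_atCrit {A : P × E → ℂ} {p : P} (h : (p, Ψ.crit p) ∉ tsupport A) :
    p ∉ tsupport (Ψ.atCrit A) := by
  rw [notMem_tsupport_iff_eventuallyEq] at h ⊢
  exact Ψ.contDiff_graph.continuous.continuousAt.eventually h

/-- The graph of the critical point has bounded derivatives only over compact sets; the support of
the amplitude reduces to one. -/
theorem symbolOn_atCrit {ρ r : ℝ} {θ : ι → ℝ}
    (hθ : ∀ i, 0 < θ i) (hθ1 : ∀ i, θ i ≤ 1) {A : ι → P × E → ℂ}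
    (hA : SymbolOn Set.univ (fun _ _ => 1) (fun i _ => (θ i)⁻¹) A)
    (hAs : ∀ i, tsupport (A i) ⊆ Metric.closedBall 0 ρ ×ˢ Metric.closedBall 0 r) :
    SymbolOn Set.univ (fun _ _ => 1) (fun i _ => (θ i)⁻¹) (fun i => Ψ.atCrit (A i)) := by
  have : ProperSpace P := FiniteDimensional.proper ℝ P
  have h1 : SymbolOn (Metric.closedBall (0 : P) ρ) (fun _ _ => 1) (fun _ _ => 1)
      (fun (_ : ι) p => (p, Ψ.crit p)) :=
    SymbolOn.of_isCompact Ψ.contDiff_graph (isCompact_closedBall _ _)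
  refine (hA.comp h1 (fun i => (one_le_inv₀ (hθ i)).2 (hθ1 i)) (fun _ => zero_le_one)
    fun i => Set.mapsTo_univ _ _).extend (fun _ _ => zero_le_one)
    (fun i _ => (inv_pos.2 (hθ i)).le) fun i p hp => ?_
  by_contra hne
  exact Ψ.notMem_tsupport_atCrit (fun h => hne (hAs i h).1) hp

variable [MeasureSpace E] [BorelSpace E] [(volume : Measure E).IsAddHaarMeasure]

/-- One step of the expansion: the value at the critical point times a universal factor, plus a
remainder with a gain of `h / θ ^ 2`. -/
theorem exists_expansion_step {ρ : ℝ} (hρ : 0 < ρ) (r : ℝ) {h θ : ι → ℝ}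
    (hh : ∀ i, 0 < h i) (hθ : ∀ i, 0 < θ i) (hθ1 : ∀ i, θ i ≤ 1)
    {A : ι → P × E → ℂ} (hA : SymbolOn Set.univ (fun _ _ => 1) (fun i _ => (θ i)⁻¹) A)
    (hAs : ∀ i, tsupport (A i) ⊆ Metric.closedBall 0 ρ ×ˢ Metric.closedBall 0 r) :
    ∃ (r' : ℝ) (χ : P × E → ℂ) (A' : ι → P × E → ℂ), ContDiff ℝ ∞ χ ∧
      tsupport χ ⊆ Metric.closedBall 0 (ρ + 1) ×ˢ Metric.closedBall 0 r' ∧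
      SymbolOn Set.univ (fun _ _ => 1) (fun i _ => (θ i)⁻¹) A' ∧
      (∀ i, tsupport (A' i) ⊆ Metric.closedBall 0 ρ ×ˢ Metric.closedBall 0 r') ∧
      (∀ i p, (p, Ψ.crit p) ∉ tsupport (A i) → (p, Ψ.crit p) ∉ tsupport (A' i)) ∧
      ∀ i p, oscIntegral (h i) Ψ.phase (A i) p =
        Ψ.atCrit (A i) p * oscIntegral (h i) Ψ.phase χ p +
          ((h i / θ i ^ 2 : ℝ) : ℂ) * oscIntegral (h i) Ψ.phase (A' i) p := by
  have : ProperSpace P := FiniteDimensional.proper ℝ P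
  have : ProperSpace E := FiniteDimensional.proper ℝ E
  obtain ⟨r₁, hr₁⟩ := (isCompact_closedBall (0 : P) ρ).exists_bound_of_continuousOn
    Ψ.contDiff_crit.continuous.continuousOn
  -- The ball of radius r₀ contains the fiber support of A and every critical point over ‖p‖ ≤ ρ, so
  -- χ below equals one at those critical points.
  set r₀ := max 1 (max r r₁) with hr₀
  have hr₀0 : 0 < r₀ := lt_of_lt_of_le one_pos (le_max_left _ _)
  have hrr₀ : r ≤ r₀ := (le_max_left _ _).trans (le_max_right _ _)
  have hr₁r₀ : r₁ ≤ r₀ := (le_max_right _ _).trans (le_max_right _ _)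
  obtain ⟨g, hg, hg1, -, hgs⟩ := exists_contDiff_eq_one_on_closedBall P hρ
  obtain ⟨f₁, hf₁, hf₁1, -, hf₁s⟩ := exists_contDiff_eq_one_on_closedBall E hr₀0
  -- Dividing by z - crit(p) destroys compact support in the fiber. The cutoff f₂ equals one on the
  -- fiber support of f, so it restores compactness without altering f.
  obtain ⟨f₂, hf₂, hf₂1, hf₂0, hf₂s⟩ := exists_contDiff_eq_one_on_closedBall E
    (show 0 < r₀ + 1 by linarith)
  have hθm : ∀ i, 1 ≤ (θ i)⁻¹ := fun i => (one_le_inv₀ (hθ i)).2 (hθ1 i)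
  have hθm0 : ∀ i, 0 ≤ (θ i)⁻¹ := fun i => (inv_pos.2 (hθ i)).le
  set χ : P × E → ℂ := fun x => ((g x.1 * f₁ x.2 : ℝ) : ℂ) with hχ
  have hχc : ContDiff ℝ ∞ χ := Complex.ofRealCLM.contDiff.comp
    ((hg.comp contDiff_fst).mul (hf₁.comp contDiff_snd))
  have hχs : tsupport χ ⊆ Metric.closedBall 0 (ρ + 1) ×ˢ Metric.closedBall 0 (r₀ + 1) := by
    refine closure_minimal (fun x hx => ⟨?_, ?_⟩) (Metric.isClosed_closedBall.prod
      Metric.isClosed_closedBall)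
    · refine hgs (subset_tsupport g fun h0 => hx ?_)
      simp [hχ, h0]
    · refine hf₁s (subset_tsupport f₁ fun h0 => hx ?_)
      simp [hχ, h0]
  set s₁ : Set (P × E) := Metric.closedBall 0 ρ ×ˢ Metric.closedBall 0 (r₀ + 1) with hs₁
  set s₂ : Set (P × E) := Metric.closedBall 0 ρ ×ˢ Metric.closedBall 0 (r₀ + 1 + 1) with hs₂
  have hs₁c : IsCompact s₁ := (isCompact_closedBall _ _).prod (isCompact_closedBall _ _)
  have hs₂c : IsCompact s₂ := (isCompact_closedBall _ _).prod (isCompact_closedBall _ _)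
  -- the amplitude minus its value on the critical set
  set f : ι → P × E → ℂ := fun i x => A i x - Ψ.atCrit (A i) x.1 * χ x with hf
  have hα := Ψ.symbolOn_atCrit hθ hθ1 hA hAs
  have hαs : ∀ i p, ρ < ‖p‖ → Ψ.atCrit (A i) p = 0 := fun i p hp => by
    by_contra hne
    have := (hAs i (subset_tsupport _ hne)).1
    rw [mem_closedBall_zero_iff] at this
    linarith
  have hfs : ∀ i, tsupport (f i) ⊆ s₁ := fun i => by
    refine closure_minimal (fun x hx => ?_) hs₁c.isClosed
    by_contra hxs
    have h1 : A i x = 0 := by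
      by_contra hne
      have := hAs i (subset_tsupport _ hne)
      refine hxs ⟨this.1, Metric.closedBall_subset_closedBall (by linarith) this.2⟩
    have h2 : Ψ.atCrit (A i) x.1 * χ x = 0 := by
      by_contra hne
      refine hxs ⟨?_, (hχs (subset_tsupport _ (right_ne_zero_of_mul hne))).2⟩
      rw [mem_closedBall_zero_iff]
      by_contra hlt
      exact left_ne_zero_of_mul hne (hαs i _ (not_le.1 hlt))
    exact hx (by simp [hf, h1, h2])
  have hfsym : SymbolOn Set.univ (fun _ _ => 1) (fun i _ => (θ i)⁻¹) f := by
    refine SymbolOn.extend (s := s₁) ?_ (fun _ _ => zero_le_one) (fun i _ => hθm0 i) hfs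
    refine (hA.mono_set (Set.subset_univ _)).sub ?_
    have h1 : SymbolOn s₁ (fun _ _ => 1) (fun i _ => (θ i)⁻¹)
        (fun i x => Ψ.atCrit (A i) x.1) :=
      hα.comp (g := fun _ => Prod.fst) (SymbolOn.of_isCompact contDiff_fst hs₁c) hθm
        (fun _ => zero_le_one) fun _ => Set.mapsTo_univ _ _
    exact (h1.mul (SymbolOn.of_isCompact_of_one_le hχc hs₁c fun i _ _ => hθm i)).congr_weight
      fun i x _ => one_mul _
  have hf0 : ∀ i p, f i (p, Ψ.crit p) = 0 := fun i p => by
    by_cases hp : ‖p‖ ≤ ρ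
    · have h1 : ‖Ψ.crit p‖ ≤ r₀ := (hr₁ p (by simpa using hp)).trans hr₁r₀
      simp [hf, hχ, atCrit, hg1 p hp, hf₁1 _ h1]
    · have h1 := hαs i p (not_le.1 hp)
      have h2 : A i (p, Ψ.crit p) = 0 := h1
      simp [hf, h1, h2]
  -- the field whose divergence is the new amplitude
  set B : ι → P × E → (E →L[ℝ] ℝ) →L[ℝ] ℂ := fun i x =>
    f₂ x.2 • (Ψ.fiberQuotient (f i) x).comp (Ψ.fiberCoeff x) with hB
  have hBsym : SymbolOn s₂ (fun i _ => (θ i)⁻¹) (fun i _ => (θ i)⁻¹) B := by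
    have h1 := (Ψ.symbolOn_fiberQuotient hs₂c hθ hθ1 hfsym).clm_comp
      (SymbolOn.of_isCompact_of_one_le Ψ.contDiff_fiberCoeff hs₂c fun i _ _ => hθm i)
    have h2 : SymbolOn s₂ (fun _ _ => 1) (fun i _ => (θ i)⁻¹) (fun (_ : ι) (x : P × E) => f₂ x.2) :=
      SymbolOn.of_isCompact_of_one_le (hf₂.comp contDiff_snd) hs₂c fun i _ _ => hθm i
    exact (h2.smul h1).congr_weight fun i x _ => by simp
  have hBs : ∀ i, tsupport (B i) ⊆ s₂ := fun i => by
    refine closure_minimal (fun x hx => ?_) hs₂c.isClosed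
    by_contra hxs
    refine hx ?_
    by_cases h1 : ‖x.1‖ ≤ ρ
    · have h2 : r₀ + 1 + 1 < ‖x.2‖ := by
        by_contra hlt
        exact hxs ⟨by simpa using h1, by simpa using hlt⟩
      exact ContinuousLinearMap.ext fun l => by simp [hB, hf₂0 _ h2]
    · have : Ψ.fiberQuotient (f i) x = 0 := Ψ.fiberQuotient_eq_zero fun t _ ht => by
        have := (hfs i ht).1
        rw [mem_closedBall_zero_iff] at this
        exact h1 this
      exact ContinuousLinearMap.ext fun l => by simp [hB, this]
  have hBc : ∀ i, ContDiff ℝ ∞ (B i) := hBsym.contDiff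
  have hDs : ∀ i, tsupport (fun x => ((θ i ^ 2 : ℝ) * Complex.I) • fiberDiv (B i) x) ⊆
      tsupport (B i) := fun i =>
    (tsupport_smul_subset_right _ _).trans (tsupport_fiberDiv_subset _)
  -- Since f = B(dΦ), its integral is ih∫e^{iΦ/h} div B. The divergence has size θ⁻², so iθ² div B
  -- is a symbol of weight one with prefactor h/θ².
  refine ⟨r₀ + 1 + 1, χ, fun i x => ((θ i ^ 2 : ℝ) * Complex.I) • fiberDiv (B i) x, hχc,
    hχs.trans (Set.prod_mono le_rfl (Metric.closedBall_subset_closedBall (by linarith))),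
    ?_, fun i => (hDs i).trans (hBs i), ?_, ?_⟩
  · refine SymbolOn.extend (s := s₂) ?_ (fun _ _ => zero_le_one) (fun i _ => hθm0 i)
      fun i => (hDs i).trans (hBs i)
    refine (hBsym.fiberDiv.const_smul (fun i => ((θ i ^ 2 : ℝ) : ℂ) * Complex.I)).congr_weight
      fun i x _ => ?_
    have := (hθ i).ne'
    rw [norm_mul, Complex.norm_I, mul_one, Complex.norm_real, Real.norm_of_nonneg (sq_nonneg _)]
    field_simp
  · intro i p hp
    suffices hBp : (p, Ψ.crit p) ∉ tsupport (B i) from fun h => hBp (hDs i h)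
    have hα0 := Ψ.notMem_tsupport_atCrit hp
    have hfp : (p, Ψ.crit p) ∉ tsupport (f i) := by
      rw [notMem_tsupport_iff_eventuallyEq] at hp hα0 ⊢
      have h1 : ∀ᶠ x : P × E in 𝓝 (p, Ψ.crit p), Ψ.atCrit (A i) x.1 = 0 :=
        (continuous_fst.tendsto (p, Ψ.crit p)).eventually hα0
      filter_upwards [hp, h1] with x hx1 hx2
      simp only [hf, hx1, hx2, Pi.zero_apply, zero_mul, sub_zero]
    rw [notMem_tsupport_iff_eventuallyEq]
    -- A ball that misses the support of f is convex, so segments from nearby critical points to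
    -- nearby points stay in it and the quotient vanishes near (p, crit p).
    obtain ⟨ε, hε, hball⟩ := Metric.mem_nhds_iff.1
      ((isClosed_tsupport (f i)).isOpen_compl.mem_nhds hfp)
    have h2 : ∀ᶠ x : P × E in 𝓝 (p, Ψ.crit p), Ψ.crit x.1 ∈ Metric.ball (Ψ.crit p) ε :=
      (Ψ.contDiff_crit.continuous.comp continuous_fst).continuousAt.eventually
        (Metric.ball_mem_nhds _ hε)
    filter_upwards [h2, Metric.ball_mem_nhds (p, Ψ.crit p) hε] with x hx1 hx2
    rw [← ball_prod_same] at hx2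
    have : Ψ.fiberQuotient (f i) x = 0 := Ψ.fiberQuotient_eq_zero fun t ht => by
      refine hball ?_
      rw [← ball_prod_same]
      refine ⟨hx2.1, ?_⟩
      exact (convex_ball _ _).add_smul_sub_mem hx1 hx2.2 ht
    exact ContinuousLinearMap.ext fun l => by simp [hB, this]
  · intro i p
    have hK : IsCompact (Metric.closedBall (0 : E) (r₀ + 1 + 1)) := isCompact_closedBall _ _
    have hfB : ∀ x, f i x = B i x (fiberDeriv Ψ.phase x) := fun x => by
      have h1 : B i x (fiberDeriv Ψ.phase x) = f₂ x.2 • f i x := by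
        simp only [hB, _root_.smul_apply, ContinuousLinearMap.comp_apply, ← Ψ.sub_crit]
        rw [← Ψ.eq_fiberQuotient_apply (hfsym.contDiff i) (hf0 i x.1) x.2]
      rw [h1]
      by_cases hx : f i x = 0
      · rw [hx, smul_zero]
      · have := (hfs i (subset_tsupport _ hx)).2
        rw [mem_closedBall_zero_iff] at this
        rw [hf₂1 _ this, one_smul]
    have hI := oscIntegral_clm_fiberDeriv (hh i).ne' Ψ.contDiff_phase (hBc i) hK
      (fun x hx => (hBs i hx).2) p
    simp only [← hfB] at hI
    have hAf : A i = fun x => Ψ.atCrit (A i) x.1 * χ x + f i x := by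
      funext x; simp only [hf]; ring
    have hle1 : Metric.closedBall (0 : E) (r₀ + 1) ⊆ Metric.closedBall 0 (r₀ + 1 + 1) :=
      Metric.closedBall_subset_closedBall (by linarith)
    have hsplit := oscIntegral_add (h := h i) Ψ.contDiff_phase
      (A := fun x => Ψ.atCrit (A i) x.1 * χ x) (A' := f i)
      (((hα.contDiff i).comp contDiff_fst).mul hχc) (hfsym.contDiff i) hK
      (tsupport_mul_subset_right.trans (hχs.trans fun x hx => hle1 hx.2))
      ((hfs i).trans fun x hx => hle1 hx.2) p
    have hc := oscIntegral_const_mul (h := h i) (Φ := Ψ.phase)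
      (fun _ => ((θ i ^ 2 : ℝ) : ℂ) * Complex.I) (fiberDiv (B i)) p
    have hθc : (θ i : ℂ) ≠ 0 := by exact_mod_cast (hθ i).ne'
    simp only [smul_eq_mul]
    rw [hc]
    conv_lhs => rw [hAf]
    rw [hsplit, oscIntegral_const_mul, hI]
    congr 1
    push_cast
    field_simp

/-- The expansion of an oscillatory integral with amplitude at scale `θ ≥ √h` in powers of
`h / θ ^ 2`. -/
theorem exists_expansion {ρ : ℝ} (hρ : 0 < ρ) (r : ℝ) {h θ : ι → ℝ}
    (hh : ∀ i, 0 < h i) (hhθ : ∀ i, h i ≤ θ i ^ 2) (hθ : ∀ i, 0 < θ i) (hθ1 : ∀ i, θ i ≤ 1)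
    {A : ι → P × E → ℂ} (hA : SymbolOn Set.univ (fun _ _ => 1) (fun i _ => (θ i)⁻¹) A)
    (hAs : ∀ i, tsupport (A i) ⊆ Metric.closedBall 0 ρ ×ˢ Metric.closedBall 0 r) (M : ℕ) :
    ∃ (c : ι → P → ℂ) (r' : ℝ) (A' : ι → P × E → ℂ),
      SymbolOn Set.univ (fun _ _ => 1) (fun i _ => (θ i)⁻¹) c ∧
      SymbolOn Set.univ (fun _ _ => 1) (fun i _ => (θ i)⁻¹) A' ∧
      (∀ i, tsupport (A' i) ⊆ Metric.closedBall 0 ρ ×ˢ Metric.closedBall 0 r') ∧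
      (∀ i p, (p, Ψ.crit p) ∉ tsupport (A i) →
        p ∉ tsupport (c i) ∧ (p, Ψ.crit p) ∉ tsupport (A' i)) ∧
      ∀ i p, oscIntegral (h i) Ψ.phase (A i) p =
        ((√(h i) ^ Module.finrank ℝ E : ℝ) : ℂ) * c i p +
          (((h i / θ i ^ 2) ^ M : ℝ) : ℂ) * oscIntegral (h i) Ψ.phase (A' i) p := by
  have : ProperSpace P := FiniteDimensional.proper ℝ P
  have : ProperSpace E := FiniteDimensional.proper ℝ E
  induction M with
  | zero =>
    refine ⟨fun _ _ => 0, r, A, SymbolOn.zero, hA, hAs, fun i p hp => ⟨?_, hp⟩, fun i p => ?_⟩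
    · have : tsupport (fun _ : P => (0 : ℂ)) = ∅ := by
        rw [tsupport_eq_empty_iff]; rfl
      rw [this]
      exact Set.notMem_empty _
    · simp
  | succ M ih =>
    obtain ⟨c, r₁, A₁, hc, hA₁, hA₁s, hloc, heq⟩ := ih
    obtain ⟨r₂, χ, A₂, hχ, hχs, hA₂, hA₂s, hloc₂, heq₂⟩ :=
      Ψ.exists_expansion_step hρ r₁ hh hθ hθ1 hA₁ hA₁s
    set d := Module.finrank ℝ E
    have hθm : ∀ i, 1 ≤ (θ i)⁻¹ := fun i => (one_le_inv₀ (hθ i)).2 (hθ1 i)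
    have hs : IsCompact (Metric.closedBall (0 : P) (ρ + 1) ×ˢ Metric.closedBall (0 : E) r₂) :=
      (isCompact_closedBall _ _).prod (isCompact_closedBall _ _)
    -- the universal factor
    have hJ : SymbolOn Set.univ (fun _ _ => 1) (fun i _ => (θ i)⁻¹) (fun i p =>
        (((√(h i) ^ d)⁻¹ : ℝ) : ℂ) • oscIntegral (h i) Ψ.phase χ p) := by
      have h1 : SymbolOn Set.univ (fun i _ => √(h i) ^ d) (fun i _ => (θ i)⁻¹)
          (fun i => oscIntegral (h i) Ψ.phase χ) := by
        refine ⟨fun i => Ψ.contDiff_oscIntegral hχ hs hχs, fun k => ?_⟩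
        obtain ⟨C, hC0, hC⟩ := Ψ.norm_iteratedFDeriv_oscIntegral_le (A := fun _ : ι => χ) hs hh
          hhθ hθ hθ1 (SymbolOn.of_isCompact_of_one_le hχ hs fun i _ _ => hθm i) (fun _ => hχs) k 0
        refine ⟨C, hC0, fun i p _ => ?_⟩
        have := hC i p 0 (Or.inl rfl)
        simpa using this
      refine (h1.const_smul fun i => (((√(h i) ^ d)⁻¹ : ℝ) : ℂ)).congr_weight fun i p _ => ?_
      have : 0 < √(h i) ^ d := pow_pos (Real.sqrt_pos.2 (hh i)) _
      rw [Complex.norm_real, Real.norm_of_nonneg (inv_pos.2 this).le, inv_mul_cancel₀ this.ne']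
    have hα := Ψ.symbolOn_atCrit hθ hθ1 hA₁ hA₁s
    -- The remainder of order M is expanded once more. The integral of χ is not evaluated; that it
    -- is √h^d times a symbol is all that is needed.
    refine ⟨fun i p => c i p + (((h i / θ i ^ 2) ^ M : ℝ) : ℂ) • (Ψ.atCrit (A₁ i) p *
      ((((√(h i) ^ d)⁻¹ : ℝ) : ℂ) • oscIntegral (h i) Ψ.phase χ p)), r₂, A₂, ?_, hA₂, hA₂s, ?_, ?_⟩
    · refine hc.add (((hα.mul hJ).const_smul fun i =>
        (((h i / θ i ^ 2) ^ M : ℝ) : ℂ)).mono_weight (fun i _ _ => zero_le_one.trans (hθm i))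
        zero_le_one fun i p _ => ?_)
      have h1 : h i / θ i ^ 2 ≤ 1 := div_le_one_of_le₀ (hhθ i) (sq_nonneg _)
      have h0 : 0 ≤ h i / θ i ^ 2 := div_nonneg (hh i).le (sq_nonneg _)
      rw [Complex.norm_real, Real.norm_of_nonneg (pow_nonneg h0 _)]
      simpa using pow_le_one₀ h0 h1
    · intro i p hp
      obtain ⟨hcp, hA₁p⟩ := hloc i p hp
      refine ⟨fun hmem => ?_, hloc₂ i p hA₁p⟩
      rcases tsupport_add _ _ hmem with h1 | h1
      · exact hcp h1
      · exact Ψ.notMem_tsupport_atCrit hA₁p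
          (tsupport_mul_subset_left (tsupport_smul_subset_right _ _ h1))
    · intro i p
      rw [heq i p, heq₂ i p]
      have h1 : ((√(h i) : ℝ) : ℂ) ≠ 0 := by exact_mod_cast (Real.sqrt_pos.2 (hh i)).ne'
      simp only [smul_eq_mul]
      push_cast
      field_simp
      ring

end CritPhase

end Expansion

/-! ### Functions that are smooth multiples of the fiber derivative of a phase. -/

section FiberIdeal

variable {P E V W : Type*} [NormedAddCommGroup P] [NormedSpace ℝ P]
  [NormedAddCommGroup E] [NormedSpace ℝ E]
  [NormedAddCommGroup V] [NormedSpace ℝ V] [NormedAddCommGroup W] [NormedSpace ℝ W]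

/-- `f` depends linearly, with smooth coefficients, on the fiber derivative of `Φ`. -/
def InFiberIdeal (Φ : P × E → ℝ) (f : P × E → V) : Prop :=
  ∃ G : P × E → (E →L[ℝ] ℝ) →L[ℝ] V, ContDiff ℝ ∞ G ∧ ∀ x, f x = G x (fiberDeriv Φ x)

namespace InFiberIdeal

variable {Φ : P × E → ℝ}

theorem add {f g : P × E → V} (hf : InFiberIdeal Φ f) (hg : InFiberIdeal Φ g) :
    InFiberIdeal Φ (fun x => f x + g x) := by
  obtain ⟨F, hF, hf⟩ := hf
  obtain ⟨G, hG, hg⟩ := hg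
  exact ⟨fun x => F x + G x, hF.add hG, fun x => by simp only [hf, hg]; rfl⟩

theorem clm {f : P × E → V} (hf : InFiberIdeal Φ f) {L : P × E → V →L[ℝ] W}
    (hL : ContDiff ℝ ∞ L) : InFiberIdeal Φ (fun x => L x (f x)) := by
  obtain ⟨F, hF, hf⟩ := hf
  exact ⟨fun x => (L x).comp (F x), hL.clm_comp hF, fun x => by simp only [hf]; rfl⟩

theorem const_clm {f : P × E → V} (hf : InFiberIdeal Φ f) (L : V →L[ℝ] W) :
    InFiberIdeal Φ (fun x => L (f x)) :=
  hf.clm (L := fun _ => L) contDiff_const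

theorem neg {f : P × E → V} (hf : InFiberIdeal Φ f) : InFiberIdeal Φ (fun x => -f x) :=
  hf.const_clm (-ContinuousLinearMap.id ℝ V)

theorem sub {f g : P × E → V} (hf : InFiberIdeal Φ f) (hg : InFiberIdeal Φ g) :
    InFiberIdeal Φ (fun x => f x - g x) := by
  simpa only [sub_eq_add_neg] using hf.add hg.neg

theorem prodMk {f : P × E → V} {g : P × E → W} (hf : InFiberIdeal Φ f) (hg : InFiberIdeal Φ g) :
    InFiberIdeal Φ (fun x => (f x, g x)) := by
  have := (hf.const_clm (ContinuousLinearMap.inl ℝ V W)).add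
    (hg.const_clm (ContinuousLinearMap.inr ℝ V W))
  simpa using this

/-- The difference of values of a smooth function at two points. -/
theorem comp_sub_comp [FiniteDimensional ℝ V] [CompleteSpace W] {g : V → W}
    (hg : ContDiff ℝ ∞ g) {a b : P × E → V} (ha : ContDiff ℝ ∞ a) (hb : ContDiff ℝ ∞ b)
    (hab : InFiberIdeal Φ (fun x => a x - b x)) :
    InFiberIdeal Φ (fun x => g (a x) - g (b x)) := by
  obtain ⟨L, hL, h⟩ := hg.exists_sub_eq_clm
  simp only [h]
  exact hab.clm (hL.comp (ha.prodMk hb))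

end InFiberIdeal

end FiberIdeal

/-! ### Identification of covectors with vectors. -/

section Riesz

variable (X : Type*) [NormedAddCommGroup X] [InnerProductSpace ℝ X] [FiniteDimensional ℝ X]

/-- The vector representing a functional, as a linear map over the reals. -/
def rieszVector : (X →L[ℝ] ℝ) →L[ℝ] X :=
  have : CompleteSpace X := FiniteDimensional.complete ℝ X
  LinearMap.toContinuousLinearMap
    { toFun := fun l => (InnerProductSpace.toDual ℝ X).symm l
      map_add' := fun l m => map_add _ _ _
      map_smul' := fun c l => by simp }

variable {X}

theorem inner_rieszVector (l : X →L[ℝ] ℝ) (v : X) : ⟪rieszVector X l, v⟫_ℝ = l v := by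
  have : CompleteSpace X := FiniteDimensional.complete ℝ X
  exact InnerProductSpace.toDual_symm_apply

theorem rieszVector_eq {l : X →L[ℝ] ℝ} {u : X} (h : ∀ v, l v = ⟪u, v⟫_ℝ) :
    rieszVector X l = u :=
  ext_inner_right ℝ fun v => by rw [inner_rieszVector, h]

theorem gradient_eq_rieszVector [CompleteSpace X] (f : X → ℝ) (x : X) :
    gradient f x = rieszVector X (fderiv ℝ f x) := rfl

/-- Used to read off generators: the component of the fiber derivative along each coordinate block
lies in the ideal. -/
theorem InFiberIdeal.of_inner {P E : Type*} [NormedAddCommGroup P] [NormedSpace ℝ P]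
    [NormedAddCommGroup E] [NormedSpace ℝ E] {Φ : P × E → ℝ} (T : X →L[ℝ] E) {u : P × E → X}
    (h : ∀ x v, fiberDeriv Φ x (T v) = ⟪u x, v⟫_ℝ) : InFiberIdeal Φ u :=
  ⟨fun _ => (rieszVector X).comp ((ContinuousLinearMap.compL ℝ X E ℝ).flip T), contDiff_const,
    fun x => (rieszVector_eq (h x)).symm⟩

end Riesz

/-! ### The phase of the composition and its critical points. -/

section CompositionPhase

variable {n : ℕ}

/-- The gradient in the first variable. -/
def gradFst (φ : Phase n → ℝ) (z : Phase n) : Config n := gradient (fun x => φ (x, z.2)) z.1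

/-- The gradient in the second variable. -/
def gradSnd (φ : Phase n → ℝ) (z : Phase n) : Config n := gradient (fun η => φ (z.1, η)) z.2

variable {φ : Phase n → ℝ}

theorem inner_gradFst (hφ : ContDiff ℝ ∞ φ) (z : Phase n) (v : Config n) :
    ⟪gradFst φ z, v⟫_ℝ = fderiv ℝ φ z (v, 0) := by
  rw [gradFst, gradient_eq_rieszVector, inner_rieszVector]
  have := ((hφ.differentiable (by simp) z).hasFDerivAt.comp z.1
    (hasFDerivAt_prodMk_left (𝕜 := ℝ) z.1 z.2)).fderiv
  exact congrArg (fun l => l v) this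

theorem inner_gradSnd (hφ : ContDiff ℝ ∞ φ) (z : Phase n) (v : Config n) :
    ⟪gradSnd φ z, v⟫_ℝ = fderiv ℝ φ z (0, v) := by
  rw [gradSnd, gradient_eq_rieszVector, inner_rieszVector]
  have := ((hφ.differentiable (by simp) z).hasFDerivAt.comp z.2
    (hasFDerivAt_prodMk_right (𝕜 := ℝ) z.1 z.2)).fderiv
  exact congrArg (fun l => l v) this

theorem contDiff_gradFst (hφ : ContDiff ℝ ∞ φ) : ContDiff ℝ ∞ (gradFst φ) := by
  have : gradFst φ = fun z => rieszVector (Config n)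
      ((fderiv ℝ φ z).comp (ContinuousLinearMap.inl ℝ (Config n) (Config n))) :=
    funext fun z => (rieszVector_eq fun v => (inner_gradFst hφ z v).symm).symm
  rw [this]
  exact (rieszVector _).contDiff.comp ((hφ.fderiv_right (m := ∞) (by exact_mod_cast le_top)).clm_comp
    contDiff_const)

theorem contDiff_gradSnd (hφ : ContDiff ℝ ∞ φ) : ContDiff ℝ ∞ (gradSnd φ) := by
  have : gradSnd φ = fun z => rieszVector (Config n)
      ((fderiv ℝ φ z).comp (ContinuousLinearMap.inr ℝ (Config n) (Config n))) :=
    funext fun z => (rieszVector_eq fun v => (inner_gradSnd hφ z v).symm).symm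
  rw [this]
  exact (rieszVector _).contDiff.comp ((hφ.fderiv_right (m := ∞) (by exact_mod_cast le_top)).clm_comp
    contDiff_const)

theorem Generates.apply_gradSnd {κ : Phase n → Phase n} (h : Generates φ κ) (x η : Config n) :
    κ (gradSnd φ (x, η), η) = (x, gradFst φ (x, η)) :=
  (h _ _ _ _).2 ⟨rfl, rfl⟩

/-- The phase of the Schwartz kernel of `S B S*`, tested against a plane wave. The base point is
`(x, ρ)` and the integration variable is `((y, ξ), (η, x'))`. -/
def compositionPhase (φ : Phase n → ℝ) (x : Phase n × (Phase n × Phase n)) : ℝ :=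
  φ (x.1.1, x.2.2.1) - φ (x.2.2.2, x.2.1.2) + ⟪x.2.1.1, x.2.1.2 - x.2.2.1⟫_ℝ -
    ⟪x.1.1 - x.2.2.2, x.1.2⟫_ℝ

theorem contDiff_compositionPhase (hφ : ContDiff ℝ ∞ φ) :
    ContDiff ℝ ∞ (compositionPhase φ) := by
  have h1 : ContDiff ℝ ∞ (fun x : Phase n × (Phase n × Phase n) =>
      ⟪x.2.1.1, x.2.1.2 - x.2.2.1⟫_ℝ) := ContDiff.inner ℝ (by fun_prop) (by fun_prop)
  have h2 : ContDiff ℝ ∞ (fun x : Phase n × (Phase n × Phase n) =>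
      ⟪x.1.1 - x.2.2.2, x.1.2⟫_ℝ) := ContDiff.inner ℝ (by fun_prop) (by fun_prop)
  exact (((hφ.comp (by fun_prop)).sub (hφ.comp (by fun_prop))).add h1).sub h2

theorem fderiv_compositionPhase (hφ : ContDiff ℝ ∞ φ) (x v : Phase n × (Phase n × Phase n)) :
    fderiv ℝ (compositionPhase φ) x v =
      fderiv ℝ φ (x.1.1, x.2.2.1) (v.1.1, v.2.2.1) - fderiv ℝ φ (x.2.2.2, x.2.1.2) (v.2.2.2, v.2.1.2)
      + (⟪x.2.1.1, v.2.1.2 - v.2.2.1⟫_ℝ + ⟪v.2.1.1, x.2.1.2 - x.2.2.1⟫_ℝ)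
      - (⟪x.1.1 - x.2.2.2, v.1.2⟫_ℝ + ⟪v.1.1 - v.2.2.2, x.1.2⟫_ℝ) := by
  have hd := hφ.differentiable (by simp)
  have h11 : HasFDerivAt (fun x : Phase n × (Phase n × Phase n) => x.1.1) _ x :=
    (hasFDerivAt_fst (𝕜 := ℝ) (p := x)).fst
  have h12 : HasFDerivAt (fun x : Phase n × (Phase n × Phase n) => x.1.2) _ x :=
    (hasFDerivAt_fst (𝕜 := ℝ) (p := x)).snd
  have h211 : HasFDerivAt (fun x : Phase n × (Phase n × Phase n) => x.2.1.1) _ x :=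
    (hasFDerivAt_snd (𝕜 := ℝ) (p := x)).fst.fst
  have h212 : HasFDerivAt (fun x : Phase n × (Phase n × Phase n) => x.2.1.2) _ x :=
    (hasFDerivAt_snd (𝕜 := ℝ) (p := x)).fst.snd
  have h221 : HasFDerivAt (fun x : Phase n × (Phase n × Phase n) => x.2.2.1) _ x :=
    (hasFDerivAt_snd (𝕜 := ℝ) (p := x)).snd.fst
  have h222 : HasFDerivAt (fun x : Phase n × (Phase n × Phase n) => x.2.2.2) _ x :=
    (hasFDerivAt_snd (𝕜 := ℝ) (p := x)).snd.snd
  have e1 := (hd (x.1.1, x.2.2.1)).hasFDerivAt.comp x (h11.prodMk h221)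
  have e2 := (hd (x.2.2.2, x.2.1.2)).hasFDerivAt.comp x (h222.prodMk h212)
  have e3 := h211.inner ℝ (h212.sub h221)
  have e4 := (h11.sub h222).inner ℝ h12
  have e5 := ((e1.sub e2).add e3).sub e4
  have e6 : HasFDerivAt (compositionPhase φ) _ x := e5
  rw [e6.fderiv]
  simp [fderivInnerCLM_apply]

theorem fiberDeriv_compositionPhase (hφ : ContDiff ℝ ∞ φ) (x : Phase n × (Phase n × Phase n))
    (v : Phase n × Phase n) :
    fiberDeriv (compositionPhase φ) x v =
      ⟪x.2.1.2 - x.2.2.1, v.1.1⟫_ℝ + ⟪x.2.1.1 - gradSnd φ (x.2.2.2, x.2.1.2), v.1.2⟫_ℝ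
      + ⟪gradSnd φ (x.1.1, x.2.2.1) - x.2.1.1, v.2.1⟫_ℝ
      + ⟪x.1.2 - gradFst φ (x.2.2.2, x.2.1.2), v.2.2⟫_ℝ := by
  have h0 : fderiv ℝ φ (x.2.2.2, x.2.1.2) (v.2.2, v.1.2) =
      ⟪gradFst φ (x.2.2.2, x.2.1.2), v.2.2⟫_ℝ + ⟪gradSnd φ (x.2.2.2, x.2.1.2), v.1.2⟫_ℝ := by
    rw [inner_gradFst hφ, inner_gradSnd hφ, ← map_add]
    simp
  have h1 : fderiv ℝ φ (x.1.1, x.2.2.1) (0, v.2.1) = ⟪gradSnd φ (x.1.1, x.2.2.1), v.2.1⟫_ℝ :=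
    (inner_gradSnd hφ _ _).symm
  simp only [fiberDeriv, ContinuousLinearMap.comp_apply, ContinuousLinearMap.inr_apply,
    fderiv_compositionPhase hφ, Prod.fst_zero, Prod.snd_zero, h0, h1, inner_sub_left,
    inner_sub_right, inner_zero_left, inner_zero_right, real_inner_comm]
  ring

theorem fderiv_compositionPhase_param (hφ : ContDiff ℝ ∞ φ) (x : Phase n × (Phase n × Phase n))
    (e : Phase n) :
    fderiv ℝ (compositionPhase φ) x (e, 0) =
      ⟪gradFst φ (x.1.1, x.2.2.1) - x.1.2, e.1⟫_ℝ - ⟪x.1.1 - x.2.2.2, e.2⟫_ℝ := by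
  have h1 : fderiv ℝ φ (x.1.1, x.2.2.1) (e.1, 0) = ⟪gradFst φ (x.1.1, x.2.2.1), e.1⟫_ℝ :=
    (inner_gradFst hφ _ _).symm
  have h2 : fderiv ℝ φ (x.2.2.2, x.2.1.2) (0, 0) = 0 := map_zero _
  simp only [fderiv_compositionPhase hφ, Prod.fst_zero, Prod.snd_zero, h1, h2, inner_sub_left,
    inner_sub_right, inner_zero_left, inner_zero_right, real_inner_comm]
  ring

set_option maxHeartbeats 1600000 in
/-- The composition phase has a single critical point in each fiber, described by `κ⁻¹`. -/
theorem exists_critPhase (hφ : ContDiff ℝ ∞ φ) {κ κinv : Phase n → Phase n}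
    (hκ : ContDiff ℝ ∞ κ) (hκinv : ContDiff ℝ ∞ κinv) (hl : Function.LeftInverse κinv κ)
    (hφκ : Generates φ κ) :
    ∃ Ψ : CritPhase (Phase n) (Phase n × Phase n), Ψ.phase = compositionPhase φ ∧
      Ψ.crit = fun p => (κinv p, ((κinv p).2, p.1)) := by
  set Φ := compositionPhase φ with hΦ
  have hgF := contDiff_gradFst hφ
  have hgS := contDiff_gradSnd hφ
  -- The generators u1, u2, u3, u4 are the derivatives of the phase along η, y, ξ and x'. Everything
  -- that follows is elimination in the ideal they generate.
  have u1 : InFiberIdeal Φ (fun x => gradSnd φ (x.1.1, x.2.2.1) - x.2.1.1) :=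
    InFiberIdeal.of_inner ((ContinuousLinearMap.inr ℝ (Phase n) (Phase n)).comp
      (ContinuousLinearMap.inl ℝ (Config n) (Config n))) fun x v => by
        simp [hΦ, fiberDeriv_compositionPhase hφ]
  have u2 : InFiberIdeal Φ (fun x => x.2.1.2 - x.2.2.1) :=
    InFiberIdeal.of_inner ((ContinuousLinearMap.inl ℝ (Phase n) (Phase n)).comp
      (ContinuousLinearMap.inl ℝ (Config n) (Config n))) fun x v => by
        simp [hΦ, fiberDeriv_compositionPhase hφ]
  have u3 : InFiberIdeal Φ (fun x => x.2.1.1 - gradSnd φ (x.2.2.2, x.2.1.2)) :=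
    InFiberIdeal.of_inner ((ContinuousLinearMap.inl ℝ (Phase n) (Phase n)).comp
      (ContinuousLinearMap.inr ℝ (Config n) (Config n))) fun x v => by
        simp [hΦ, fiberDeriv_compositionPhase hφ]
  have u4 : InFiberIdeal Φ (fun x => x.1.2 - gradFst φ (x.2.2.2, x.2.1.2)) :=
    InFiberIdeal.of_inner ((ContinuousLinearMap.inr ℝ (Phase n) (Phase n)).comp
      (ContinuousLinearMap.inr ℝ (Config n) (Config n))) fun x v => by
        simp [hΦ, fiberDeriv_compositionPhase hφ]
  have d0 : InFiberIdeal Φ (fun x : Phase n × (Phase n × Phase n) =>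
      (x.1.1, x.2.1.2) - (x.1.1, x.2.2.1)) := by
    simpa using u2.const_clm (ContinuousLinearMap.inr ℝ (Config n) (Config n))
  have f1 : InFiberIdeal Φ (fun x => gradSnd φ (x.1.1, x.2.1.2) - gradSnd φ (x.1.1, x.2.2.1)) :=
    InFiberIdeal.comp_sub_comp hgS (by fun_prop) (by fun_prop) d0
  have f2 : InFiberIdeal Φ (fun x => gradSnd φ (x.1.1, x.2.1.2) - gradSnd φ (x.2.2.2, x.2.1.2)) := by
    simpa using (f1.add u1).add u3
  -- By f2 the points (d_ηφ(x,ξ), ξ) and (d_ηφ(x',ξ), ξ) agree modulo the ideal, hence so do their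
  -- images (x, d_xφ(x,ξ)) and (x', d_xφ(x',ξ)) under κ. The first components give x - x'.
  have f3 : InFiberIdeal Φ (fun x => κ (gradSnd φ (x.1.1, x.2.1.2), x.2.1.2) -
      κ (gradSnd φ (x.2.2.2, x.2.1.2), x.2.1.2)) :=
    InFiberIdeal.comp_sub_comp hκ (Φ := Φ)
      (a := fun x : Phase n × (Phase n × Phase n) => (gradSnd φ (x.1.1, x.2.1.2), x.2.1.2))
      (b := fun x : Phase n × (Phase n × Phase n) => (gradSnd φ (x.2.2.2, x.2.1.2), x.2.1.2))
      ((hgS.comp (by fun_prop)).prodMk (by fun_prop))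
      ((hgS.comp (by fun_prop)).prodMk (by fun_prop))
      (by simpa using f2.const_clm (ContinuousLinearMap.inl ℝ (Config n) (Config n)))
  simp only [hφκ.apply_gradSnd] at f3
  have f4 : InFiberIdeal Φ (fun x => x.1.1 - x.2.2.2) :=
    f3.const_clm (ContinuousLinearMap.fst ℝ (Config n) (Config n))
  have f5 : InFiberIdeal Φ (fun x => gradFst φ (x.1.1, x.2.1.2) - gradFst φ (x.2.2.2, x.2.1.2)) :=
    f3.const_clm (ContinuousLinearMap.snd ℝ (Config n) (Config n))
  have f6 : InFiberIdeal Φ (fun x => gradFst φ (x.1.1, x.2.1.2) - x.1.2) := by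
    simpa using f5.sub u4
  -- By f6, (x, d_xφ(x,ξ)) agrees with (x,ρ). Applying κ⁻¹, whose value at the first point is
  -- (d_ηφ(x,ξ), ξ), compares ξ with the second component of κ⁻¹(x,ρ), and then y and η as well.
  have f7 : InFiberIdeal Φ (fun x => κinv (x.1.1, gradFst φ (x.1.1, x.2.1.2)) - κinv x.1) :=
    InFiberIdeal.comp_sub_comp hκinv (Φ := Φ)
      (a := fun x : Phase n × (Phase n × Phase n) => (x.1.1, gradFst φ (x.1.1, x.2.1.2)))
      (b := fun x : Phase n × (Phase n × Phase n) => x.1) ((by fun_prop : ContDiff ℝ ∞ _).prodMk (hgF.comp (by fun_prop)))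
      (by fun_prop)
      (by
        have := f6.const_clm (ContinuousLinearMap.inr ℝ (Config n) (Config n))
        refine (congrArg (InFiberIdeal Φ) (funext fun x => ?_)).mp this
        ext <;> simp)
  simp only [← hφκ.apply_gradSnd, hl _] at f7
  have f8 : InFiberIdeal Φ (fun x => gradSnd φ (x.1.1, x.2.1.2) - (κinv x.1).1) :=
    f7.const_clm (ContinuousLinearMap.fst ℝ (Config n) (Config n))
  have f9 : InFiberIdeal Φ (fun x => x.2.1.2 - (κinv x.1).2) :=
    f7.const_clm (ContinuousLinearMap.snd ℝ (Config n) (Config n))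
  have f10 : InFiberIdeal Φ (fun x => x.2.1.1 - (κinv x.1).1) := by
    refine (congrArg (InFiberIdeal Φ) (funext fun x => ?_)).mp ((f8.sub f1).sub u1)
    abel
  have f11 : InFiberIdeal Φ (fun x => x.2.2.1 - (κinv x.1).2) := by
    refine (congrArg (InFiberIdeal Φ) (funext fun x => ?_)).mp (f9.sub u2)
    abel
  have f12 : InFiberIdeal Φ (fun x => gradFst φ (x.1.1, x.2.1.2) - gradFst φ (x.1.1, x.2.2.1)) :=
    InFiberIdeal.comp_sub_comp hgF (by fun_prop) (by fun_prop) d0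
  have f13 : InFiberIdeal Φ (fun x => gradFst φ (x.1.1, x.2.2.1) - x.1.2) := by
    refine (congrArg (InFiberIdeal Φ) (funext fun x => ?_)).mp (f6.sub f12)
    abel
  obtain ⟨G, hG, hGeq⟩ := (f10.prodMk f9).prodMk (f11.prodMk f4.neg)
  -- The parameter derivative has components d_xφ(x,η) - ρ and -(x - x'), which are f13 and the
  -- negative of f4.
  have f14 : InFiberIdeal Φ (fun x => fderiv ℝ Φ x ∘L ContinuousLinearMap.inl ℝ (Phase n) _) := by
    let T₁ : Config n →L[ℝ] (Phase n →L[ℝ] ℝ) :=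
      ((ContinuousLinearMap.compL ℝ (Phase n) (Config n) ℝ).flip
        (ContinuousLinearMap.fst ℝ (Config n) (Config n))).comp (innerSL ℝ)
    let T₂ : Config n →L[ℝ] (Phase n →L[ℝ] ℝ) :=
      ((ContinuousLinearMap.compL ℝ (Phase n) (Config n) ℝ).flip
        (ContinuousLinearMap.snd ℝ (Config n) (Config n))).comp (innerSL ℝ)
    refine (congrArg (InFiberIdeal Φ) (funext fun x => ?_)).mp
      ((f13.const_clm T₁).sub (f4.const_clm T₂))
    refine ContinuousLinearMap.ext fun e => ?_
    refine Eq.trans ?_ (fderiv_compositionPhase_param hφ x e).symm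
    rfl
  obtain ⟨H, hH, hHeq⟩ := f14
  refine ⟨⟨Φ, fun p => (κinv p, ((κinv p).2, p.1)), G, H, contDiff_compositionPhase hφ, by fun_prop,
    hG, hH, fun x => ?_, fun x e => ?_⟩, rfl, rfl⟩
  · rw [← hGeq]
    ext <;> simp
  · rw [← hHeq]
    rfl

end CompositionPhase

/-! ### Constant and linear symbols. -/

section LinearSymbols

variable {ι X F G : Type*} [NormedAddCommGroup X] [NormedSpace ℝ X]
  [NormedAddCommGroup F] [NormedSpace ℝ F]
  {s : Set X} {w m : ι → X → ℝ}

theorem ContDiff.const_clm {V : Type*} [NormedAddCommGroup V] [NormedSpace ℝ V] (L : V →L[ℝ] F)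
    {f : X → V} (hf : ContDiff ℝ ∞ f) : ContDiff ℝ ∞ (fun x => L (f x)) :=
  L.contDiff.comp hf

theorem SymbolOn.const {c : ι → F} {C : ℝ} (hC : 0 ≤ C) (hw : ∀ i, ∀ x ∈ s, 0 ≤ w i x)
    (hm : ∀ i, ∀ x ∈ s, 0 ≤ m i x) (hc : ∀ i, ∀ x ∈ s, ‖c i‖ ≤ C * w i x) :
    SymbolOn s w m (fun i _ => c i) := by
  refine ⟨fun i => contDiff_const, fun k => ⟨C, hC, fun i x hx => ?_⟩⟩
  cases k with
  | zero => simpa using hc i x hx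
  | succ k =>
    rw [iteratedFDeriv_const_of_ne (by simp)]
    have := hw i x hx
    have := hm i x hx
    simp only [Pi.zero_apply, norm_zero]
    positivity

/-- Linear maps are unbounded on noncompact sets, so the weight has to carry their size; it is
tested at order zero only, the first derivative being constant. -/
theorem SymbolOn.of_clm (L : X →L[ℝ] F) {C : ℝ} (hC : 0 ≤ C) (hw : ∀ i, ∀ x ∈ s, 1 ≤ w i x)
    (hm : ∀ i, ∀ x ∈ s, 1 ≤ m i x) (hL : ∀ i, ∀ x ∈ s, ‖L x‖ ≤ C * w i x) :
    SymbolOn s w m (fun _ => L) := by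
  refine ⟨fun i => L.contDiff, fun k => ?_⟩
  cases k with
  | zero => exact ⟨C, hC, fun i x hx => by simpa using hL i x hx⟩
  | succ k =>
    have h1 : SymbolOn s (fun i x => w i x * m i x) m (fun (_ : ι) (_ : X) => L) :=
      SymbolOn.const (norm_nonneg L)
        (fun i x hx => mul_nonneg (zero_le_one.trans (hw i x hx)) (zero_le_one.trans (hm i x hx)))
        (fun i x hx => zero_le_one.trans (hm i x hx))
        (fun i x hx => le_mul_of_one_le_right (norm_nonneg L)
          (one_le_mul_of_one_le_of_one_le (hw i x hx) (hm i x hx)))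
    refine OrderBound.of_fderiv ?_
    have h2 : (fun _ : ι => _root_.fderiv ℝ (L : X → F)) = fun _ _ => L := by
      funext i x
      exact L.fderiv
    rw [h2]
    exact h1.bound k

end LinearSymbols

/-! ### Decay of the kernel of S at large frequencies. -/

section NonstationaryPhase

variable {ι : Type*} {n : ℕ}

/-- Rapid decay in `t / h` outside the ball of radius `T`. -/
def decayWeight (T : ℝ) (N : ℕ) (h : ℝ) (t : Config n) : ℝ :=
  open Classical in if T ≤ ‖t‖ then (h / (1 + ‖t‖)) ^ N else 1

theorem decayWeight_nonneg (T : ℝ) (N : ℕ) {h : ℝ} (hh : 0 < h) (t : Config n) :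
    0 ≤ decayWeight T N h t := by
  unfold decayWeight
  split_ifs <;> positivity

/-- The phase `φ(s, u) - ⟨t, u⟩`, with parameter `(s, t)` and integration variable `u`. -/
def transformPhase (φ : Phase n → ℝ) (x : Phase n × Config n) : ℝ :=
  φ (x.1.1, x.2) - ⟪x.1.2, x.2⟫_ℝ

variable {φ : Phase n → ℝ}

theorem contDiff_transformPhase (hφ : ContDiff ℝ ∞ φ) : ContDiff ℝ ∞ (transformPhase φ) := by
  have h1 : ContDiff ℝ ∞ (fun x : Phase n × Config n => ⟪x.1.2, x.2⟫_ℝ) :=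
    ContDiff.inner ℝ (by fun_prop) (by fun_prop)
  exact (hφ.comp (by fun_prop)).sub h1

theorem fderiv_transformPhase (hφ : ContDiff ℝ ∞ φ) (x v : Phase n × Config n) :
    fderiv ℝ (transformPhase φ) x v =
      fderiv ℝ φ (x.1.1, x.2) (v.1.1, v.2) - (⟪x.1.2, v.2⟫_ℝ + ⟪v.1.2, x.2⟫_ℝ) := by
  have hd := hφ.differentiable (by simp)
  have h11 : HasFDerivAt (fun x : Phase n × Config n => x.1.1) _ x :=
    (hasFDerivAt_fst (𝕜 := ℝ) (p := x)).fst
  have h12 : HasFDerivAt (fun x : Phase n × Config n => x.1.2) _ x :=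
    (hasFDerivAt_fst (𝕜 := ℝ) (p := x)).snd
  have h2 : HasFDerivAt (fun x : Phase n × Config n => x.2) _ x :=
    hasFDerivAt_snd (𝕜 := ℝ) (p := x)
  have e1 := (hd (x.1.1, x.2)).hasFDerivAt.comp x (h11.prodMk h2)
  have e5 := e1.sub (h12.inner ℝ h2)
  have e6 : HasFDerivAt (transformPhase φ) _ x := e5
  rw [e6.fderiv]
  simp [fderivInnerCLM_apply]

theorem fiberDeriv_transformPhase (hφ : ContDiff ℝ ∞ φ) (x : Phase n × Config n) (v : Config n) :
    fiberDeriv (transformPhase φ) x v = ⟪gradSnd φ (x.1.1, x.2) - x.1.2, v⟫_ℝ := by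
  simp [fiberDeriv, fderiv_transformPhase hφ, inner_sub_left, inner_gradSnd hφ]

/-- The points over `K`, with an arbitrary frequency `t`. -/
def overSet (K : Set (Phase n)) : Set (Phase n × Config n) := {x | (x.1.1, x.2) ∈ K}

/-- The set over K is unbounded in t, so compactness is used before pulling back rather than after.
-/
theorem SymbolOn.comp_overSet {F : Type*} [NormedAddCommGroup F] [NormedSpace ℝ F]
    {K : Set (Phase n)} (hK : IsCompact K) {μ v : ι → ℝ} {f : ι → Phase n → F}
    (hf : SymbolOn K (fun i _ => v i) (fun i _ => μ i) f) (hμ : ∀ i, 1 ≤ μ i)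
    (hv : ∀ i, 0 ≤ v i) :
    SymbolOn (overSet K) (fun i _ => v i) (fun i _ => μ i)
      (fun i x => f i (x.1.1, x.2)) := by
  obtain ⟨C, hC⟩ := hK.isBounded.exists_norm_le
  let L : Phase n × Config n →L[ℝ] Phase n :=
    ((ContinuousLinearMap.fst ℝ (Config n) (Config n)).comp
      (ContinuousLinearMap.fst ℝ (Phase n) (Config n))).prod
      (ContinuousLinearMap.snd ℝ (Phase n) (Config n))
  refine hf.comp (g := fun _ => L) (SymbolOn.of_clm L (C := max C 0) (le_max_right _ _)
    (fun _ _ _ => le_rfl) (fun _ _ _ => le_rfl) fun i x hx => ?_) hμ hv fun i x hx => hx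
  rw [mul_one]
  exact (hC _ hx).trans (le_max_left _ _)

-- The fiber derivative is V = d_uφ(s,u) - t, with d_uφ bounded over K, so |V| is comparable to 1 +
-- |t| for large t. Damping with evaluation at V gains h/(1+|t|) each time. The threshold depends on
-- φ and K alone, so one cutoff serves all families and all N.
set_option maxHeartbeats 1000000 in
theorem exists_norm_transform_le (hφ : ContDiff ℝ ∞ φ) {K : Set (Phase n)} (hK : IsCompact K) :
    ∃ T₀ : ℝ, 0 < T₀ ∧ ∀ {h v : ι → ℝ}, (∀ i, 0 < h i) → (∀ i, h i ≤ 1) → (∀ i, 0 ≤ v i) →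
      ∀ {A : ι → Phase n × Config n → ℂ}, SymbolOn (overSet K) (fun i _ => v i) (fun _ _ => 1) A →
      (∀ i, tsupport (A i) ⊆ overSet K) → ∀ N : ℕ, ∃ C, 0 ≤ C ∧ ∀ i p,
        ‖oscIntegral (h i) (transformPhase φ) (A i) p‖ ≤ C * (v i * decayWeight T₀ N (h i) p.2) := by
  obtain ⟨R, hR⟩ := hK.isBounded.exists_norm_le
  obtain ⟨G, hG⟩ := hK.exists_bound_of_continuousOn (contDiff_gradSnd hφ).continuous.continuousOn
  set G' := max G 0
  -- With G' a bound for d_uφ over K, |t| ≥ 2G' + 1 yields |V| ≥ |t| - G' ≥ (1+|t|)/4, whence the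
  -- constant 1/16 in `hlow`.
  refine ⟨2 * G' + 1, by positivity, ?_⟩
  intro h v hh hh1 hv A hA hAs N
  have hcK : IsCompact (Metric.closedBall (0 : Config n) R) := isCompact_closedBall _ _
  have hAK : ∀ i, tsupport (A i) ⊆ Prod.snd ⁻¹' Metric.closedBall (0 : Config n) R := fun i x hx => by
    have := hR _ (hAs i hx)
    rw [Set.mem_preimage, mem_closedBall_zero_iff]
    exact (le_max_right _ _).trans this
  -- the functional evaluating covectors at the gradient
  set V : Phase n × Config n → Config n := fun x => gradSnd φ (x.1.1, x.2) - x.1.2 with hV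
  set B₀ : Phase n × Config n → (Config n →L[ℝ] ℝ) →L[ℝ] ℝ := fun x =>
    ContinuousLinearMap.apply ℝ ℝ (V x) with hB₀
  set σ : ι → Phase n × Config n → ℝ := fun _ x => 1 + ‖x.1.2‖ with hσ
  set S : Set (Phase n × Config n) := overSet K ∩ {x | 2 * G' + 1 ≤ ‖x.1.2‖} with hS
  have hσ1 : ∀ (i : ι), ∀ x ∈ S, 1 ≤ σ i x := fun i x _ => by simp [hσ]
  have hVS : SymbolOn S σ (fun _ _ => 1) (fun _ : ι => V) := by
    refine SymbolOn.sub ?_ ?_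
    · refine ((SymbolOn.comp_overSet (ι := ι) hK (SymbolOn.of_isCompact (contDiff_gradSnd hφ) hK)
        (fun _ => le_rfl) (fun _ => zero_le_one)).mono_set Set.inter_subset_left).mono_weight
        (fun _ _ _ => zero_le_one) zero_le_one fun i x hx => ?_
      rw [one_mul]
      exact hσ1 i x hx
    · exact SymbolOn.of_clm ((ContinuousLinearMap.snd ℝ (Config n) (Config n)).comp
        (ContinuousLinearMap.fst ℝ (Phase n) (Config n))) zero_le_one hσ1 (fun _ _ _ => le_rfl)
        fun i x hx => by simp [hσ]
  have hVc : ContDiff ℝ ∞ V :=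
    ((contDiff_gradSnd hφ).comp ((contDiff_fst.comp contDiff_fst).prodMk contDiff_snd)).sub
      (contDiff_snd.comp contDiff_fst)
  have hB₀c : ContDiff ℝ ∞ B₀ := hVc.const_clm
    (F := (Config n →L[ℝ] ℝ) →L[ℝ] ℝ) (ContinuousLinearMap.apply ℝ ℝ)
  have hB₀S : SymbolOn S σ (fun _ _ => 1) (fun _ : ι => B₀) :=
    hVS.const_clm (G := (Config n →L[ℝ] ℝ) →L[ℝ] ℝ) (ContinuousLinearMap.apply ℝ ℝ)
  have hfd : ∀ x, B₀ x (fiberDeriv (transformPhase φ) x) = ‖V x‖ ^ 2 := fun x => by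
    simp only [hB₀, ContinuousLinearMap.apply_apply, fiberDeriv_transformPhase hφ]
    exact real_inner_self_eq_norm_sq _
  have hqs : SymbolOn S (fun i x => σ i x ^ 2) (fun _ _ => 1)
      (fun i x => h i + B₀ x (fiberDeriv (transformPhase φ) x)) := by
    refine SymbolOn.add (SymbolOn.const zero_le_one (fun _ _ _ => sq_nonneg _)
      (fun _ _ _ => zero_le_one) fun i x hx => ?_) ?_
    · rw [Real.norm_of_nonneg (hh i).le, one_mul]
      exact (hh1 i).trans (one_le_pow₀ (hσ1 i x hx))
    · simp only [hfd, ← real_inner_self_eq_norm_sq]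
      exact (hVS.bilinear (innerSL ℝ) hVS).congr_weight fun i x _ => (sq _).symm
  have hlow : ∀ i, ∀ x ∈ S, 1 / 16 * σ i x ^ 2 ≤
      h i + B₀ x (fiberDeriv (transformPhase φ) x) := fun i x hx => by
    rw [hfd]
    have h1 : ‖gradSnd φ (x.1.1, x.2)‖ ≤ G' := (hG _ hx.1).trans (le_max_left _ _)
    have h2 : ‖x.1.2‖ - ‖gradSnd φ (x.1.1, x.2)‖ ≤ ‖V x‖ := by
      rw [hV, ← norm_neg (gradSnd φ (x.1.1, x.2) - x.1.2), neg_sub]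
      exact norm_sub_norm_le _ _
    have h3 : 2 * G' + 1 ≤ ‖x.1.2‖ := hx.2
    have h4 : 1 / 4 * σ i x ≤ ‖V x‖ := by
      have : 0 ≤ G' := le_max_right _ _
      simp only [hσ]
      linarith
    have h5 : (1 / 4 * σ i x) ^ 2 ≤ ‖V x‖ ^ 2 :=
      pow_le_pow_left₀ (by have := hσ1 i x hx; positivity) h4 2
    have := hh i
    nlinarith
  obtain ⟨C, hC0, hC⟩ := SymbolOn.norm_oscIntegral_le (h := h) (hA.mono_set (t := S)
      Set.inter_subset_left) hh (contDiff_transformPhase hφ)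
    hB₀c hB₀S hqs
    (fun x => by rw [hfd]; exact sq_nonneg _) (by norm_num) hlow
    (fun i x hx => zero_lt_one.trans_le (hσ1 i x hx)) (fun _ _ _ => zero_le_one)
    (fun i x hx => by rw [mul_one]; exact hσ1 i x hx) (fun i _ _ => hv i) hcK hAK N
  obtain ⟨C', hC'0, hC'⟩ := hA.bound 0
  set vol := (volume : Measure (Config n)).real (Metric.closedBall 0 R) with hvol
  have hvol0 : 0 ≤ vol := measureReal_nonneg
  set g : ℝ → Config n → ℝ := fun c => (Metric.closedBall (0 : Config n) R).indicator fun _ => c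
  have hgi : ∀ c, Integrable (g c) := fun c =>
    (integrable_indicator_iff hcK.measurableSet).2 (integrableOn_const hcK.measure_lt_top.ne)
  have hg : ∀ c, ∫ z, g c z = vol * c := fun c => by
    simp only [g]
    rw [integral_indicator hcK.measurableSet, setIntegral_const, smul_eq_mul]
  have hgm : ∀ c z, (z ∈ Metric.closedBall (0 : Config n) R) → g c z = c := fun c z hz =>
    Set.indicator_of_mem hz _
  have hg0 : ∀ c, 0 ≤ c → ∀ z, 0 ≤ g c z := fun c hc z => Set.indicator_nonneg (fun _ _ => hc) z
  clear_value g
  have hAK' : ∀ i p z, (p, z) ∈ tsupport (A i) → z ∈ Metric.closedBall (0 : Config n) R :=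
    fun i p z hz => by
      have := hAK i hz
      rwa [Set.mem_preimage] at this
  refine ⟨(C + C') * vol, by positivity, fun i p => ?_⟩
  have hvi := hv i
  by_cases hp : 2 * G' + 1 ≤ ‖p.2‖
  · have hd : decayWeight (2 * G' + 1) N (h i) p.2 = (h i / (1 + ‖p.2‖)) ^ N := if_pos hp
    have hd0 := decayWeight_nonneg (2 * G' + 1) N (hh i) p.2
    refine (hC i p (fun z hz => ⟨hAs i hz, hp⟩) (g (v i * decayWeight (2 * G' + 1) N (h i) p.2))
      (hgi _) (hg0 _ (mul_nonneg hvi hd0)) fun z hz => ?_).trans ?_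
    · have : g (v i * decayWeight (2 * G' + 1) N (h i) p.2) z =
          v i * decayWeight (2 * G' + 1) N (h i) p.2 := hgm _ z (hAK' i p z hz)
      rw [this, hd, mul_one, div_eq_mul_inv]
    · rw [hg]
      nlinarith [mul_nonneg (mul_nonneg hC'0 hvol0) (mul_nonneg hvi hd0)]
  · have hd : decayWeight (2 * G' + 1) N (h i) p.2 = 1 := if_neg hp
    rw [hd, mul_one]
    refine (norm_integral_le_of_norm_le (hgi (C' * v i))
      (Filter.Eventually.of_forall fun z => ?_)).trans ?_
    · rw [norm_mul, norm_oscFactor, one_mul]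
      by_cases hz : (p, z) ∈ tsupport (A i)
      · have h1 := hC' i (p, z) (hAs i hz)
        have : g (C' * v i) z = C' * v i := hgm _ z (hAK' i p z hz)
        rw [this]
        simpa using h1
      · rw [image_eq_zero_of_notMem_tsupport hz, norm_zero]
        exact hg0 _ (mul_nonneg hC'0 hvi) z
    · rw [hg]
      nlinarith [mul_nonneg (mul_nonneg hC0 hvol0) hvi]

theorem symbolOn_fderiv_transformPhase (hφ : ContDiff ℝ ∞ φ) {K : Set (Phase n)} (hK : IsCompact K)
    (e : Phase n) : SymbolOn (overSet K) (fun _ _ => 1) (fun _ _ => 1)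
      (fun (_ : ι) x => fderiv ℝ (transformPhase φ) x (e, 0)) := by
  have h0 : ContDiff ℝ ∞ (fun z : Phase n => fderiv ℝ φ z (e.1, 0)) :=
    (hφ.fderiv_right (m := ∞) (by exact_mod_cast le_top)).clm_apply contDiff_const
  have h1 : ContDiff ℝ ∞ (fun z : Phase n => fderiv ℝ φ z (e.1, 0) - ⟪e.2, z.2⟫_ℝ) :=
    h0.sub (ContDiff.inner ℝ contDiff_const contDiff_snd)
  have h2 := SymbolOn.comp_overSet (ι := ι) hK (SymbolOn.of_isCompact h1 hK)
    (fun _ => le_rfl) (fun _ => zero_le_one)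
  have h3 : (fun (_ : ι) x => fderiv ℝ (transformPhase φ) x (e, 0)) =
      fun _ (x : Phase n × Config n) => fderiv ℝ φ (x.1.1, x.2) (e.1, 0) - ⟪e.2, x.2⟫_ℝ := by
    funext i x
    simp [fderiv_transformPhase hφ]
  rw [h3]
  exact h2

/-- Bounds for the semiclassical Fourier transform, in the variable `u`, of a compactly supported
oscillating function `e^{iφ(s, u)/h} A(s, u)`. -/
theorem symbolOn_transform (hφ : ContDiff ℝ ∞ φ) {K : Set (Phase n)} (hK : IsCompact K) :
    ∃ T₀ : ℝ, 0 < T₀ ∧ ∀ {h : ι → ℝ}, (∀ i, 0 < h i) → (∀ i, h i ≤ 1) →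
      ∀ {a : ι → Phase n → ℂ}, SymbolOn K (fun _ _ => 1) (fun _ _ => 1) a →
      (∀ i, tsupport (a i) ⊆ K) → ∀ N : ℕ,
        SymbolOn Set.univ (fun i p => decayWeight T₀ N (h i) p.2) (fun i _ => (h i)⁻¹)
          (fun i => oscIntegral (h i) (transformPhase φ) (fun x => a i (x.1.1, x.2))) := by
  obtain ⟨T₀, hT₀, H⟩ := exists_norm_transform_le (ι := ι) hφ hK
  refine ⟨T₀, hT₀, ?_⟩
  intro h hh hh1 a ha has N
  obtain ⟨R, hR⟩ := hK.isBounded.exists_norm_le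
  have hcK : IsCompact (Metric.closedBall (0 : Config n) R) := isCompact_closedBall _ _
  have hKR : overSet K ⊆ Prod.snd ⁻¹' Metric.closedBall (0 : Config n) R := fun x hx => by
    have := hR _ hx
    rw [Set.mem_preimage, mem_closedBall_zero_iff]
    exact (le_max_right _ _).trans this
  have hΨ := contDiff_transformPhase hφ
  have hψ := symbolOn_fderiv_transformPhase (ι := ι) hφ hK
  -- The scalar v is generalized because each derivative multiplies the amplitude by h⁻¹ while
  -- leaving it at scale one.
  have key : ∀ k : ℕ, ∀ (v : ι → ℝ), (∀ i, 0 ≤ v i) → ∀ A : ι → Phase n × Config n → ℂ,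
      SymbolOn (overSet K) (fun i _ => v i) (fun _ _ => 1) A →
      (∀ i, tsupport (A i) ⊆ overSet K) → ∃ C, 0 ≤ C ∧ ∀ i p,
        ‖iteratedFDeriv ℝ k (oscIntegral (h i) (transformPhase φ) (A i)) p‖ ≤
          C * (v i * decayWeight T₀ N (h i) p.2 * (h i)⁻¹ ^ k) := by
    intro k
    induction k with
    | zero =>
      intro v hv A hA hAs
      simpa using H hh hh1 hv hA hAs N
    | succ k ih =>
      intro v hv A hA hAs
      obtain ⟨C₀, hC₀, hb⟩ := exists_norm_iteratedFDeriv_succ_le (P := Phase n) k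
      set b := Module.finBasis ℝ (Phase n)
      set D : Phase n → ι → Phase n × Config n → ℂ := fun e i x =>
        Complex.I / h i * (fderiv ℝ (transformPhase φ) x (e, 0) : ℂ) * A i x +
          fderiv ℝ (A i) x (e, 0) with hD
      have hDs : ∀ e i, tsupport (D e i) ⊆ overSet K := fun e i => by
        refine Set.Subset.trans ((tsupport_add _ _).trans (Set.union_subset
          tsupport_mul_subset_right (CritPhase.tsupport_fderiv_apply_subset _ _))) (hAs i)
      have hDsym : ∀ e, SymbolOn (overSet K) (fun i _ => v i * (h i)⁻¹) (fun _ _ => 1) (D e) :=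
        fun e => by
        have h1 := (((hψ e).const_clm Complex.ofRealCLM).const_smul
          fun i => Complex.I / (h i : ℂ)).mul hA
        have h2 := hA.fderiv.const_clm (ContinuousLinearMap.apply ℝ ℂ ((e, 0) : Phase n × Config n))
        refine SymbolOn.add (h1.congr_weight fun i x _ => ?_)
          (h2.mono_weight (fun _ _ _ => zero_le_one) zero_le_one fun i x _ => ?_)
        · rw [norm_div, Complex.norm_I, Complex.norm_real, Real.norm_of_nonneg (hh i).le]
          ring
        · have := (one_le_inv₀ (hh i)).2 (hh1 i)
          rw [mul_one, one_mul]
          exact le_mul_of_one_le_right (hv i) this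
      choose C hC0 hC using fun j => ih (fun i => v i * (h i)⁻¹)
        (fun i => mul_nonneg (hv i) (inv_pos.2 (hh i)).le) (D (b j)) (hDsym _) (hDs _)
      refine ⟨∑ j, C₀ j * C j, Finset.sum_nonneg fun j _ => mul_nonneg (hC₀ j) (hC0 j),
        fun i p => ?_⟩
      obtain ⟨hsm, hfd⟩ := contDiff_oscIntegral (h := h i) hΨ (hA.contDiff i) hcK
        ((hAs i).trans hKR)
      refine (hb _ hsm p).trans ?_
      rw [Finset.sum_mul]
      refine Finset.sum_le_sum fun j _ => ?_
      have : (fun p => fderiv ℝ (oscIntegral (h i) (transformPhase φ) (A i)) p (b j)) =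
          oscIntegral (h i) (transformPhase φ) (D (b j) i) := funext fun p => hfd p (b j)
      rw [this, mul_assoc]
      refine mul_le_mul_of_nonneg_left ((hC j i p).trans (le_of_eq ?_)) (hC₀ j)
      ring
  have hA : SymbolOn (overSet K) (fun _ _ => 1) (fun _ _ => 1)
      (fun i (x : Phase n × Config n) => a i (x.1.1, x.2)) :=
    SymbolOn.comp_overSet hK ha (fun _ => le_rfl) (fun _ => zero_le_one)
  have hAs : ∀ i, tsupport (fun x : Phase n × Config n => a i (x.1.1, x.2)) ⊆ overSet K := fun i =>
    (tsupport_comp_subset_preimage (a i)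
      (by fun_prop : Continuous fun x : Phase n × Config n => (x.1.1, x.2))).trans
      (Set.preimage_mono (has i))
  refine ⟨fun i => (contDiff_oscIntegral hΨ (hA.contDiff i) hcK ((hAs i).trans hKR)).1,
    fun k => ?_⟩
  obtain ⟨C, hC0, hC⟩ := key k (fun _ => 1) (fun _ => zero_le_one) _ hA hAs
  refine ⟨C, hC0, fun i p _ => ?_⟩
  simpa using hC i p

end NonstationaryPhase

/-! ### Affine changes of variable and complements of cutoffs. -/

section AffineSubstitution

open Topology

variable {ι ι' X Y F : Type*} [NormedAddCommGroup X] [NormedSpace ℝ X]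
  [NormedAddCommGroup Y] [NormedSpace ℝ Y] [NormedAddCommGroup F] [NormedSpace ℝ F]

theorem norm_iteratedFDeriv_comp_affine_le {f : X → F} (hf : ContDiff ℝ ∞ f) (L : Y →L[ℝ] X)
    (hL : ‖L‖ ≤ 1) (v : X) (k : ℕ) (y : Y) :
    ‖iteratedFDeriv ℝ k (fun y => f (L y + v)) y‖ ≤ ‖iteratedFDeriv ℝ k f (L y + v)‖ := by
  have h1 : ContDiff ℝ ∞ (fun x => f (x + v)) := hf.comp (contDiff_id.add contDiff_const)
  have h2 : (fun y => f (L y + v)) = (fun x => f (x + v)) ∘ L := rfl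
  rw [h2, L.iteratedFDeriv_comp_right h1 y (by exact_mod_cast le_top),
    iteratedFDeriv_comp_add_right]
  refine (ContinuousMultilinearMap.norm_compContinuousLinearMap_le _ _).trans ?_
  exact mul_le_of_le_one_right (norm_nonneg _) (Finset.prod_le_one (fun _ _ => norm_nonneg _)
    fun _ _ => hL)

theorem SymbolOn.comp_affine {w m : ι → X → ℝ} {f : ι → X → F} (hf : SymbolOn Set.univ w m f)
    (r : ι' → ι) (L : Y →L[ℝ] X) (hL : ‖L‖ ≤ 1) (v : ι' → X) :
    SymbolOn Set.univ (fun j y => w (r j) (L y + v j)) (fun j y => m (r j) (L y + v j))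
      (fun j y => f (r j) (L y + v j)) := by
  refine ⟨fun j => (hf.contDiff (r j)).comp (L.contDiff.add contDiff_const), fun k => ?_⟩
  obtain ⟨C, hC0, hC⟩ := hf.bound k
  exact ⟨C, hC0, fun j y _ => (norm_iteratedFDeriv_comp_affine_le (hf.contDiff _) L hL _ k y).trans
    (hC _ _ (Set.mem_univ _))⟩

/-- One minus a cutoff, with a weight vanishing where the cutoff is locally one. -/
theorem symbolOn_one_sub_cutoff {χ : X → ℝ} (hχ : ContDiff ℝ ∞ χ) {T T' : ℝ} (hT : T < T')
    (hχ1 : ∀ x, ‖x‖ ≤ T' → χ x = 1) (hχc : HasCompactSupport χ) :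
    SymbolOn Set.univ (fun (_ : ι) x => open Classical in if ‖x‖ ≤ T then 0 else 1)
      (fun _ _ => 1) (fun _ x => (1 : ℂ) - (χ x : ℂ)) := by
  have hc : ContDiff ℝ ∞ (fun x => (χ x : ℂ)) := Complex.ofRealCLM.contDiff.comp hχ
  have hsup : tsupport (fun x => (χ x : ℂ)) ⊆ tsupport χ :=
    closure_mono fun x hx h0 => hx (by simp [h0])
  have h1 : SymbolOn Set.univ (fun _ _ => 1) (fun _ _ => 1)
      (fun (_ : ι) x => (1 : ℂ) - (χ x : ℂ)) :=
    (SymbolOn.const (C := 1) zero_le_one (fun _ _ _ => zero_le_one) (fun _ _ _ => zero_le_one)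
      fun _ _ _ => by simp).sub ((SymbolOn.of_isCompact hc hχc.isCompact).extend
        (fun _ _ => zero_le_one) (fun _ _ => zero_le_one) fun _ => hsup)
  refine ⟨h1.contDiff, fun k => ?_⟩
  obtain ⟨C, hC0, hC⟩ := h1.bound k
  refine ⟨C, hC0, fun i x hx => ?_⟩
  by_cases hxT : ‖x‖ ≤ T
  · have hev : (fun x => (1 : ℂ) - (χ x : ℂ)) =ᶠ[𝓝 x] fun _ => 0 := by
      have : ∀ᶠ z in 𝓝 x, ‖z‖ < T' :=
        continuous_norm.continuousAt.eventually (gt_mem_nhds (hxT.trans_lt hT))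
      filter_upwards [this] with z hz
      simp [hχ1 z hz.le]
    rw [(hev.iteratedFDeriv ℝ k).eq_of_nhds]
    simp [hxT]
  · simpa [hxT] using hC i x hx

end AffineSubstitution

/-! ### The integrand away from the compact part. -/

section Remainder

variable {ι : Type*} {n : ℕ}

/-- Inside the ball the weight is one and the constant (1+T')^N compensates; this holds everywhere
but discards the powers of h. -/
theorem decayWeight_le {T T' : ℝ} (hT : 0 < T) (hTT' : T ≤ T') (N : ℕ) {h : ℝ} (hh : 0 < h)
    (hh1 : h ≤ 1) (t : Config n) :
    decayWeight T N h t ≤ (1 + T') ^ N * ((1 + ‖t‖)⁻¹) ^ N := by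
  have h0 : 0 ≤ ‖t‖ := norm_nonneg t
  rw [← mul_pow]
  unfold decayWeight
  split_ifs with ht
  · refine pow_le_pow_left₀ (by positivity) ?_ N
    rw [div_eq_mul_inv]
    gcongr
    linarith
  · refine one_le_pow₀ ?_
    rw [← div_eq_mul_inv, one_le_div (by positivity)]
    linarith

/-- Beyond T' the powers of h can be kept. -/
theorem decayWeight_le_of_lt {T T' : ℝ} (hT : 0 < T) (hTT' : T ≤ T') (N : ℕ) {h : ℝ} (hh : 0 < h)
    {t : Config n} (ht : T' < ‖t‖) :
    decayWeight T N h t ≤ h ^ N * ((1 + T') ^ N * ((1 + ‖t‖)⁻¹) ^ N) := by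
  have h0 : 0 ≤ ‖t‖ := norm_nonneg t
  rw [← mul_pow, ← mul_pow]
  rw [decayWeight, if_pos (hTT'.trans ht.le), div_eq_mul_inv]
  refine pow_le_pow_left₀ (by positivity) ?_ N
  gcongr
  refine le_mul_of_one_le_left (by positivity) (by linarith)

/-- The integral kernel of `S` without the factor `(2πh)^{-n}`. -/
def fioKernel (h : ℝ) (φ : Phase n → ℝ) (a : Phase n → ℂ) : Phase n → ℂ :=
  oscIntegral h (transformPhase φ) (fun x => a (x.1.1, x.2))

theorem fioKernel_eq_zero {h : ℝ} {φ : Phase n → ℝ} {a : Phase n → ℂ} {R : ℝ}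
    (ha : tsupport a ⊆ Metric.closedBall 0 R) {p : Phase n} (hp : R < ‖p.1‖) :
    fioKernel h φ a p = 0 := by
  have : ∀ u, a (p.1, u) = 0 := fun u => by
    by_contra hne
    have := ha (subset_tsupport a hne)
    rw [mem_closedBall_zero_iff] at this
    have h2 : ‖p.1‖ ≤ ‖(p.1, u)‖ := le_max_left _ _
    linarith
  simp [fioKernel, oscIntegral, this]

/-- The integrand, in `q = (y, ξ)`, of the symbol of `S B S*` at `p = (x, ρ)`. -/
def symbolIntegrand (h : ℝ) (φ : Phase n → ℝ) (a b : Phase n → ℂ) (g : Phase n → ℂ)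
    (p q : Phase n) : ℂ :=
  Complex.exp (Complex.I / h * ((⟪q.1, q.2⟫_ℝ - ⟪p.1, p.2⟫_ℝ : ℝ) : ℂ)) *
    (fioKernel h φ a (p.1, q.1) *
      conj (fioKernel h (φ ∘ Prod.swap) (a ∘ Prod.swap) (q.2, p.2))) * b q * g (q.1, p.2)

/-- The derivative of the pairing of position and momentum. -/
def pairingDeriv (n : ℕ) : Phase n →L[ℝ] (Phase n →L[ℝ] ℝ) :=
  (((ContinuousLinearMap.compL ℝ (Phase n) (Config n) ℝ).flip
    (ContinuousLinearMap.snd ℝ (Config n) (Config n))).comp (innerSL ℝ)).comp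
      (ContinuousLinearMap.fst ℝ (Config n) (Config n)) +
  (((ContinuousLinearMap.compL ℝ (Phase n) (Config n) ℝ).flip
    (ContinuousLinearMap.fst ℝ (Config n) (Config n))).comp (innerSL ℝ)).comp
      (ContinuousLinearMap.snd ℝ (Config n) (Config n))

theorem pairingDeriv_apply (p e : Phase n) :
    pairingDeriv n p e = ⟪p.1, e.2⟫_ℝ + ⟪p.2, e.1⟫_ℝ := rfl

theorem hasFDerivAt_pairing (p : Phase n) :
    HasFDerivAt (fun p : Phase n => ⟪p.1, p.2⟫_ℝ) (pairingDeriv n p) p := by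
  have h1 := (hasFDerivAt_fst (𝕜 := ℝ) (p := p)).inner ℝ (hasFDerivAt_snd (𝕜 := ℝ) (p := p))
  refine h1.congr_fderiv (ContinuousLinearMap.ext fun e => ?_)
  rw [pairingDeriv_apply, real_inner_comm e.1 p.2]
  simp [fderivInnerCLM_apply]

theorem contDiff_pairing : ContDiff ℝ ∞ (fun p : Phase n => ⟪p.1, p.2⟫_ℝ) :=
  ContDiff.inner ℝ contDiff_fst contDiff_snd

theorem norm_pairingDeriv_le (p : Phase n) : ‖pairingDeriv n p‖ ≤ ‖p.1‖ + ‖p.2‖ := by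
  refine ContinuousLinearMap.opNorm_le_bound _ (by positivity) fun e => ?_
  rw [pairingDeriv_apply, add_mul]
  refine (norm_add_le _ _).trans (add_le_add ?_ ?_)
  · exact (norm_inner_le_norm _ _).trans (mul_le_mul_of_nonneg_left (le_max_right _ _)
      (norm_nonneg _))
  · exact (norm_inner_le_norm _ _).trans (mul_le_mul_of_nonneg_left (le_max_left _ _)
      (norm_nonneg _))

/-- For |x| ≤ R the derivative of ⟨x,ρ⟩ has size 1 + |ρ|, so each derivative of the plane wave costs
(1+|ρ|)/h. The rapid decay in ρ pays for it later. -/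
theorem symbolOn_planeWave {h : ι → ℝ} (hh : ∀ i, 0 < h i) (hh1 : ∀ i, h i ≤ 1) (c : ι → ℝ)
    (R : ℝ) :
    SymbolOn {p : Phase n | ‖p.1‖ ≤ R} (fun _ _ => 1) (fun i p => (1 + ‖p.2‖) * (h i)⁻¹)
      (fun i p => Complex.exp (Complex.I / h i * ((c i - ⟪p.1, p.2⟫_ℝ : ℝ) : ℂ))) := by
  have hh' : ∀ i, 1 ≤ (h i)⁻¹ := fun i => (one_le_inv₀ (hh i)).2 (hh1 i)
  have h0 : (fun i (p : Phase n) =>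
      Complex.exp (Complex.I / h i * ((c i - ⟪p.1, p.2⟫_ℝ : ℝ) : ℂ))) =
      fun i p => Complex.exp (Complex.I * (((h i)⁻¹ * (c i - ⟪p.1, p.2⟫_ℝ) : ℝ) : ℂ)) := by
    funext i p
    push_cast
    ring_nf
  rw [h0]
  refine SymbolOn.cexp (fun i => contDiff_const.mul (contDiff_const.sub contDiff_pairing)) ?_
  have h1 : SymbolOn {p : Phase n | ‖p.1‖ ≤ R} (fun _ p => 1 + ‖p.2‖) (fun _ _ => 1)
      (fun (_ : ι) => pairingDeriv n) :=
    SymbolOn.of_clm _ (C := |R| + 1) (by positivity) (fun _ _ _ => by simp)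
      (fun _ _ _ => le_rfl) fun i p hp => by
        have hp' : ‖p.1‖ ≤ R := hp
        have := norm_pairingDeriv_le p
        have := le_abs_self R
        nlinarith [norm_nonneg p.2, abs_nonneg R]
  have h2 := (h1.const_smul (fun i => -(h i)⁻¹)).mono_scale
    (m' := fun i p => (1 + ‖p.2‖) * (h i)⁻¹)
    (fun i p _ => by positivity) (fun _ _ _ => zero_le_one) fun i p _ =>
      one_le_mul_of_one_le_of_one_le (by simp) (hh' i)
  have h3 : (fun i => fderiv ℝ fun p : Phase n => (h i)⁻¹ * (c i - ⟪p.1, p.2⟫_ℝ)) =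
      fun i p => (-(h i)⁻¹) • pairingDeriv n p := by
    funext i p
    rw [(((hasFDerivAt_pairing p).const_sub (c i)).const_mul (h i)⁻¹).fderiv]
    exact ContinuousLinearMap.ext fun e => by simp
  rw [h3]
  refine h2.congr_weight fun i p _ => ?_
  rw [norm_neg, Real.norm_of_nonneg (zero_le_one.trans (hh' i)), mul_comm]

set_option maxHeartbeats 1000000 in
/-- The bound for the integrand away from the compact part. -/
theorem symbolOn_symbolIntegrand {φ : Phase n → ℝ} (hφ : ContDiff ℝ ∞ φ) {R : ℝ} :
    ∃ T : ℝ, 0 < T ∧ ∀ {χ : Phase n → ℝ} {T' : ℝ}, ContDiff ℝ ∞ χ → T < T' →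
      (∀ z, ‖z‖ ≤ T' → χ z = 1) → HasCompactSupport χ →
      ∀ {h : ι → ℝ}, (∀ i, 0 < h i) → (∀ i, h i ≤ 1) → ∀ {a b : ι → Phase n → ℂ},
      SymbolOn (Metric.closedBall 0 R) (fun _ _ => 1) (fun _ _ => 1) a →
      (∀ i, tsupport (a i) ⊆ Metric.closedBall 0 R) → ∀ {C : ℝ}, (∀ i z, ‖b i z‖ ≤ C) → ∀ N : ℕ,
      SymbolOn Set.univ (fun (j : ι × Phase n) p => h j.1 ^ N *
          (((1 + ‖j.2.1‖)⁻¹) ^ N * ((1 + ‖p.2‖)⁻¹) ^ N) *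
            (Metric.closedBall (0 : Config n) R).indicator (fun _ => 1) j.2.2)
        (fun j p => (1 + ‖p.2‖) * (h j.1)⁻¹)
        (fun j p => symbolIntegrand (h j.1) φ (a j.1) (b j.1) (fun z => 1 - (χ z : ℂ)) p j.2) := by
  have hK : IsCompact (Metric.closedBall (0 : Phase n) R) := isCompact_closedBall _ _
  have hφ' : ContDiff ℝ ∞ (φ ∘ Prod.swap) := hφ.comp (contDiff_snd.prodMk contDiff_fst)
  obtain ⟨T₁, hT₁, H₁⟩ := symbolOn_transform (ι := ι) hφ hK
  obtain ⟨T₂, hT₂, H₂⟩ := symbolOn_transform (ι := ι) hφ' hK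
  have hT : 0 < max T₁ T₂ := lt_max_of_lt_left hT₁
  refine ⟨max T₁ T₂, hT, ?_⟩
  set T := max T₁ T₂ with hTdef
  intro χ T' hχ hTT' hχ1 hχc h hh hh1 a b ha has C hb N
  have hh' : ∀ i, 1 ≤ (h i)⁻¹ := fun i => (one_le_inv₀ (hh i)).2 (hh1 i)
  let sw : Phase n →L[ℝ] Phase n := (ContinuousLinearMap.snd ℝ (Config n) (Config n)).prod
    (ContinuousLinearMap.fst ℝ (Config n) (Config n))
  have hsw : ∀ z : Phase n, ‖z.swap‖ = ‖z‖ := fun z => max_comm _ _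
  have ha' : SymbolOn (Metric.closedBall 0 R) (fun _ _ => 1) (fun _ _ => 1)
      (fun i => a i ∘ Prod.swap) :=
    ha.comp (g := fun _ => sw) (SymbolOn.of_isCompact sw.contDiff hK) (fun _ => le_rfl)
      (fun _ => zero_le_one) fun i z hz => by
        rw [mem_closedBall_zero_iff] at hz ⊢
        exact (hsw z).trans_le hz
  have has' : ∀ i, tsupport (a i ∘ Prod.swap) ⊆ Metric.closedBall 0 R := fun i =>
    (tsupport_comp_subset_preimage (a i) continuous_swap).trans fun z hz => by
      have := has i hz
      rw [mem_closedBall_zero_iff] at this ⊢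
      exact (hsw z).symm.trans_le this
  have hF := (H₁ hh hh1 ha has N).comp_affine (Prod.fst : ι × Phase n → ι)
    ((ContinuousLinearMap.inl ℝ (Config n) (Config n)).comp
      (ContinuousLinearMap.fst ℝ (Config n) (Config n)))
    (ContinuousLinearMap.opNorm_le_bound _ zero_le_one fun z => by
      rw [one_mul]
      refine max_le (le_max_left _ _) (by simp)) (fun j => (0, j.2.1))
  have hW := ((H₂ hh hh1 ha' has' N).comp_affine (Prod.fst : ι × Phase n → ι)
    ((ContinuousLinearMap.inr ℝ (Config n) (Config n)).comp
      (ContinuousLinearMap.snd ℝ (Config n) (Config n)))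
    (ContinuousLinearMap.opNorm_le_bound _ zero_le_one fun z => by
      rw [one_mul]
      refine max_le (by simp) (le_max_right _ _)) (fun j => (j.2.2, 0))).const_clm
    (Complex.conjCLE : ℂ →L[ℝ] ℂ)
  have hg := (symbolOn_one_sub_cutoff (ι := ι) hχ hTT' hχ1 hχc).comp_affine
    (Prod.fst : ι × Phase n → ι)
    ((ContinuousLinearMap.inr ℝ (Config n) (Config n)).comp
      (ContinuousLinearMap.snd ℝ (Config n) (Config n)))
    (ContinuousLinearMap.opNorm_le_bound _ zero_le_one fun z => by
      rw [one_mul]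
      refine max_le (by simp) (le_max_right _ _)) (fun j => (j.2.1, 0))
  simp only [ContinuousLinearMap.comp_apply, ContinuousLinearMap.inl_apply,
    ContinuousLinearMap.inr_apply, ContinuousLinearMap.coe_fst', ContinuousLinearMap.coe_snd',
    Prod.mk_add_mk, add_zero, zero_add] at hF hW hg
  set S : Set (Phase n) := {p | ‖p.1‖ ≤ R} with hS
  have hSc : IsClosed S := isClosed_le (by fun_prop) continuous_const
  have hm : ∀ (j : ι × Phase n) (p : Phase n), (h j.1)⁻¹ ≤ (1 + ‖p.2‖) * (h j.1)⁻¹ := fun j p =>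
    le_mul_of_one_le_left (zero_le_one.trans (hh' j.1)) (by simp)
  have hm1 : ∀ (j : ι × Phase n) (p : Phase n), 1 ≤ (1 + ‖p.2‖) * (h j.1)⁻¹ := fun j p =>
    (hh' j.1).trans (hm j p)
  have hm0 : ∀ (j : ι × Phase n) (p : Phase n), 0 ≤ (1 + ‖p.2‖) * (h j.1)⁻¹ := fun j p =>
    zero_le_one.trans (hm1 j p)
  have hi0 : ∀ j : ι × Phase n, 0 ≤ (h j.1)⁻¹ := fun j => zero_le_one.trans (hh' j.1)
  have hF' := (hF.mono_scale (fun j p _ => decayWeight_nonneg _ _ (hh j.1) _)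
    (fun j p _ => hi0 j) fun j p _ => hm j p).mono_set (Set.subset_univ S)
  have hW' := (hW.mono_scale (fun j p _ => decayWeight_nonneg _ _ (hh j.1) _)
    (fun j p _ => hi0 j) fun j p _ => hm j p).mono_set (Set.subset_univ S)
  have hg' := (hg.mono_scale (fun j p _ => by split_ifs <;> norm_num)
    (fun j p _ => zero_le_one) fun j p _ => hm1 j p).mono_set (Set.subset_univ S)
  have hE := symbolOn_planeWave (n := n) (h := fun j : ι × Phase n => h j.1) (fun j : ι × Phase n => hh j.1) (fun j => hh1 j.1)
    (fun j => ⟪j.2.1, j.2.2⟫_ℝ) R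
  -- The variable q belongs to the index, so b(q) is a scalar and only its supremum enters. The
  -- indicator may be inserted because the kernel of S* vanishes for |ξ| > R.
  have hQ := (hE.mul (hF'.mul (hW'.mul hg'))).const_smul (fun j : ι × Phase n =>
    (Metric.closedBall (0 : Config n) R).indicator (fun _ => b j.1 j.2) j.2.2)
  have heq : (fun (j : ι × Phase n) p => symbolIntegrand (h j.1) φ (a j.1) (b j.1)
      (fun z => 1 - (χ z : ℂ)) p j.2) = fun j p =>
      (Metric.closedBall (0 : Config n) R).indicator (fun _ => b j.1 j.2) j.2.2 •
        (Complex.exp (Complex.I / h j.1 * ((⟪j.2.1, j.2.2⟫_ℝ - ⟪p.1, p.2⟫_ℝ : ℝ) : ℂ)) *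
        (fioKernel (h j.1) φ (a j.1) (p.1, j.2.1) *
          (conj (fioKernel (h j.1) (φ ∘ Prod.swap) (a j.1 ∘ Prod.swap) (j.2.2, p.2)) *
          (1 - (χ (j.2.1, p.2) : ℂ))))) := by
    funext j p
    rw [smul_eq_mul]
    by_cases hj : j.2.2 ∈ Metric.closedBall (0 : Config n) R
    · rw [Set.indicator_of_mem hj, symbolIntegrand]
      ring
    · rw [mem_closedBall_zero_iff, not_le] at hj
      have hz : fioKernel (h j.1) (φ ∘ Prod.swap) (a j.1 ∘ Prod.swap) (j.2.2, p.2) = 0 :=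
        fioKernel_eq_zero (p := (j.2.2, p.2)) (has' j.1) hj
      simp only [symbolIntegrand, hz, map_zero, mul_zero, zero_mul]
  rw [heq]
  refine SymbolOn.extend (s := S) ?_ (fun j p => ?_) hm0 fun j => ?_
  · refine hQ.mono_weight (fun j p _ => hm0 j p) (c := |C| * ((1 + T) ^ N * (1 + T) ^ N))
      (by positivity) fun j p _ => ?_
    by_cases hj : j.2.2 ∈ Metric.closedBall (0 : Config n) R
    · have hb' : ‖b j.1 j.2‖ ≤ |C| := (hb j.1 j.2).trans (le_abs_self C)
      have e1 := decayWeight_le hT₁ (le_max_left T₁ T₂) N (hh j.1) (hh1 j.1) j.2.1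
      have e2 := decayWeight_le hT₂ (le_max_right T₁ T₂) N (hh j.1) (hh1 j.1) p.2
      have e3 := decayWeight_le_of_lt hT₁ (le_max_left T₁ T₂) N (hh j.1) (t := j.2.1)
      have e4 := decayWeight_le_of_lt hT₂ (le_max_right T₁ T₂) N (hh j.1) (t := p.2)
      have n1 := decayWeight_nonneg T₁ N (hh j.1) j.2.1
      have n2 := decayWeight_nonneg T₂ N (hh j.1) p.2
      have hj0 := (hh j.1).le
      rw [← hTdef] at e1 e2 e3 e4
      simp only [Set.indicator_of_mem hj, one_mul, mul_one]
      set A := (1 + T) ^ N * ((1 + ‖j.2.1‖)⁻¹) ^ N with hA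
      set B := (1 + T) ^ N * ((1 + ‖p.2‖)⁻¹) ^ N with hB
      have hA0 : 0 ≤ A := by positivity
      have hB0 : 0 ≤ B := by positivity
      -- Where the cutoff is not locally one, |y| or |ρ| exceeds T; the corresponding kernel
      -- supplies h^N and the other only its decay.
      have key : decayWeight T₁ N (h j.1) j.2.1 * (decayWeight T₂ N (h j.1) p.2 *
          if ‖(j.2.1, p.2)‖ ≤ T then 0 else 1) ≤ h j.1 ^ N * (A * B) := by
        by_cases hle : ‖(j.2.1, p.2)‖ ≤ T
        · rw [if_pos hle, mul_zero, mul_zero]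
          positivity
        · rw [if_neg hle, mul_one]
          rcases lt_max_iff.1 (not_le.1 hle) with hlt | hlt
          · calc _ ≤ (h j.1 ^ N * A) * B := mul_le_mul (e3 hlt) e2 n2 (by positivity)
              _ = _ := by ring
          · calc _ ≤ A * (h j.1 ^ N * B) := mul_le_mul e1 (e4 hlt) n2 hA0
              _ = _ := by ring
      calc _ ≤ |C| * (h j.1 ^ N * (A * B)) :=
            mul_le_mul hb' key (mul_nonneg n1 (mul_nonneg n2 (by split_ifs <;> norm_num)))
              (abs_nonneg C)
        _ = _ := by rw [hA, hB]; ring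
    · simp [Set.indicator_of_notMem hj]
  · have := (hh j.1).le
    have : 0 ≤ (Metric.closedBall (0 : Config n) R).indicator (fun _ => (1 : ℝ)) j.2.2 :=
      Set.indicator_nonneg (fun _ _ => zero_le_one) _
    positivity
  · refine closure_minimal (fun p hp => ?_) hSc
    by_contra hpS
    have hz : fioKernel (h j.1) φ (a j.1) (p.1, j.2.1) = 0 :=
      fioKernel_eq_zero (p := (p.1, j.2.1)) (has j.1) (not_le.1 hpS)
    exact hp (by simp only [hz, mul_zero, zero_mul, smul_zero])

end Remainder

/-! ### The contribution of the complement of the cutoff to the symbol. -/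

section RemainderSymbol

/-- Smoothness of a parametric integral with majorants uniform in the parameter. -/
theorem contDiff_integral_of_majorant {X Y F : Type*} [NormedAddCommGroup X] [NormedSpace ℝ X]
    [NormedAddCommGroup F] [NormedSpace ℝ F] [NormedAddCommGroup Y] [NormedSpace ℝ Y]
    [FiniteDimensional ℝ X] [FiniteDimensional ℝ Y] [CompleteSpace F] [MeasurableSpace Y]
    [BorelSpace Y] {μ : Measure Y} {f : X → Y → F}
    (hf : ContDiff ℝ ∞ (fun z : X × Y => f z.1 z.2))
    (hdom : ∀ k : ℕ, ∃ g : Y → ℝ, Integrable g μ ∧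
      ∀ x y, ‖iteratedFDeriv ℝ k (fun x => f x y) x‖ ≤ g y) :
    ContDiff ℝ ∞ (fun x => ∫ y, f x y ∂μ) ∧ ∀ k x,
      iteratedFDeriv ℝ k (fun x => ∫ y, f x y ∂μ) x =
        ∫ y, iteratedFDeriv ℝ k (fun x => f x y) x ∂μ := by
  have : ProperSpace X := FiniteDimensional.proper ℝ X
  have : ProperSpace Y := FiniteDimensional.proper ℝ Y
  refine contDiff_integral_and_iteratedFDeriv
    (fun y => hf.comp (contDiff_id.prodMk contDiff_const)) (fun k x => ?_) fun k x₀ => ?_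
  · exact ((continuous_iteratedFDeriv_prodMk_left hf k).comp
      (Continuous.prodMk_right x)).aestronglyMeasurable
  · obtain ⟨g, hg, h⟩ := hdom k
    exact ⟨g, hg, Set.univ, Filter.univ_mem, Filter.Eventually.of_forall fun y x _ => h x y⟩

open Topology

variable {ι : Type*} {n : ℕ}

theorem norm_iteratedFDeriv_const_smul {X F 𝕜 : Type*} [NormedAddCommGroup X] [NormedSpace ℝ X]
    [NormedAddCommGroup F] [NormedSpace ℝ F] [NormedField 𝕜] [NormedSpace 𝕜 F]
    [SMulCommClass ℝ 𝕜 F] (c : 𝕜) {f : X → F} (hf : ContDiff ℝ ∞ f) (k : ℕ) (x : X) :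
    ‖iteratedFDeriv ℝ k (fun x => c • f x) x‖ = ‖c‖ * ‖iteratedFDeriv ℝ k f x‖ := by
  have : iteratedFDeriv ℝ k (fun x => c • f x) x = c • iteratedFDeriv ℝ k f x :=
    iteratedFDeriv_const_smul_apply (hf.of_le (by exact_mod_cast le_top)).contDiffAt
  rw [this, norm_smul]

theorem norm_iteratedFDeriv_const_mul {X : Type*} [NormedAddCommGroup X] [NormedSpace ℝ X]
    (c : ℂ) {f : X → ℂ} (hf : ContDiff ℝ ∞ f) (k : ℕ) (x : X) :
    ‖iteratedFDeriv ℝ k (fun x => c * f x) x‖ = ‖c‖ * ‖iteratedFDeriv ℝ k f x‖ :=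
  norm_iteratedFDeriv_const_smul c hf k x

/-- The integrable majorant of the integrands in `q = (y, ξ)`. -/
def majorant (R : ℝ) (q : Phase n) : ℝ :=
  ((1 + ‖q.1‖)⁻¹) ^ (n + 1) * (Metric.closedBall (0 : Config n) R).indicator (fun _ => 1) q.2

theorem integrable_inv_one_add_norm_pow :
    Integrable (fun y : Config n => ((1 + ‖y‖)⁻¹) ^ (n + 1)) := by
  have h1 : (Module.finrank ℝ (Config n) : ℝ) < ((n + 1 : ℕ) : ℝ) := by simp
  refine (integrable_one_add_norm (μ := (volume : Measure (Config n))) h1).congr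
    (Filter.Eventually.of_forall fun y => ?_)
  simp only
  rw [Real.rpow_neg (by positivity), Real.rpow_natCast, inv_pow]

theorem integrable_majorant (R : ℝ) : Integrable (majorant (n := n) R) := by
  have hc : IsCompact (Metric.closedBall (0 : Config n) R) := isCompact_closedBall _ _
  exact integrable_inv_one_add_norm_pow.mul_prod
    ((integrable_indicator_iff hc.measurableSet).2 (integrableOn_const hc.measure_lt_top.ne))

theorem majorant_nonneg (R : ℝ) (q : Phase n) : 0 ≤ majorant R q := by
  have : 0 ≤ (Metric.closedBall (0 : Config n) R).indicator (fun _ => (1 : ℝ)) q.2 :=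
    Set.indicator_nonneg (fun _ _ => zero_le_one) _
  unfold majorant
  positivity

theorem contDiff_fioKernel {h : ℝ} {φ : Phase n → ℝ} (hφ : ContDiff ℝ ∞ φ) {a : Phase n → ℂ}
    (ha : ContDiff ℝ ∞ a) (hac : HasCompactSupport a) : ContDiff ℝ ∞ (fioKernel h φ a) := by
  obtain ⟨R, hR⟩ := hac.isCompact.isBounded.exists_norm_le
  refine (contDiff_oscIntegral (contDiff_transformPhase hφ) (K := Metric.closedBall 0 R)
    (ha.comp (by fun_prop)) (isCompact_closedBall _ _) ?_).1
  refine (tsupport_comp_subset_preimage a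
    (by fun_prop : Continuous fun x : Phase n × Config n => (x.1.1, x.2))).trans fun x hx => ?_
  have := hR _ hx
  rw [Set.mem_preimage, mem_closedBall_zero_iff]
  exact (le_max_right _ _).trans this

theorem hasCompactSupport_comp_swap {a : Phase n → ℂ} (ha : HasCompactSupport a) :
    HasCompactSupport (a ∘ Prod.swap) :=
  ha.comp_homeomorph (Homeomorph.prodComm (Config n) (Config n))

theorem contDiff_symbolIntegrand {h : ℝ} {φ : Phase n → ℝ} (hφ : ContDiff ℝ ∞ φ)
    {a b g : Phase n → ℂ} (ha : ContDiff ℝ ∞ a) (hac : HasCompactSupport a)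
    (hb : ContDiff ℝ ∞ b) (hg : ContDiff ℝ ∞ g) :
    ContDiff ℝ ∞ (fun z : Phase n × Phase n => symbolIntegrand h φ a b g z.1 z.2) := by
  have hsw : ContDiff ℝ ∞ (Prod.swap : Phase n → Phase n) := contDiff_snd.prodMk contDiff_fst
  have h1 := contDiff_fioKernel (h := h) hφ ha hac
  have h2 := contDiff_fioKernel (h := h) (hφ.comp hsw) (ha.comp hsw)
    (hasCompactSupport_comp_swap hac)
  have e1 : ContDiff ℝ ∞ (fun z : Phase n × Phase n => ⟪z.2.1, z.2.2⟫_ℝ - ⟪z.1.1, z.1.2⟫_ℝ) :=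
    (contDiff_pairing.comp contDiff_snd).sub (contDiff_pairing.comp contDiff_fst)
  have e2 : ContDiff ℝ ∞ (fun z : Phase n × Phase n =>
      Complex.exp (Complex.I / h * ((⟪z.2.1, z.2.2⟫_ℝ - ⟪z.1.1, z.1.2⟫_ℝ : ℝ) : ℂ))) :=
    (contDiff_const.mul (Complex.ofRealCLM.contDiff.comp e1)).cexp
  have e3 : ContDiff ℝ ∞ (fun z : Phase n × Phase n => fioKernel h φ a (z.1.1, z.2.1)) :=
    h1.comp ((contDiff_fst.comp contDiff_fst).prodMk (contDiff_fst.comp contDiff_snd))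
  have e4 : ContDiff ℝ ∞ (fun z : Phase n × Phase n =>
      conj (fioKernel h (φ ∘ Prod.swap) (a ∘ Prod.swap) (z.2.2, z.1.2))) :=
    Complex.conjCLE.contDiff.comp
      (h2.comp ((contDiff_snd.comp contDiff_snd).prodMk (contDiff_snd.comp contDiff_fst)))
  have e5 : ContDiff ℝ ∞ (fun z : Phase n × Phase n => g (z.2.1, z.1.2)) :=
    hg.comp ((contDiff_fst.comp contDiff_snd).prodMk (contDiff_snd.comp contDiff_fst))
  exact ((e2.mul (e3.mul e4)).mul (hb.comp contDiff_snd)).mul e5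

/-- The symbol of `S B S*`, with a factor `g(y, ρ)` inserted into the integral. -/
def symbolIntegral (h : ℝ) (φ : Phase n → ℝ) (a b g : Phase n → ℂ) (p : Phase n) : ℂ :=
  ((((2 * Real.pi * h) ^ n : ℝ) : ℂ)⁻¹) ^ 2 * ∫ q, symbolIntegrand h φ a b g p q

theorem symbolIntegrand_eq_zero {h : ℝ} {φ : Phase n → ℝ} {a b g : Phase n → ℂ} {R : ℝ}
    (ha : tsupport a ⊆ Metric.closedBall 0 R) {p : Phase n} (hp : R < ‖p.1‖) (q : Phase n) :
    symbolIntegrand h φ a b g p q = 0 := by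
  have hz : fioKernel h φ a (p.1, q.1) = 0 := fioKernel_eq_zero (p := (p.1, q.1)) ha hp
  simp only [symbolIntegrand, hz, mul_zero, zero_mul]

theorem norm_prefactor_le {h : ℝ} (hh : 0 < h) :
    ‖((((2 * Real.pi * h) ^ n : ℝ) : ℂ)⁻¹) ^ 2‖ ≤ (h⁻¹) ^ (2 * n) := by
  have h1 : h ≤ 2 * Real.pi * h := le_mul_of_one_le_left hh.le (by
    have := Real.pi_gt_three
    linarith)
  rw [norm_pow, norm_inv, Complex.norm_real, Real.norm_of_nonneg (by positivity), ← inv_pow,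
    ← pow_mul, mul_comm n 2]
  gcongr

set_option maxHeartbeats 400000 in
/-- Away from the compact part, the symbol is negligible with all its derivatives. -/
theorem exists_symbolIntegral_remainder {φ : Phase n → ℝ} (hφ : ContDiff ℝ ∞ φ) {R : ℝ} :
    ∃ T : ℝ, 0 < T ∧ ∀ {χ : Phase n → ℝ} {T' : ℝ}, ContDiff ℝ ∞ χ → T < T' →
      (∀ z, ‖z‖ ≤ T' → χ z = 1) → HasCompactSupport χ →
      ∀ {h : ι → ℝ}, (∀ i, 0 < h i) → (∀ i, h i ≤ 1) → ∀ {a b : ι → Phase n → ℂ},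
      SymbolOn (Metric.closedBall 0 R) (fun _ _ => 1) (fun _ _ => 1) a →
      (∀ i, tsupport (a i) ⊆ Metric.closedBall 0 R) → (∀ i, ContDiff ℝ ∞ (b i)) →
      ∀ {C : ℝ}, (∀ i z, ‖b i z‖ ≤ C) →
      (∀ i, ContDiff ℝ ∞ (symbolIntegral (h i) φ (a i) (b i) (fun z => 1 - (χ z : ℂ)))) ∧
      ∀ k N : ℕ, ∃ C, 0 ≤ C ∧ ∀ i p,
        ‖iteratedFDeriv ℝ k (symbolIntegral (h i) φ (a i) (b i) (fun z => 1 - (χ z : ℂ))) p‖ ≤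
          C * (h i ^ N * ((1 + ‖p‖)⁻¹) ^ N) := by
  obtain ⟨T, hT, H⟩ := symbolOn_symbolIntegrand (ι := ι) hφ (R := R)
  refine ⟨T, hT, ?_⟩
  intro χ T' hχ hTT' hχ1 hχc h hh hh1 a b ha has hbs C hb
  set g : Phase n → ℂ := fun z => 1 - (χ z : ℂ) with hg
  have hgs : ContDiff ℝ ∞ g := contDiff_const.sub (Complex.ofRealCLM.contDiff.comp hχ)
  have hac : ∀ i, HasCompactSupport (a i) := fun i =>
    HasCompactSupport.of_support_subset_isCompact (isCompact_closedBall 0 R)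
      ((subset_tsupport _).trans (has i))
  have hjoint := fun i => contDiff_symbolIntegrand (h := h i) hφ (ha.contDiff i) (hac i)
    (hbs i) hgs
  have hbound : ∀ k N : ℕ, ∃ C', 0 ≤ C' ∧ ∀ i p q,
      ‖iteratedFDeriv ℝ k (fun p => symbolIntegrand (h i) φ (a i) (b i) g p q) p‖ ≤
        C' * (h i ^ (N + 2 * n) * ((1 + ‖p.2‖)⁻¹) ^ N * majorant R q) := by
    intro k N
    -- The exponent budget: N for the claimed decay, k for the loss ((1+|ρ|)/h)^k of the
    -- derivatives, 2n for the prefactor h^{-2n}, and n + 1 for integrability in y.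
    obtain ⟨C', hC'0, hC'⟩ := (H hχ hTT' hχ1 hχc hh hh1 ha has hb
      (N + k + (2 * n) + (n + 1))).bound k
    refine ⟨C', hC'0, fun i p q => (hC' (i, q) p (Set.mem_univ _)).trans ?_⟩
    refine mul_le_mul_of_nonneg_left ?_ hC'0
    have hi := hh i
    have hi1 := hh1 i
    simp only [majorant]
    set I := (Metric.closedBall (0 : Config n) R).indicator (fun _ => (1 : ℝ)) q.2
    have hI : 0 ≤ I := Set.indicator_nonneg (fun _ _ => zero_le_one) _
    set u := (1 + ‖p.2‖) with hu
    set v := (1 + ‖q.1‖)⁻¹ with hv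
    have hu1 : 1 ≤ u := by simp [hu]
    have hu0 : 0 < u := by positivity
    have hui : u⁻¹ ≤ 1 := inv_le_one_of_one_le₀ hu1
    have hv0 : 0 ≤ v := by positivity
    have hv1 : v ≤ 1 := inv_le_one_of_one_le₀ (by simp)
    have e1 : h i ^ (N + k + 2 * n + (n + 1)) * (h i)⁻¹ ^ k ≤ h i ^ (N + 2 * n) := by
      have : h i ^ (N + k + 2 * n + (n + 1)) * (h i)⁻¹ ^ k = h i ^ (N + 2 * n) * h i ^ (n + 1) := by
        rw [inv_pow]; field_simp; ring
      rw [this]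
      exact mul_le_of_le_one_right (by positivity) (pow_le_one₀ hi.le hi1)
    have e2 : u⁻¹ ^ (N + k + 2 * n + (n + 1)) * u ^ k ≤ u⁻¹ ^ N := by
      have : u⁻¹ ^ (N + k + 2 * n + (n + 1)) * u ^ k = u⁻¹ ^ N * u⁻¹ ^ (2 * n + (n + 1)) := by
        simp only [inv_pow]; field_simp; ring
      rw [this]
      exact mul_le_of_le_one_right (by positivity) (pow_le_one₀ (by positivity) hui)
    have e3 : v ^ (N + k + 2 * n + (n + 1)) ≤ v ^ (n + 1) :=
      pow_le_pow_of_le_one hv0 hv1 (by omega)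
    calc h i ^ (N + k + 2 * n + (n + 1)) *
          (v ^ (N + k + 2 * n + (n + 1)) * u⁻¹ ^ (N + k + 2 * n + (n + 1))) * I *
          (u * (h i)⁻¹) ^ k
        = (h i ^ (N + k + 2 * n + (n + 1)) * (h i)⁻¹ ^ k) *
          (u⁻¹ ^ (N + k + 2 * n + (n + 1)) * u ^ k) *
          (v ^ (N + k + 2 * n + (n + 1)) * I) := by rw [mul_pow]; ring
      _ ≤ h i ^ (N + 2 * n) * u⁻¹ ^ N * (v ^ (n + 1) * I) := by gcongr
  have hsm : ∀ i, ContDiff ℝ ∞ (fun p => ∫ q, symbolIntegrand (h i) φ (a i) (b i) g p q) ∧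
      ∀ k p, iteratedFDeriv ℝ k (fun p => ∫ q, symbolIntegrand (h i) φ (a i) (b i) g p q) p =
        ∫ q, iteratedFDeriv ℝ k (fun p => symbolIntegrand (h i) φ (a i) (b i) g p q) p := fun i => by
    refine contDiff_integral_of_majorant (hjoint i) fun k => ?_
    obtain ⟨C', hC'0, hC'⟩ := hbound k 0
    refine ⟨fun q => C' * majorant R q, (integrable_majorant R).const_mul C', fun p q =>
      (hC' i p q).trans ?_⟩
    have h2 : h i ^ (0 + 2 * n) ≤ 1 := pow_le_one₀ (hh i).le (hh1 i)
    refine mul_le_mul_of_nonneg_left ?_ hC'0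
    rw [pow_zero, mul_one]
    exact mul_le_of_le_one_left (majorant_nonneg R q) h2
  refine ⟨fun i => contDiff_const.mul (hsm i).1, fun k N => ?_⟩
  obtain ⟨C', hC'0, hC'⟩ := hbound k N
  set J := ∫ q : Phase n, majorant R q
  have hJ : 0 ≤ J := integral_nonneg fun q => majorant_nonneg R q
  refine ⟨C' * J * (1 + |R|) ^ N, by positivity, fun i p => ?_⟩
  have hi := hh i
  -- For |x| > R the symbol vanishes near p; for |x| ≤ R decay in ρ is decay in p.
  by_cases hp : ‖p.1‖ ≤ R
  · have h1 : ‖iteratedFDeriv ℝ k (symbolIntegral (h i) φ (a i) (b i) g) p‖ ≤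
        (h i)⁻¹ ^ (2 * n) * (C' * (h i ^ (N + 2 * n) * ((1 + ‖p.2‖)⁻¹) ^ N) * J) := by
      rw [show symbolIntegral (h i) φ (a i) (b i) g = fun p =>
        ((((2 * Real.pi * h i) ^ n : ℝ) : ℂ)⁻¹) ^ 2 * ∫ q, symbolIntegrand (h i) φ (a i) (b i) g p q
        from rfl, norm_iteratedFDeriv_const_mul _ (hsm i).1, (hsm i).2]
      refine mul_le_mul (norm_prefactor_le hi) ?_ (norm_nonneg _) (by positivity)
      rw [← integral_const_mul]
      refine norm_integral_le_of_norm_le ((integrable_majorant R).const_mul _)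
        (Filter.Eventually.of_forall fun q => (hC' i p q).trans (le_of_eq ?_))
      ring
    refine h1.trans ?_
    have h2 : (1 + ‖p.2‖)⁻¹ ≤ (1 + |R|) * (1 + ‖p‖)⁻¹ := by
      rw [← div_eq_mul_inv, inv_eq_one_div, div_le_div_iff₀ (by positivity) (by positivity)]
      have h3 : ‖p‖ ≤ |R| + ‖p.2‖ := max_le
        ((hp.trans (le_abs_self R)).trans (le_add_of_nonneg_right (norm_nonneg _)))
        (le_add_of_nonneg_left (abs_nonneg R))
      nlinarith [mul_nonneg (abs_nonneg R) (norm_nonneg p.2)]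
    calc (h i)⁻¹ ^ (2 * n) * (C' * (h i ^ (N + 2 * n) * ((1 + ‖p.2‖)⁻¹) ^ N) * J)
        = C' * J * h i ^ N * ((1 + ‖p.2‖)⁻¹) ^ N := by
          rw [pow_add, inv_pow]; field_simp
      _ ≤ C' * J * h i ^ N * ((1 + |R|) * (1 + ‖p‖)⁻¹) ^ N := by gcongr
      _ = _ := by rw [mul_pow]; ring
  · have hev : symbolIntegral (h i) φ (a i) (b i) g =ᶠ[𝓝 p] fun _ => 0 := by
      have : ∀ᶠ z : Phase n in 𝓝 p, R < ‖z.1‖ :=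
        (continuous_norm.comp continuous_fst).continuousAt.eventually (lt_mem_nhds (not_le.1 hp))
      filter_upwards [this] with z hz
      simp only [symbolIntegral, symbolIntegrand_eq_zero (has i) hz, integral_zero, mul_zero]
    rw [(hev.iteratedFDeriv ℝ k).eq_of_nhds]
    simp only [iteratedFDeriv_fun_zero, Pi.zero_apply, norm_zero]
    positivity

end RemainderSymbol

/-! ### The semiclassical Fourier transform and its inversion. -/

section SemiclassicalFourier

open FourierTransform

/-- The unimodular factor `e^{it/h}`. -/
def phaseFactor (h t : ℝ) : ℂ := Complex.exp (Complex.I / h * (t : ℂ))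

theorem phaseFactor_add (h s t : ℝ) : phaseFactor h (s + t) = phaseFactor h s * phaseFactor h t := by
  rw [phaseFactor, phaseFactor, phaseFactor, ← Complex.exp_add]
  push_cast
  ring_nf

theorem phaseFactor_neg (h t : ℝ) : phaseFactor h (-t) = phaseFactor (-h) t := by
  simp only [phaseFactor]
  push_cast
  congr 1
  rw [div_neg]
  ring

theorem norm_phaseFactor (h t : ℝ) : ‖phaseFactor h t‖ = 1 := by
  have : Complex.I / h * (t : ℂ) = ((t / h : ℝ) : ℂ) * Complex.I := by push_cast; ring
  rw [phaseFactor, this, Complex.norm_exp_ofReal_mul_I]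

theorem conj_phaseFactor (h t : ℝ) : conj (phaseFactor h t) = phaseFactor h (-t) := by
  rw [phaseFactor, phaseFactor, ← Complex.exp_conj]
  simp [neg_div]

theorem contDiff_phaseFactor (h : ℝ) : ContDiff ℝ ∞ (phaseFactor h) :=
  (contDiff_const.mul Complex.ofRealCLM.contDiff).cexp

variable {n : ℕ}

/-- The semiclassical Fourier transform, without normalization. -/
def semiFourier (h : ℝ) (f : Config n → ℂ) (ρ : Config n) : ℂ :=
  ∫ x, phaseFactor h (-⟪x, ρ⟫_ℝ) * f x

theorem semiFourier_eq {h : ℝ} (hh : h ≠ 0) (f : Config n → ℂ) (ρ : Config n) :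
    semiFourier h f ρ = 𝓕 f ((2 * Real.pi * h)⁻¹ • ρ) := by
  rw [Real.fourier_eq', semiFourier]
  congr 1
  funext x
  have hπ := Real.pi_ne_zero
  rw [smul_eq_mul, phaseFactor, real_inner_smul_right]
  congr 2
  have hc : (h : ℂ) ≠ 0 := by exact_mod_cast hh
  have hπc : (Real.pi : ℂ) ≠ 0 := by exact_mod_cast hπ
  push_cast
  field_simp

theorem integrable_semiFourier {h : ℝ} (hh : h ≠ 0) (f : SchwartzMap (Config n) ℂ) :
    Integrable (semiFourier h f) := by
  have h1 : semiFourier h f = fun ρ => (𝓕 f) ((2 * Real.pi * h)⁻¹ • ρ) := by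
    funext ρ
    rw [semiFourier_eq hh, SchwartzMap.fourier_coe]
  rw [h1]
  exact (𝓕 f).integrable.comp_smul (inv_ne_zero (by have := Real.pi_ne_zero; positivity))

/-- Inversion of the semiclassical Fourier transform. -/
theorem semiFourier_inversion {h : ℝ} (hh : h ≠ 0) (f : SchwartzMap (Config n) ℂ) (x : Config n) :
    ∫ ρ, phaseFactor h ⟪ρ, x⟫_ℝ * semiFourier h f ρ = ((|2 * Real.pi * h| ^ n : ℝ) : ℂ) * f x := by
  have hπ := Real.pi_ne_zero
  have hne : 2 * Real.pi * h ≠ 0 := by positivity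
  set Ψ : Config n → ℂ := fun w => Complex.exp (((2 * Real.pi * ⟪w, x⟫_ℝ : ℝ) : ℂ) * Complex.I) •
    𝓕 (f : Config n → ℂ) w with hΨ
  have h1 : (fun ρ => phaseFactor h ⟪ρ, x⟫_ℝ * semiFourier h f ρ) =
      fun ρ => Ψ ((2 * Real.pi * h)⁻¹ • ρ) := by
    funext ρ
    rw [semiFourier_eq hh, hΨ]
    simp only [smul_eq_mul, real_inner_smul_left, phaseFactor]
    congr 2
    have hc : (h : ℂ) ≠ 0 := by exact_mod_cast hh
    have hπc : (Real.pi : ℂ) ≠ 0 := by exact_mod_cast hπ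
    push_cast
    field_simp
  rw [h1, Measure.integral_comp_smul]
  have h2 : ∫ w, Ψ w = f x := by
    rw [← Real.fourierInv_eq']
    have := f.continuous.fourierInv_fourier_eq f.integrable (by
      rw [← SchwartzMap.fourier_coe]; exact (𝓕 f).integrable)
    rw [this]
  rw [h2, inv_pow, inv_inv, abs_pow, finrank_euclideanSpace_fin, Complex.real_smul]

end SemiclassicalFourier

/-! ### The functions S*g and BS*g. -/

section ReducedFunction

variable {n : ℕ}

/-- The Fourier transform of `S* g`, up to normalization. -/
def adjointTransform (h : ℝ) (φ : Phase n → ℝ) (a : Phase n → ℂ) (g : Config n → ℂ)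
    (ξ : Config n) : ℂ :=
  ∫ u, phaseFactor h (-φ (u, ξ)) * (conj (a (u, ξ)) * g u)

variable {h : ℝ} {φ : Phase n → ℝ} {a b : Phase n → ℂ} {R : ℝ}

theorem eq_zero_of_lt_norm (ha : tsupport a ⊆ Metric.closedBall 0 R) {z : Phase n}
    (hz : R < ‖z.1‖ ∨ R < ‖z.2‖) : a z = 0 := by
  by_contra hne
  have := ha (subset_tsupport a hne)
  rw [mem_closedBall_zero_iff] at this
  have h1 : ‖z.1‖ ≤ ‖z‖ := norm_fst_le z
  have h2 : ‖z.2‖ ≤ ‖z‖ := norm_snd_le z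
  rcases hz with hz | hz <;> linarith

theorem adjointTransform_eq_zero (ha : tsupport a ⊆ Metric.closedBall 0 R) (g : Config n → ℂ)
    {ξ : Config n} (hξ : R < ‖ξ‖) : adjointTransform h φ a g ξ = 0 := by
  have : ∀ u, a (u, ξ) = 0 := fun u => eq_zero_of_lt_norm ha (Or.inr hξ)
  simp [adjointTransform, this]

theorem contDiff_adjointTransform (hφ : ContDiff ℝ ∞ φ) (ha : ContDiff ℝ ∞ a)
    (has : tsupport a ⊆ Metric.closedBall 0 R) {g : Config n → ℂ} (hg : ContDiff ℝ ∞ g) :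
    ContDiff ℝ ∞ (adjointTransform h φ a g) := by
  have hsw : ContDiff ℝ ∞ (fun x : Config n × Config n => (x.2, x.1)) :=
    contDiff_snd.prodMk contDiff_fst
  refine (contDiff_oscIntegral (h := h) (Φ := fun x : Config n × Config n => -φ (x.2, x.1))
    (hφ.comp hsw).neg (A := fun x => conj (a (x.2, x.1)) * g x.2)
    ((Complex.conjCLE.contDiff.comp (ha.comp hsw)).mul (hg.comp contDiff_snd))
    (isCompact_closedBall 0 R) ?_).1
  refine closure_minimal (fun x hx => ?_) (Metric.isClosed_closedBall.preimage continuous_snd)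
  rw [Set.mem_preimage, mem_closedBall_zero_iff]
  by_contra hlt
  refine hx ?_
  simp only [eq_zero_of_lt_norm has (z := (x.2, x.1)) (Or.inl (not_le.1 hlt)), map_zero, zero_mul]

theorem hasCompactSupport_adjointTransform (has : tsupport a ⊆ Metric.closedBall 0 R)
    (g : Config n → ℂ) : HasCompactSupport (adjointTransform h φ a g) := by
  refine HasCompactSupport.intro (isCompact_closedBall 0 R) fun ξ hξ => ?_
  rw [mem_closedBall_zero_iff, not_le] at hξ
  exact adjointTransform_eq_zero has g hξ

theorem fourierIntegralOpAdjoint_eq (g : Config n → ℂ) (y : Config n) :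
    fourierIntegralOpAdjoint h φ a g y = (((2 * Real.pi * h) ^ n : ℝ) : ℂ)⁻¹ *
      semiFourier (-h) (adjointTransform h φ a g) y := by
  rw [fourierIntegralOpAdjoint, semiFourier]
  congr 2
  funext η
  rw [← phaseFactor_neg, neg_neg, adjointTransform, ← integral_const_mul]
  congr 1
  funext u
  have e1 : Complex.exp (-(Complex.I / h * ((φ (u, η) - ⟪y, η⟫_ℝ : ℝ) : ℂ))) =
      phaseFactor h (⟪η, y⟫_ℝ) * phaseFactor h (-φ (u, η)) := by
    rw [← phaseFactor_add, phaseFactor, real_inner_comm]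
    push_cast
    ring_nf
  rw [e1]
  ring

/-- The function `B S* g`. -/
def pseudoAdjoint (h : ℝ) (b : Phase n → ℂ) (G : Config n → ℂ) (y : Config n) : ℂ :=
  ∫ ξ, phaseFactor h ⟪y, ξ⟫_ℝ * (b (y, ξ) * G ξ)

/-- S*g is, up to normalization, the transform with parameter -h of the smooth compactly supported
function G, so Fourier inversion evaluates the y-integral in B and no convergence question arises.
-/
theorem standardQuantization_adjoint_eq (hh : 0 < h) (hφ : ContDiff ℝ ∞ φ) (ha : ContDiff ℝ ∞ a)
    (has : tsupport a ⊆ Metric.closedBall 0 R) (g : SchwartzMap (Config n) ℂ) (y : Config n) :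
    standardQuantization h b (fourierIntegralOpAdjoint h φ a g) y =
      (((2 * Real.pi * h) ^ n : ℝ) : ℂ)⁻¹ * pseudoAdjoint h b (adjointTransform h φ a g) y := by
  set G := adjointTransform h φ a g with hG
  set Gs : SchwartzMap (Config n) ℂ := (hasCompactSupport_adjointTransform has g).toSchwartzMap
    (contDiff_adjointTransform hφ ha has g.smooth') with hGs
  have hGc : (Gs : Config n → ℂ) = G := rfl
  rw [standardQuantization, pseudoAdjoint]
  congr 2
  funext ξ
  have hinv := semiFourier_inversion (neg_ne_zero.2 hh.ne') Gs ξ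
  rw [hGc, mul_neg, abs_neg, abs_of_pos (by positivity)] at hinv
  have hne : (((2 * Real.pi * h) ^ n : ℝ) : ℂ) ≠ 0 := by
    have : 0 < (2 * Real.pi * h) ^ n := by positivity
    exact_mod_cast this.ne'
  have e1 : ∀ y', Complex.exp (Complex.I / h * ((⟪y - y', ξ⟫_ℝ : ℝ) : ℂ)) * b (y, ξ) *
      fourierIntegralOpAdjoint h φ a g y' = phaseFactor h ⟪y, ξ⟫_ℝ * b (y, ξ) *
        (((2 * Real.pi * h) ^ n : ℝ) : ℂ)⁻¹ * (phaseFactor (-h) ⟪y', ξ⟫_ℝ * semiFourier (-h) G y') := by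
    intro y'
    rw [fourierIntegralOpAdjoint_eq, ← phaseFactor_neg]
    have : Complex.exp (Complex.I / h * ((⟪y - y', ξ⟫_ℝ : ℝ) : ℂ)) =
        phaseFactor h ⟪y, ξ⟫_ℝ * phaseFactor h (-⟪y', ξ⟫_ℝ) := by
      rw [← phaseFactor_add, inner_sub_left, sub_eq_add_neg, phaseFactor]
    rw [this]
    ring
  simp only [e1, integral_const_mul, hinv]
  field_simp

theorem contDiff_pseudoAdjoint (hb : ContDiff ℝ ∞ b) {G : Config n → ℂ} (hG : ContDiff ℝ ∞ G)
    (hGc : HasCompactSupport G) : ContDiff ℝ ∞ (pseudoAdjoint h b G) := by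
  refine (contDiff_oscIntegral (h := h) (Φ := fun x : Config n × Config n => ⟪x.1, x.2⟫_ℝ)
    contDiff_pairing (A := fun x => b (x.1, x.2) * G x.2) (hb.mul (hG.comp contDiff_snd))
    hGc.isCompact ?_).1
  refine closure_minimal (fun x hx => ?_) ((isClosed_tsupport G).preimage continuous_snd)
  exact subset_tsupport G (right_ne_zero_of_mul hx)

/-- Decay of `B S* g`, uniformly bounded symbols being allowed. -/
theorem exists_norm_pseudoAdjoint_le (hh : 0 < h) (hh1 : h ≤ 1) (hbs : ContDiff ℝ ∞ b)
    (hb : ∀ k, ∃ C, 0 ≤ C ∧ ∀ z, ‖iteratedFDeriv ℝ k b z‖ ≤ C)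
    {G : Config n → ℂ} (hG : ContDiff ℝ ∞ G) (hGc : HasCompactSupport G) :
    ∃ C, 0 ≤ C ∧ ∀ y, ‖pseudoAdjoint h b G y‖ ≤ C * ((1 + ‖y‖)⁻¹) ^ (n + 1) := by
  obtain ⟨R, hR⟩ := hGc.isCompact.isBounded.exists_norm_le
  -- The radius 2 accommodates the cutoff χ, which equals one on the unit ball.
  set R' := max 2 R with hR'
  have hK : IsCompact (Metric.closedBall (0 : Phase n) R') := isCompact_closedBall _ _
  obtain ⟨T, hT, H⟩ := exists_norm_transform_le (ι := Config n) (φ := fun _ => 0) contDiff_const hK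
  obtain ⟨χ, hχ, hχ1, -, hχs⟩ := exists_contDiff_eq_one_on_closedBall (Config n) one_pos
  have hbsym : SymbolOn Set.univ (fun _ _ => 1) (fun _ _ => 1) (fun _ : Unit => b) := by
    refine ⟨fun _ => hbs, fun k => ?_⟩
    obtain ⟨C, hC0, hC⟩ := hb k
    exact ⟨C, hC0, fun i z _ => by simpa using hC z⟩
  have h1 := hbsym.comp_affine (fun _ : Config n => ())
    ((ContinuousLinearMap.inr ℝ (Config n) (Config n)).comp
      (ContinuousLinearMap.snd ℝ (Config n) (Config n)))
    (ContinuousLinearMap.opNorm_le_bound _ zero_le_one fun z => by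
      rw [one_mul]
      refine max_le (by simp) (le_max_right _ _)) (fun y => (y, 0))
  simp only [ContinuousLinearMap.comp_apply, ContinuousLinearMap.inr_apply,
    ContinuousLinearMap.coe_snd', Prod.mk_add_mk, add_zero, zero_add] at h1
  have hχG : ContDiff ℝ ∞ (fun z : Phase n => (χ z.1 : ℂ) * G z.2) :=
    (Complex.ofRealCLM.contDiff.comp (hχ.comp contDiff_fst)).mul (hG.comp contDiff_snd)
  have h2 : SymbolOn (Metric.closedBall (0 : Phase n) R') (fun _ _ => 1) (fun _ _ => 1)
      (fun (y : Config n) (z : Phase n) => b (y, z.2) * ((χ z.1 : ℂ) * G z.2)) :=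
    ((h1.mono_set (Set.subset_univ _)).mul (SymbolOn.of_isCompact hχG hK)).congr_weight
      fun _ _ _ => one_mul _
  have h3 := SymbolOn.comp_overSet hK (v := fun _ => 1) (μ := fun _ => 1) h2 (fun _ => le_rfl)
    (fun _ => zero_le_one)
  have hcl : IsClosed (overSet (Metric.closedBall (0 : Phase n) R')) :=
    hK.isClosed.preimage (f := fun x : Phase n × Config n => (x.1.1, x.2)) (by fun_prop)
  have hsupp : ∀ y : Config n, tsupport (fun x : Phase n × Config n =>
      b (y, x.2) * ((χ x.1.1 : ℂ) * G x.2)) ⊆ overSet (Metric.closedBall 0 R') := fun y => by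
    refine closure_minimal (fun x hx => ?_) hcl
    have h4 := right_ne_zero_of_mul hx
    have h5 : χ x.1.1 ≠ 0 := fun h0 => left_ne_zero_of_mul h4 (by simp [h0])
    have h6 := hχs (subset_tsupport χ h5)
    have h7 := hR _ (subset_tsupport G (right_ne_zero_of_mul h4))
    rw [mem_closedBall_zero_iff] at h6
    change (x.1.1, x.2) ∈ Metric.closedBall (0 : Phase n) R'
    rw [mem_closedBall_zero_iff]
    refine max_le ?_ ?_
    · exact h6.trans (le_trans (by norm_num) (le_max_left _ _))
    · exact h7.trans (le_max_right _ _)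
  obtain ⟨C, hC0, hC⟩ := H (h := fun _ => h) (v := fun _ => 1) (fun _ => hh) (fun _ => hh1)
    (fun _ => zero_le_one) h3 hsupp (n + 1)
  refine ⟨C * (1 + T) ^ (n + 1), by positivity, fun y => ?_⟩
  -- The integral in ξ is a transform with phase φ = 0 and frequency -y. The first parameter is a
  -- dummy, confined by χ and set to zero. The y inside b is treated as an index, which makes the
  -- bound uniform in it.
  have h8 : pseudoAdjoint h b G y = oscIntegral h (transformPhase fun _ => 0)
      (fun x : Phase n × Config n => b (y, x.2) * ((χ x.1.1 : ℂ) * G x.2)) (0, -y) := by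
    rw [pseudoAdjoint, oscIntegral]
    congr 1
    funext ξ
    have : χ 0 = 1 := hχ1 0 (by simp)
    simp [oscFactor, phaseFactor, transformPhase, this]
  rw [h8]
  refine (hC y (0, -y)).trans ?_
  rw [one_mul, mul_assoc]
  refine mul_le_mul_of_nonneg_left ?_ hC0
  have := decayWeight_le hT le_rfl (n + 1) hh hh1 (-y)
  rwa [norm_neg] at this

end ReducedFunction

/-! ### The operator SBS* as a quantization. -/

section OperatorIdentity

variable {n : ℕ} {h : ℝ} {φ : Phase n → ℝ} {a b : Phase n → ℂ} {R : ℝ}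

theorem fioKernel_eq (p : Phase n) :
    fioKernel h φ a p = ∫ u, phaseFactor h (φ (p.1, u) - ⟪p.2, u⟫_ℝ) * a (p.1, u) := rfl

/-- Qualitative, for one fixed operator: the constant may depend on h and a, since it only serves to
justify Fubini. -/
theorem exists_norm_fioKernel_le (hφ : ContDiff ℝ ∞ φ) (hh : 0 < h) (hh1 : h ≤ 1)
    (ha : ContDiff ℝ ∞ a) (has : tsupport a ⊆ Metric.closedBall 0 R) (N : ℕ) :
    ∃ C, 0 ≤ C ∧ ∀ p, ‖fioKernel h φ a p‖ ≤ C * ((1 + ‖p.2‖)⁻¹) ^ N := by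
  obtain ⟨T, hT, H⟩ := symbolOn_transform (ι := Unit) hφ (isCompact_closedBall (0 : Phase n) R)
  obtain ⟨C, hC0, hC⟩ := (H (fun _ => hh) (fun _ => hh1) (a := fun _ => a)
    (SymbolOn.of_isCompact ha (isCompact_closedBall _ _)) (fun _ => has) N).bound 0
  refine ⟨C * (1 + T) ^ N, by positivity, fun p => ?_⟩
  have h1 := hC () p (Set.mem_univ _)
  rw [norm_iteratedFDeriv_zero, pow_zero, mul_one] at h1
  refine h1.trans ?_
  rw [mul_assoc]
  exact mul_le_mul_of_nonneg_left (decayWeight_le hT le_rfl N hh hh1 p.2) hC0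

theorem tsupport_comp_swap_subset (has : tsupport a ⊆ Metric.closedBall 0 R) :
    tsupport (a ∘ Prod.swap) ⊆ Metric.closedBall 0 R :=
  (tsupport_comp_subset_preimage a continuous_swap).trans fun z hz => by
    have := has hz
    rw [mem_closedBall_zero_iff] at this ⊢
    exact (max_comm _ _).trans_le this

theorem hasCompactSupport_of_tsupport_subset_closedBall
    (has : tsupport a ⊆ Metric.closedBall 0 R) : HasCompactSupport a :=
  HasCompactSupport.of_support_subset_isCompact (isCompact_closedBall 0 R)
    ((subset_tsupport _).trans has)

theorem contDiff_comp_swap {F : Type*} [NormedAddCommGroup F] [NormedSpace ℝ F] {f : Phase n → F}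
    (hf : ContDiff ℝ ∞ f) : ContDiff ℝ ∞ (f ∘ Prod.swap) :=
  hf.comp (contDiff_snd.prodMk contDiff_fst)

theorem exists_norm_symbolIntegrand_le (hφ : ContDiff ℝ ∞ φ) (hh : 0 < h) (hh1 : h ≤ 1)
    (ha : ContDiff ℝ ∞ a) (has : tsupport a ⊆ Metric.closedBall 0 R) {C : ℝ}
    (hb : ∀ z, ‖b z‖ ≤ C) :
    ∃ C', 0 ≤ C' ∧ ∀ (g : Phase n → ℂ) p q,
      ‖symbolIntegrand h φ a b g p q‖ ≤ C' * majorant R q * ‖g (q.1, p.2)‖ := by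
  have has' := tsupport_comp_swap_subset has
  obtain ⟨C₁, hC₁0, hC₁⟩ := exists_norm_fioKernel_le hφ hh hh1 ha has (n + 1)
  obtain ⟨C₂, hC₂0, hC₂⟩ := exists_norm_fioKernel_le (contDiff_comp_swap hφ) hh hh1
    (contDiff_comp_swap ha) has' 0
  have hC0 : 0 ≤ C := (norm_nonneg _).trans (hb 0)
  refine ⟨C₁ * C₂ * C, by positivity, fun g p q => ?_⟩
  rw [symbolIntegrand, norm_mul]
  refine mul_le_mul_of_nonneg_right ?_ (norm_nonneg _)
  by_cases hq : q.2 ∈ Metric.closedBall (0 : Config n) R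
  · have e1 := hC₁ (p.1, q.1)
    have e2 := hC₂ (q.2, p.2)
    rw [pow_zero, mul_one] at e2
    have e3 : ‖Complex.exp (Complex.I / h * ((⟪q.1, q.2⟫_ℝ - ⟪p.1, p.2⟫_ℝ : ℝ) : ℂ))‖ = 1 :=
      norm_phaseFactor h _
    rw [norm_mul, norm_mul, norm_mul, e3, one_mul, RCLike.norm_conj, majorant,
      Set.indicator_of_mem hq, mul_one]
    calc _ ≤ (C₁ * ((1 + ‖q.1‖)⁻¹) ^ (n + 1)) * C₂ * C := by
          gcongr
          exact hb q
      _ = _ := by ring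
  · have hq' : R < ‖q.2‖ := by rwa [mem_closedBall_zero_iff, not_le] at hq
    have hz : fioKernel h (φ ∘ Prod.swap) (a ∘ Prod.swap) (q.2, p.2) = 0 :=
      fioKernel_eq_zero (p := (q.2, p.2)) has' hq'
    have := majorant_nonneg R q
    simp only [hz, map_zero, mul_zero, zero_mul, norm_zero]
    positivity

theorem integrable_symbolIntegrand (hφ : ContDiff ℝ ∞ φ) (hh : 0 < h) (hh1 : h ≤ 1)
    (ha : ContDiff ℝ ∞ a) (has : tsupport a ⊆ Metric.closedBall 0 R) (hbs : ContDiff ℝ ∞ b)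
    {C : ℝ} (hb : ∀ z, ‖b z‖ ≤ C) {g : Phase n → ℂ} (hg : ContDiff ℝ ∞ g) {C₀ : ℝ}
    (hg0 : ∀ z, ‖g z‖ ≤ C₀) (p : Phase n) : Integrable (symbolIntegrand h φ a b g p) := by
  obtain ⟨C', hC'0, hC'⟩ := exists_norm_symbolIntegrand_le hφ hh hh1 ha has hb
  have hc := (contDiff_symbolIntegrand (h := h) hφ ha
    (hasCompactSupport_of_tsupport_subset_closedBall has) hbs hg).continuous
  refine (((integrable_majorant R).const_mul C').mul_const C₀).mono'
    (hc.comp (Continuous.prodMk_right p)).aestronglyMeasurable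
    (Filter.Eventually.of_forall fun q => (hC' g p q).trans ?_)
  exact mul_le_mul_of_nonneg_left (hg0 _) (mul_nonneg hC'0 (majorant_nonneg R q))

/-- The symbol splits along a cutoff. -/
theorem symbolIntegral_split (hφ : ContDiff ℝ ∞ φ) (hh : 0 < h) (hh1 : h ≤ 1)
    (ha : ContDiff ℝ ∞ a) (has : tsupport a ⊆ Metric.closedBall 0 R) (hbs : ContDiff ℝ ∞ b)
    {C : ℝ} (hb : ∀ z, ‖b z‖ ≤ C) {g : Phase n → ℂ} (hg : ContDiff ℝ ∞ g)
    (hgc : HasCompactSupport g) (p : Phase n) :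
    symbolIntegral h φ a b (fun _ => 1) p =
      symbolIntegral h φ a b g p + symbolIntegral h φ a b (fun z => 1 - g z) p := by
  obtain ⟨C₀, hC₀⟩ := hgc.exists_bound_of_continuous hg.continuous
  have h1 := integrable_symbolIntegrand hφ hh hh1 ha has hbs hb hg hC₀ p
  have h2 := integrable_symbolIntegrand hφ hh hh1 ha has hbs hb
    (g := fun z => 1 - g z) (contDiff_const.sub hg) (C₀ := 1 + C₀)
    (fun z => (norm_sub_le _ _).trans (by rw [norm_one]; gcongr; exact hC₀ z)) p
  rw [symbolIntegral, symbolIntegral, symbolIntegral, ← mul_add, ← integral_add h1 h2]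
  congr 2
  funext q
  simp only [symbolIntegrand]
  ring

/-- The Parseval identity for the kernel of `S*`. -/
theorem integral_conj_fioKernel_mul (hφ : ContDiff ℝ ∞ φ) (hh : 0 < h) (ha : ContDiff ℝ ∞ a)
    (has : tsupport a ⊆ Metric.closedBall 0 R) (g : SchwartzMap (Config n) ℂ) (ξ : Config n) :
    ∫ ρ, conj (fioKernel h (φ ∘ Prod.swap) (a ∘ Prod.swap) (ξ, ρ)) * semiFourier h g ρ =
      (((2 * Real.pi * h) ^ n : ℝ) : ℂ) * adjointTransform h φ a g ξ := by
  have hac := hasCompactSupport_of_tsupport_subset_closedBall has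
  have hĝ := integrable_semiFourier hh.ne' g
  set K : Config n → Config n → ℂ := fun ρ u =>
    phaseFactor h (-φ (u, ξ)) * conj (a (u, ξ)) * (phaseFactor h ⟪ρ, u⟫_ℝ * semiFourier h g ρ) with hK
  have hφc := hφ.continuous
  have hacc := ha.continuous
  have hpf := (contDiff_phaseFactor h).continuous
  have hau : Integrable (fun u : Config n => a (u, ξ)) := by
    refine Continuous.integrable_of_hasCompactSupport (by fun_prop)
      (HasCompactSupport.intro (isCompact_closedBall 0 R) fun u hu => ?_)
    rw [mem_closedBall_zero_iff, not_le] at hu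
    exact eq_zero_of_lt_norm has (Or.inl hu)
  have hint : Integrable (Function.uncurry K) (volume.prod volume) := by
    refine (hĝ.mul_prod hau).mono ?_ (Filter.Eventually.of_forall fun z => ?_)
    · have m1 : Continuous (fun z : Config n × Config n =>
          phaseFactor h (-φ (z.2, ξ)) * conj (a (z.2, ξ))) := by
        have := Complex.continuous_conj
        fun_prop
      have m2 : Continuous (fun z : Config n × Config n => phaseFactor h ⟪z.1, z.2⟫_ℝ) := by
        fun_prop
      exact m1.aestronglyMeasurable.mul (m2.aestronglyMeasurable.mul hĝ.1.comp_fst)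
    · simp only [Function.uncurry, hK, norm_mul, norm_phaseFactor, one_mul, RCLike.norm_conj]
      rw [mul_comm]
  have e1 : ∀ ρ, conj (fioKernel h (φ ∘ Prod.swap) (a ∘ Prod.swap) (ξ, ρ)) * semiFourier h g ρ =
      ∫ u, K ρ u := fun ρ => by
    rw [fioKernel_eq, ← integral_conj, ← integral_mul_const]
    congr 1
    funext u
    simp only [hK, map_mul, conj_phaseFactor, Function.comp_apply, Prod.swap_prod_mk]
    rw [neg_sub, sub_eq_add_neg, phaseFactor_add]
    ring
  simp only [e1]
  rw [integral_integral_swap hint, adjointTransform, ← integral_const_mul]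
  congr 1
  funext u
  simp only [hK]
  rw [integral_const_mul, semiFourier_inversion hh.ne', abs_of_pos (by positivity)]
  ring

theorem continuous_symbolIntegrand_frequency (hφ : ContDiff ℝ ∞ φ) (ha : ContDiff ℝ ∞ a)
    (hac : HasCompactSupport a) (hbs : ContDiff ℝ ∞ b) {g : Phase n → ℂ} (hg : ContDiff ℝ ∞ g)
    (x : Config n) :
    Continuous (fun z : Config n × Phase n => symbolIntegrand h φ a b g (x, z.1) z.2) := by
  have h1 := (contDiff_symbolIntegrand (h := h) hφ ha hac hbs hg).continuous
  have h2 : Continuous (fun z : Config n × Phase n => (((x, z.1), z.2) : Phase n × Phase n)) := by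
    fun_prop
  have h3 := h1.comp h2
  simpa only [Function.comp_def] using h3

set_option maxHeartbeats 1000000 in
/-- `S B S*` is the quantization of its symbol integral. -/
theorem conjugatedOp_eq_standardQuantization (hφ : ContDiff ℝ ∞ φ) (hh : 0 < h) (hh1 : h ≤ 1)
    (ha : ContDiff ℝ ∞ a) (has : tsupport a ⊆ Metric.closedBall 0 R) (hbs : ContDiff ℝ ∞ b)
    (hb : ∀ k, ∃ C, 0 ≤ C ∧ ∀ z, ‖iteratedFDeriv ℝ k b z‖ ≤ C) (g : SchwartzMap (Config n) ℂ) :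
    conjugatedOp h φ a b g = standardQuantization h (symbolIntegral h φ a b fun _ => 1) g := by
  funext x
  have hac := hasCompactSupport_of_tsupport_subset_closedBall has
  have hφc := hφ.continuous
  have hacc := ha.continuous
  have hbc := hbs.continuous
  have hpf := (contDiff_phaseFactor h).continuous
  have hĝ := integrable_semiFourier hh.ne' g
  obtain ⟨Cb, hCb0, hCb⟩ := hb 0
  simp only [norm_iteratedFDeriv_zero] at hCb
  set G := adjointTransform h φ a g with hG
  have hGs : ContDiff ℝ ∞ G := contDiff_adjointTransform hφ ha has g.smooth'
  have hGc : HasCompactSupport G := hasCompactSupport_adjointTransform has g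
  set u := pseudoAdjoint h b G with hu
  set c₀ : ℂ := (((2 * Real.pi * h) ^ n : ℝ) : ℂ)⁻¹ with hc₀
  have hpos : 0 < (2 * Real.pi * h) ^ n := by positivity
  have hc₀ne : (((2 * Real.pi * h) ^ n : ℝ) : ℂ) ≠ 0 := by exact_mod_cast hpos.ne'
  have hus : Continuous u := (contDiff_pseudoAdjoint hbs hGs hGc).continuous
  have hui : Integrable u := by
    obtain ⟨C, hC0, hC⟩ := exists_norm_pseudoAdjoint_le hh hh1 hbs hb hGs hGc
    exact (integrable_inv_one_add_norm_pow.const_mul C).mono' hus.aestronglyMeasurable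
      (Filter.Eventually.of_forall hC)
  -- the left-hand side
  have hL : conjugatedOp h φ a b g x = c₀ * (c₀ * ∫ y, fioKernel h φ a (x, y) * u y) := by
    rw [conjugatedOp, fourierIntegralOp]
    simp only [standardQuantization_adjoint_eq hh hφ ha has g]
    set K : Config n → Config n → ℂ := fun η y =>
      phaseFactor h (φ (x, η) - ⟪y, η⟫_ℝ) * a (x, η) * u y with hK
    have e1 : ∀ η y, Complex.exp (Complex.I / h * ((φ (x, η) - ⟪y, η⟫_ℝ : ℝ) : ℂ)) * a (x, η) *
        (c₀ * u y) = c₀ * K η y := fun η y => by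
      simp only [hK, phaseFactor]
      ring
    have hax : Integrable (fun η : Config n => a (x, η)) := by
      refine Continuous.integrable_of_hasCompactSupport (by fun_prop)
        (HasCompactSupport.intro (isCompact_closedBall 0 R) fun η hη => ?_)
      rw [mem_closedBall_zero_iff, not_le] at hη
      exact eq_zero_of_lt_norm has (Or.inr hη)
    have hint : Integrable (Function.uncurry K) (volume.prod volume) := by
      refine (hax.mul_prod hui).mono ?_ (Filter.Eventually.of_forall fun z => ?_)
      · have m1 : Continuous (Function.uncurry K) := by
          simp only [Function.uncurry_def, hK]
          fun_prop
        exact m1.aestronglyMeasurable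
      · simp only [Function.uncurry, hK, norm_mul, norm_phaseFactor, one_mul]
        exact le_rfl
    simp only [← hG, ← hu, ← hc₀, e1, integral_const_mul]
    rw [integral_integral_swap hint]
    congr 3
    funext y
    rw [fioKernel_eq, ← integral_mul_const]
  -- the right-hand side
  have hR : standardQuantization h (symbolIntegral h φ a b fun _ => 1) g x =
      c₀ * (c₀ * ∫ q : Phase n, fioKernel h φ a (x, q.1) *
        (phaseFactor h ⟪q.1, q.2⟫_ℝ * (b q * G q.2))) ∧
      Integrable (fun q : Phase n => fioKernel h φ a (x, q.1) *
        (phaseFactor h ⟪q.1, q.2⟫_ℝ * (b q * G q.2))) := by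
    -- The double integrand in (ρ,q): the ρ-integral is evaluated by Parseval and reproduces the
    -- function G, after which both sides are the same integral over q = (y,ξ).
    set K : Config n → Phase n → ℂ := fun ρ q =>
      phaseFactor h ⟪x, ρ⟫_ℝ * symbolIntegrand h φ a b (fun _ => 1) (x, ρ) q * semiFourier h g ρ
      with hK
    have hint : Integrable (Function.uncurry K) (volume.prod volume) := by
      obtain ⟨C', hC'0, hC'⟩ := exists_norm_symbolIntegrand_le hφ hh hh1 ha has hCb
      refine (hĝ.norm.mul_prod ((integrable_majorant R).const_mul C')).mono ?_
        (Filter.Eventually.of_forall fun z => ?_)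
      · have m1 := continuous_symbolIntegrand_frequency (h := h) hφ ha hac hbs
          (g := fun _ => 1) contDiff_const x
        have m0 : Continuous (fun z : Config n × Phase n => phaseFactor h ⟪x, z.1⟫_ℝ) := by fun_prop
        have m2 := m0.mul m1
        exact m2.aestronglyMeasurable.mul hĝ.1.comp_fst
      · have := hC' (fun _ => 1) (x, z.1) z.2
        rw [norm_one, mul_one] at this
        simp only [Function.uncurry, hK, norm_mul, norm_phaseFactor, one_mul]
        rw [mul_comm]
        refine (mul_le_mul_of_nonneg_left this (norm_nonneg _)).trans ?_
        rw [norm_norm, Real.norm_of_nonneg hC'0, Real.norm_of_nonneg (majorant_nonneg R z.2)]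
    have hq : ∀ q, ∫ ρ, K ρ q = (((2 * Real.pi * h) ^ n : ℝ) : ℂ) * (fioKernel h φ a (x, q.1) *
        (phaseFactor h ⟪q.1, q.2⟫_ℝ * (b q * G q.2))) := fun q => by
      have e1 : ∀ ρ, K ρ q = fioKernel h φ a (x, q.1) * (phaseFactor h ⟪q.1, q.2⟫_ℝ * b q) *
          (conj (fioKernel h (φ ∘ Prod.swap) (a ∘ Prod.swap) (q.2, ρ)) * semiFourier h g ρ) :=
        fun ρ => by
        have e2 : phaseFactor h ⟪q.1, q.2⟫_ℝ = phaseFactor h ⟪x, ρ⟫_ℝ *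
            Complex.exp (Complex.I / h * ((⟪q.1, q.2⟫_ℝ - ⟪x, ρ⟫_ℝ : ℝ) : ℂ)) := by
          change _ = _ * phaseFactor h _
          rw [← phaseFactor_add]
          congr 1
          ring
        simp only [hK, symbolIntegrand, e2]
        ring
      simp only [e1, integral_const_mul, integral_conj_fioKernel_mul hφ hh ha has]
      ring
    refine ⟨?_, ?_⟩
    · rw [standardQuantization, ← hc₀]
      have e1 : ∀ ρ, ∫ x', Complex.exp (Complex.I / h * ((⟪x - x', ρ⟫_ℝ : ℝ) : ℂ)) *
          symbolIntegral h φ a b (fun _ => 1) (x, ρ) * g x' = c₀ ^ 2 * ∫ q, K ρ q := fun ρ => by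
        have e2 : ∀ x', Complex.exp (Complex.I / h * ((⟪x - x', ρ⟫_ℝ : ℝ) : ℂ)) *
            symbolIntegral h φ a b (fun _ => 1) (x, ρ) * g x' =
            (phaseFactor h ⟪x, ρ⟫_ℝ * symbolIntegral h φ a b (fun _ => 1) (x, ρ)) *
              (phaseFactor h (-⟪x', ρ⟫_ℝ) * g x') := fun x' => by
          have : Complex.exp (Complex.I / h * ((⟪x - x', ρ⟫_ℝ : ℝ) : ℂ)) =
              phaseFactor h ⟪x, ρ⟫_ℝ * phaseFactor h (-⟪x', ρ⟫_ℝ) := by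
            rw [← phaseFactor_add, inner_sub_left, sub_eq_add_neg, phaseFactor]
          rw [this]
          ring
        simp only [e2, integral_const_mul]
        simp only [hK, integral_const_mul, integral_mul_const, symbolIntegral, semiFourier]
        ring
      simp only [e1, integral_const_mul]
      rw [integral_integral_swap hint]
      simp only [hq, integral_const_mul]
      rw [sq, hc₀]
      field_simp
    · have h1 := (hint.integral_prod_right).const_mul c₀
      refine h1.congr (Filter.Eventually.of_forall fun q => ?_)
      have := hq q
      simp only [Function.uncurry] at this ⊢
      rw [this, ← mul_assoc, hc₀, inv_mul_cancel₀ hc₀ne, one_mul]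
  obtain ⟨hR1, hR2⟩ := hR
  rw [hL, hR1, Measure.volume_eq_prod, integral_prod _ hR2]
  congr 3
  funext y
  rw [hu, pseudoAdjoint, ← integral_const_mul]

end OperatorIdentity

/-! ### Decay of the expansion error away from the support. -/

section ExpansionDecay

set_option linter.unusedSectionVars false

open Topology

variable {ι P E : Type*} [NormedAddCommGroup P] [NormedSpace ℝ P] [FiniteDimensional ℝ P]
  [NormedAddCommGroup E] [NormedSpace ℝ E] [FiniteDimensional ℝ E]
  [MeasureSpace E] [BorelSpace E] [(volume : Measure E).IsAddHaarMeasure]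

/-- The oscillatory integral, divided by the volume factor of the stationary phase expansion. -/
def normalizedIntegral (h : ℝ) (Φ : P × E → ℝ) (A : P × E → ℂ) (p : P) : ℂ :=
  (((√h ^ Module.finrank ℝ E)⁻¹ : ℝ) : ℂ) * oscIntegral h Φ A p

namespace CritPhase

variable (Ψ : CritPhase P E) {ρ r : ℝ} {h θ : ι → ℝ} {A : ι → P × E → ℂ}

theorem contDiff_normalizedIntegral {h : ℝ} {A : P × E → ℂ} (hA : ContDiff ℝ ∞ A)
    (hAs : tsupport A ⊆ Metric.closedBall 0 ρ ×ˢ Metric.closedBall 0 r) :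
    ContDiff ℝ ∞ (normalizedIntegral h Ψ.phase A) := by
  have : ProperSpace P := FiniteDimensional.proper ℝ P
  have : ProperSpace E := FiniteDimensional.proper ℝ E
  exact contDiff_const.mul (Ψ.contDiff_oscIntegral hA
    ((isCompact_closedBall (0 : P) ρ).prod (isCompact_closedBall (0 : E) r)) hAs)

theorem norm_iteratedFDeriv_normalizedIntegral_le (hh : ∀ i, 0 < h i)
    (hhθ : ∀ i, h i ≤ θ i ^ 2) (hθ : ∀ i, 0 < θ i) (hθ1 : ∀ i, θ i ≤ 1)
    (hA : SymbolOn Set.univ (fun _ _ => 1) (fun i _ => (θ i)⁻¹) A)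
    (hAs : ∀ i, tsupport (A i) ⊆ Metric.closedBall 0 ρ ×ˢ Metric.closedBall 0 r) (k N : ℕ) :
    ∃ C, 0 ≤ C ∧ ∀ i p r', (N = 0 ∨ (θ i ≤ r' ∧ ∀ z, (p, z) ∈ tsupport (A i) →
      r' ≤ ‖z - Ψ.crit p‖)) →
      ‖iteratedFDeriv ℝ k (normalizedIntegral (h i) Ψ.phase (A i)) p‖ ≤
        C * ((θ i)⁻¹ ^ k * (h i / (θ i * r')) ^ N) := by
  have : ProperSpace P := FiniteDimensional.proper ℝ P
  have : ProperSpace E := FiniteDimensional.proper ℝ E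
  have hs := (isCompact_closedBall (0 : P) ρ).prod (isCompact_closedBall (0 : E) r)
  obtain ⟨C, hC0, hC⟩ := Ψ.norm_iteratedFDeriv_oscIntegral_le hs hh hhθ hθ hθ1
    (hA.mono_set (Set.subset_univ _)) hAs k N
  refine ⟨C, hC0, fun i p r' hr' => ?_⟩
  have h1 : 0 < √(h i) ^ Module.finrank ℝ E := pow_pos (Real.sqrt_pos.2 (hh i)) _
  have h2 := norm_iteratedFDeriv_const_mul (((√(h i) ^ Module.finrank ℝ E)⁻¹ : ℝ) : ℂ)
    (Ψ.contDiff_oscIntegral (h := h i) (hA.contDiff i) hs (hAs i)) k p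
  refine (le_of_eq h2).trans ?_
  rw [Complex.norm_real, Real.norm_of_nonneg (inv_pos.2 h1).le, inv_mul_le_iff₀ h1]
  refine (hC i p r' hr').trans (le_of_eq ?_)
  ring

/-- The terms of the expansion approximate the normalized integral. -/
theorem exists_normalized_expansion (hρ : 0 < ρ) (hh : ∀ i, 0 < h i)
    (hhθ : ∀ i, h i ≤ θ i ^ 2) (hθ : ∀ i, 0 < θ i) (hθ1 : ∀ i, θ i ≤ 1)
    (hA : SymbolOn Set.univ (fun _ _ => 1) (fun i _ => (θ i)⁻¹) A)
    (hAs : ∀ i, tsupport (A i) ⊆ Metric.closedBall 0 ρ ×ˢ Metric.closedBall 0 r) (M : ℕ) :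
    ∃ c : ι → P → ℂ, SymbolOn Set.univ (fun _ _ => 1) (fun i _ => (θ i)⁻¹) c ∧
      (∀ i p, (p, Ψ.crit p) ∉ tsupport (A i) → p ∉ tsupport (c i)) ∧
      ∀ k, ∃ C, 0 ≤ C ∧ ∀ i p,
        ‖iteratedFDeriv ℝ k (fun p => normalizedIntegral (h i) Ψ.phase (A i) p - c i p) p‖ ≤
          C * ((θ i)⁻¹ ^ k * (h i / θ i ^ 2) ^ M) := by
  obtain ⟨c, r', A', hc, hA', hAs', hloc, heq⟩ := Ψ.exists_expansion hρ r hh hhθ hθ hθ1 hA hAs M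
  refine ⟨c, hc, fun i p hp => (hloc i p hp).1, fun k => ?_⟩
  obtain ⟨C, hC0, hC⟩ := Ψ.norm_iteratedFDeriv_normalizedIntegral_le hh hhθ hθ hθ1 hA' hAs' k 0
  refine ⟨C, hC0, fun i p => ?_⟩
  have h1 : √(h i) ^ Module.finrank ℝ E ≠ 0 := (pow_pos (Real.sqrt_pos.2 (hh i)) _).ne'
  have h2 : (fun p => normalizedIntegral (h i) Ψ.phase (A i) p - c i p) =
      fun p => (((h i / θ i ^ 2) ^ M : ℝ) : ℂ) * normalizedIntegral (h i) Ψ.phase (A' i) p := by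
    funext p
    rw [normalizedIntegral, normalizedIntegral, heq i p, Complex.ofReal_inv]
    have h1c : ((√(h i) ^ Module.finrank ℝ E : ℝ) : ℂ) ≠ 0 := by exact_mod_cast h1
    rw [mul_add, inv_mul_cancel_left₀ h1c]
    ring
  rw [h2, norm_iteratedFDeriv_const_mul _ (Ψ.contDiff_normalizedIntegral (hA'.contDiff i) (hAs' i))]
  have h3 : 0 ≤ (h i / θ i ^ 2) ^ M := pow_nonneg (div_nonneg (hh i).le (sq_nonneg _)) _
  have h4 := hC i p 0 (Or.inl rfl)
  rw [pow_zero, mul_one] at h4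
  rw [Complex.norm_real, Real.norm_of_nonneg h3]
  calc _ ≤ (h i / θ i ^ 2) ^ M * (C * (θ i)⁻¹ ^ k) := mul_le_mul_of_nonneg_left h4 h3
    _ = _ := by ring

/-- Decay of the error of an approximation of order `M`, at points whose critical point is far
from the support of the amplitude. -/
theorem exists_norm_iteratedFDeriv_error_le (hρ : 0 < ρ) (hh : ∀ i, 0 < h i)
    (hhθ : ∀ i, h i ≤ θ i ^ 2) (hθ : ∀ i, 0 < θ i) (hθ1 : ∀ i, θ i ≤ 1)
    (hA : SymbolOn Set.univ (fun _ _ => 1) (fun i _ => (θ i)⁻¹) A)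
    (hAs : ∀ i, tsupport (A i) ⊆ Metric.closedBall 0 ρ ×ˢ Metric.closedBall 0 r) {M : ℕ}
    {c : ι → P → ℂ} (hc : ∀ i, ContDiff ℝ ∞ (c i))
    (hloc : ∀ i p, (p, Ψ.crit p) ∉ tsupport (A i) → p ∉ tsupport (c i)) {k : ℕ} {C₀ : ℝ}
    (hC₀ : 0 ≤ C₀) (herr : ∀ i p,
      ‖iteratedFDeriv ℝ k (fun p => normalizedIntegral (h i) Ψ.phase (A i) p - c i p) p‖ ≤
        C₀ * ((θ i)⁻¹ ^ k * (h i / θ i ^ 2) ^ M)) {ε : ℝ} (hε : 0 < ε) (N : ℕ) :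
    ∃ C, 0 ≤ C ∧ ∀ i p d, 0 ≤ d → (d = 0 ∨ (p, Ψ.crit p) ∉ tsupport (A i)) →
      (∀ z, (p, z) ∈ tsupport (A i) → ε * d ≤ ‖z - Ψ.crit p‖) →
      ‖iteratedFDeriv ℝ k (fun p => normalizedIntegral (h i) Ψ.phase (A i) p - c i p) p‖ ≤
        C * ((θ i)⁻¹ ^ k * (h i / θ i ^ 2) ^ M * ((1 + (h i)⁻¹ * θ i * d) ^ N)⁻¹) := by
  -- The N extra orders are to be converted into decay in d. This longer expansion need not extend
  -- c: at points off the support both vanish locally and drop out.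
  obtain ⟨c', hc', hloc', herr'⟩ := Ψ.exists_normalized_expansion hρ hh hhθ hθ hθ1 hA hAs (M + N)
  obtain ⟨C₁, hC₁0, hC₁⟩ := herr' k
  obtain ⟨C₂, hC₂0, hC₂⟩ := Ψ.norm_iteratedFDeriv_normalizedIntegral_le hh hhθ hθ hθ1 hA hAs k
    (M + N)
  refine ⟨C₀ + C₁ * (1 + ε⁻¹) ^ N + C₂ * ((1 + ε⁻¹)) ^ N, by positivity,
    fun i p d hd hdp hsep => ?_⟩
  have hi := hh i
  have hti := hθ i
  set H := h i / θ i ^ 2 with hH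
  have hH0 : 0 < H := by positivity
  have hH1 : H ≤ 1 := div_le_one_of_le₀ (hhθ i) (sq_nonneg _)
  set t := 1 + (h i)⁻¹ * θ i * d with ht
  have ht1 : 1 ≤ t := by rw [ht]; linarith [show 0 ≤ (h i)⁻¹ * θ i * d by positivity]
  have ht0 : 0 < t := zero_lt_one.trans_le ht1
  set B := (θ i)⁻¹ ^ k * H ^ M with hB
  have hB0 : 0 ≤ B := by positivity
  have hq : 0 ≤ B * (t ^ N)⁻¹ := by positivity
  rcases hdp with hd0 | hp
  · have : t = 1 := by rw [ht, hd0]; ring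
    rw [this, one_pow, inv_one, mul_one]
    refine (herr i p).trans (mul_le_mul_of_nonneg_right ?_ hB0)
    have : 0 ≤ C₁ * (1 + ε⁻¹) ^ N := by positivity
    have : 0 ≤ C₂ * (1 + ε⁻¹) ^ N := by positivity
    linarith
  · have hJs := Ψ.contDiff_normalizedIntegral (h := h i) (hA.contDiff i) (hAs i)
    have key : ∀ f : P → ℂ, ContDiff ℝ ∞ f → p ∉ tsupport f →
        iteratedFDeriv ℝ k (fun p => normalizedIntegral (h i) Ψ.phase (A i) p - f p) p =
          iteratedFDeriv ℝ k (normalizedIntegral (h i) Ψ.phase (A i)) p := fun f hf hpf => by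
      have hev : (fun p => normalizedIntegral (h i) Ψ.phase (A i) p - f p) =ᶠ[𝓝 p]
          normalizedIntegral (h i) Ψ.phase (A i) := by
        rw [notMem_tsupport_iff_eventuallyEq] at hpf
        filter_upwards [hpf] with q hq
        simp [hq]
      exact (hev.iteratedFDeriv ℝ k).eq_of_nhds
    rw [key _ (hc i) (hloc i p hp)]
    -- Near regime: with H = h/θ², the identity H·(h⁻¹θd) = d/θ ≤ ε⁻¹ shows H ≲ 1/t for t = 1 +
    -- h⁻¹θd, so H^{M+N} contains the factor t^{-N}.
    by_cases hdθ : ε * d ≤ θ i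
    · have h1 := hC₁ i p
      rw [key _ (hc'.contDiff i) (hloc' i p hp)] at h1
      refine h1.trans ?_
      have h2 : H ≤ (1 + ε⁻¹) * t⁻¹ := by
        rw [← div_eq_mul_inv, le_div_iff₀ ht0, ht, mul_add, mul_one]
        refine add_le_add hH1 ?_
        have : H * ((h i)⁻¹ * θ i * d) = d / θ i := by
          rw [hH]; field_simp
        rw [this, div_le_iff₀ hti, inv_mul_eq_div, le_div_iff₀ hε, mul_comm]
        exact hdθ
      calc C₁ * ((θ i)⁻¹ ^ k * H ^ (M + N)) = C₁ * (B * H ^ N) := by rw [hB]; ring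
        _ ≤ C₁ * (B * ((1 + ε⁻¹) * t⁻¹) ^ N) := by gcongr
        _ = C₁ * (1 + ε⁻¹) ^ N * (B * (t ^ N)⁻¹) := by rw [mul_pow, inv_pow]; ring
        _ ≤ _ := by
          refine mul_le_mul_of_nonneg_right ?_ hq
          have : 0 ≤ C₂ * (1 + ε⁻¹) ^ N := by positivity
          linarith
    · rw [not_le] at hdθ
      have hdpos : 0 < d := by
        by_contra hn
        have : d = 0 := le_antisymm (not_lt.1 hn) hd
        rw [this, mul_zero] at hdθ
        linarith
      -- Far regime: M + N dampings give g^{M+N} with g = h/(θεd). The bound g ≤ H pays for H^M, and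
      -- g ≲ 1/t for the decay.
      refine (hC₂ i p (ε * d) (Or.inr ⟨hdθ.le, hsep⟩)).trans ?_
      set g := h i / (θ i * (ε * d)) with hg
      have hg0 : 0 ≤ g := by positivity
      have hgH : g ≤ H := by
        rw [hg, hH, sq]
        gcongr
      have hgt : g ≤ (1 + ε⁻¹) * t⁻¹ := by
        rw [← div_eq_mul_inv, le_div_iff₀ ht0, ht, mul_add, mul_one]
        refine add_le_add (hgH.trans hH1) (le_of_eq ?_)
        rw [hg]; field_simp
      calc C₂ * ((θ i)⁻¹ ^ k * g ^ (M + N)) = C₂ * ((θ i)⁻¹ ^ k * g ^ M * g ^ N) := by ring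
        _ ≤ C₂ * ((θ i)⁻¹ ^ k * H ^ M * ((1 + ε⁻¹) * t⁻¹) ^ N) := by gcongr
        _ = C₂ * (1 + ε⁻¹) ^ N * (B * (t ^ N)⁻¹) := by rw [mul_pow, inv_pow]; ring
        _ ≤ _ := by
          refine mul_le_mul_of_nonneg_right ?_ hq
          have : 0 ≤ C₁ * (1 + ε⁻¹) ^ N := by positivity
          linarith

end CritPhase

end ExpansionDecay

/-! ### The cut-off symbol as an oscillatory integral. -/

section CompositionAmplitude

variable {ι : Type*} {n : ℕ}

/-- The amplitude belonging to `compositionPhase`. -/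
def compositionAmplitude (a b χ : Phase n → ℂ) (x : Phase n × (Phase n × Phase n)) : ℂ :=
  a (x.1.1, x.2.2.1) * conj (a (x.2.2.2, x.2.1.2)) * (χ (x.2.1.1, x.1.2) * b x.2.1)

theorem tsupport_compositionAmplitude_subset {a b χ : Phase n → ℂ} {R : ℝ}
    (ha : tsupport a ⊆ Metric.closedBall 0 R) (hχ : tsupport χ ⊆ Metric.closedBall 0 R) :
    tsupport (compositionAmplitude a b χ) ⊆
      Metric.closedBall (0 : Phase n) R ×ˢ Metric.closedBall (0 : Phase n × Phase n) R := by
  refine closure_minimal (fun x hx => ?_)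
    (Metric.isClosed_closedBall.prod Metric.isClosed_closedBall)
  have h1 := ha (subset_tsupport a (left_ne_zero_of_mul (left_ne_zero_of_mul hx)))
  have h2' : a (x.2.2.2, x.2.1.2) ≠ 0 := fun h0 =>
    right_ne_zero_of_mul (left_ne_zero_of_mul hx) (by rw [h0, map_zero])
  have h2 := ha (subset_tsupport a h2')
  have h3 := hχ (subset_tsupport χ (left_ne_zero_of_mul (right_ne_zero_of_mul hx)))
  rw [mem_closedBall_zero_iff] at h1 h2 h3
  have e1 := (norm_fst_le _).trans h1
  have e2 := (norm_snd_le _).trans h1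
  have e3 := (norm_fst_le _).trans h2
  have e4 := (norm_snd_le _).trans h2
  have e5 := (norm_fst_le _).trans h3
  have e6 := (norm_snd_le _).trans h3
  refine ⟨?_, ?_⟩
  · rw [mem_closedBall_zero_iff]
    exact max_le e1 e6
  · rw [mem_closedBall_zero_iff]
    exact max_le (max_le e5 e4) (max_le e2 e3)

/-- This ties the support of the expansion to b: at a critical point the component (y,ξ) is κ⁻¹(p).
-/
theorem mem_tsupport_of_mem_tsupport_compositionAmplitude {a b χ : Phase n → ℂ}
    {x : Phase n × (Phase n × Phase n)} (hx : x ∈ tsupport (compositionAmplitude a b χ)) :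
    x.2.1 ∈ tsupport b := by
  have h1 : tsupport (compositionAmplitude a b χ) ⊆
      (fun x : Phase n × (Phase n × Phase n) => x.2.1) ⁻¹' tsupport b :=
    closure_minimal (fun x hx => subset_tsupport b
      (right_ne_zero_of_mul (right_ne_zero_of_mul hx)))
      ((isClosed_tsupport b).preimage (by fun_prop))
  exact h1 hx

theorem SymbolOn.comp_projection {X Y F : Type*} [NormedAddCommGroup X] [NormedSpace ℝ X]
    [NormedAddCommGroup Y] [NormedSpace ℝ Y] [NormedAddCommGroup F] [NormedSpace ℝ F]
    {m : ι → ℝ} {f : ι → X → F} (hf : SymbolOn Set.univ (fun _ _ => 1) (fun i _ => m i) f)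
    (L : Y →L[ℝ] X) (hL : ∀ y, ‖L y‖ ≤ ‖y‖) :
    SymbolOn Set.univ (fun _ _ => 1) (fun i _ => m i) (fun i y => f i (L y)) := by
  simpa using hf.comp_affine (fun i => i) L
    (ContinuousLinearMap.opNorm_le_bound _ zero_le_one fun y => by rw [one_mul]; exact hL y)
    (fun _ => 0)

theorem symbolOn_compositionAmplitude {θ : ι → ℝ} (hθ : ∀ i, 0 < θ i) (hθ1 : ∀ i, θ i ≤ 1)
    {a b : ι → Phase n → ℂ} {χ : Phase n → ℂ}
    (ha : SymbolOn Set.univ (fun _ _ => 1) (fun _ _ => 1) a)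
    (hb : SymbolOn Set.univ (fun _ _ => 1) (fun i _ => (θ i)⁻¹) b)
    (hχ : SymbolOn Set.univ (fun _ _ => 1) (fun _ _ => 1) (fun _ : ι => χ)) :
    SymbolOn Set.univ (fun _ _ => 1) (fun i _ => (θ i)⁻¹)
      (fun i => compositionAmplitude (a i) (b i) χ) := by
  have hm : ∀ i, 1 ≤ (θ i)⁻¹ := fun i => (one_le_inv₀ (hθ i)).2 (hθ1 i)
  let p₁ := ContinuousLinearMap.fst ℝ (Phase n) (Phase n × Phase n)
  let q₁ := (ContinuousLinearMap.fst ℝ (Phase n) (Phase n)).comp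
    (ContinuousLinearMap.snd ℝ (Phase n) (Phase n × Phase n))
  let q₂ := (ContinuousLinearMap.snd ℝ (Phase n) (Phase n)).comp
    (ContinuousLinearMap.snd ℝ (Phase n) (Phase n × Phase n))
  let f := ContinuousLinearMap.fst ℝ (Config n) (Config n)
  let s := ContinuousLinearMap.snd ℝ (Config n) (Config n)
  have b1 : ∀ x : Phase n × (Phase n × Phase n), ‖x.2.1‖ ≤ ‖x‖ := fun x =>
    (norm_fst_le x.2).trans (norm_snd_le x)
  have b2 : ∀ x : Phase n × (Phase n × Phase n), ‖x.2.2‖ ≤ ‖x‖ := fun x =>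
    (norm_snd_le x.2).trans (norm_snd_le x)
  have up : ∀ {g : ι → Phase n × (Phase n × Phase n) → ℂ},
      SymbolOn Set.univ (fun _ _ => 1) (fun _ _ => 1) g →
      SymbolOn Set.univ (fun _ _ => 1) (fun i _ => (θ i)⁻¹) g := fun hg =>
    hg.mono_scale (fun _ _ _ => zero_le_one) (fun _ _ _ => zero_le_one) fun i _ _ => hm i
  have h1 := up (ha.comp_projection ((f.comp p₁).prod (f.comp q₂)) fun x => max_le
    ((norm_fst_le x.1).trans (norm_fst_le x)) ((norm_fst_le x.2.2).trans (b2 x)))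
  have h2 := (up (ha.comp_projection ((s.comp q₂).prod (s.comp q₁)) fun x => max_le
    ((norm_snd_le x.2.2).trans (b2 x)) ((norm_snd_le x.2.1).trans (b1 x)))).const_clm
    (Complex.conjCLE : ℂ →L[ℝ] ℂ)
  have h3 := up (hχ.comp_projection ((f.comp q₁).prod (s.comp p₁)) fun x => max_le
    ((norm_fst_le x.2.1).trans (b1 x)) ((norm_snd_le x.1).trans (norm_fst_le x)))
  have h4 := hb.comp_projection q₁ b1
  exact ((h1.mul h2).mul (h3.mul h4)).congr_weight fun _ _ _ => by norm_num

theorem isAddHaarMeasure_volume_prod {V W : Type*} [NormedAddCommGroup V] [NormedSpace ℝ V]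
    [FiniteDimensional ℝ V] [MeasureSpace V] [BorelSpace V] [(volume : Measure V).IsAddHaarMeasure]
    [NormedAddCommGroup W] [NormedSpace ℝ W] [FiniteDimensional ℝ W] [MeasureSpace W]
    [BorelSpace W] [(volume : Measure W).IsAddHaarMeasure] :
    (volume : Measure (V × W)).IsAddHaarMeasure := by
  have : ProperSpace V := FiniteDimensional.proper ℝ V
  have : ProperSpace W := FiniteDimensional.proper ℝ W
  rw [Measure.volume_eq_prod]
  infer_instance

instance : (volume : Measure (Phase n)).IsAddHaarMeasure := isAddHaarMeasure_volume_prod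

instance : (volume : Measure (Phase n × Phase n)).IsAddHaarMeasure :=
  isAddHaarMeasure_volume_prod

/-- Writing out the two kernels adds the variables η and x'. With the cutoff all variables are
confined to balls, so Fubini applies. -/
theorem symbolIntegral_eq_oscIntegral {h : ℝ} {φ : Phase n → ℝ} (hφ : ContDiff ℝ ∞ φ)
    {a b χ : Phase n → ℂ} {R : ℝ} (ha : ContDiff ℝ ∞ a) (hb : ContDiff ℝ ∞ b)
    (hχ : ContDiff ℝ ∞ χ) (has : tsupport a ⊆ Metric.closedBall 0 R)
    (hχs : tsupport χ ⊆ Metric.closedBall 0 R) (p : Phase n) :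
    symbolIntegral h φ a b χ p = ((((2 * Real.pi * h) ^ n : ℝ) : ℂ)⁻¹) ^ 2 *
      oscIntegral h (compositionPhase φ) (compositionAmplitude a b χ) p := by
  have hAc : ContDiff ℝ ∞ (compositionAmplitude a b χ) := by
    have e1 : ContDiff ℝ ∞ (fun x : Phase n × (Phase n × Phase n) => a (x.1.1, x.2.2.1)) :=
      ha.comp (by fun_prop)
    have e2 : ContDiff ℝ ∞ (fun x : Phase n × (Phase n × Phase n) =>
        conj (a (x.2.2.2, x.2.1.2))) := Complex.conjCLE.contDiff.comp (ha.comp (by fun_prop))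
    have e3 : ContDiff ℝ ∞ (fun x : Phase n × (Phase n × Phase n) => χ (x.2.1.1, x.1.2)) :=
      hχ.comp (by fun_prop)
    have e4 : ContDiff ℝ ∞ (fun x : Phase n × (Phase n × Phase n) => b x.2.1) :=
      hb.comp (by fun_prop)
    exact (e1.mul e2).mul (e3.mul e4)
  have hint := integrable_oscFactor_mul (h := h) (contDiff_compositionPhase hφ) hAc
    (isCompact_closedBall (0 : Phase n × Phase n) R)
    ((tsupport_compositionAmplitude_subset has hχs).trans fun x hx => hx.2) p
  rw [symbolIntegral, oscIntegral]
  congr 1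
  rw [Measure.volume_eq_prod (Phase n) (Phase n)] at hint ⊢
  rw [integral_prod _ hint]
  congr 1
  funext q
  have e1 : ∀ w : Phase n, oscFactor h (compositionPhase φ) (p, (q, w)) *
      compositionAmplitude a b χ (p, (q, w)) =
      (phaseFactor h (⟪q.1, q.2⟫_ℝ - ⟪p.1, p.2⟫_ℝ) * (b q * χ (q.1, p.2))) *
      ((phaseFactor h (φ (p.1, w.1) - ⟪q.1, w.1⟫_ℝ) * a (p.1, w.1)) *
        conj (phaseFactor h (φ (w.2, q.2) - ⟪p.2, w.2⟫_ℝ) * a (w.2, q.2))) := fun w => by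
    have e2 : oscFactor h (compositionPhase φ) (p, (q, w)) =
        phaseFactor h (⟪q.1, q.2⟫_ℝ - ⟪p.1, p.2⟫_ℝ) *
        (phaseFactor h (φ (p.1, w.1) - ⟪q.1, w.1⟫_ℝ) *
          phaseFactor h (-(φ (w.2, q.2) - ⟪p.2, w.2⟫_ℝ))) := by
      rw [← phaseFactor_add, ← phaseFactor_add]
      change phaseFactor h _ = _
      congr 1
      simp only [compositionPhase, inner_sub_left, inner_sub_right]
      rw [real_inner_comm p.2 w.2]
      ring
    rw [e2, map_mul, conj_phaseFactor, compositionAmplitude]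
    ring
  simp only [e1, integral_const_mul]
  have e3 := integral_prod_mul (μ := (volume : Measure (Config n)))
    (ν := (volume : Measure (Config n)))
    (fun η : Config n => phaseFactor h (φ (p.1, η) - ⟪q.1, η⟫_ℝ) * a (p.1, η))
    (fun u : Config n => conj (phaseFactor h (φ (u, q.2) - ⟪p.2, u⟫_ℝ) * a (u, q.2)))
  rw [← Measure.volume_eq_prod] at e3
  rw [e3, integral_conj, symbolIntegrand, fioKernel_eq, fioKernel_eq]
  simp only [Function.comp_apply, Prod.swap_prod_mk, phaseFactor]
  ring

end CompositionAmplitude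

/-! ### Euclidean distance to the image of D. -/

section PhaseDist

variable {n : ℕ}

theorem norm_toLp_le (z : Phase n) : ‖WithLp.toLp 2 z‖ ≤ 2 * ‖z‖ := by
  rw [WithLp.prod_norm_eq_of_L2, Real.sqrt_le_iff]
  have h1 := norm_fst_le z
  have h2 := norm_snd_le z
  have h3 := norm_nonneg z.1
  have h4 := norm_nonneg z.2
  refine ⟨by positivity, ?_⟩
  change ‖z.1‖ ^ 2 + ‖z.2‖ ^ 2 ≤ _
  nlinarith

theorem phaseDist_nonneg (z : Phase n) (s : Set (Phase n)) : 0 ≤ phaseDist z s :=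
  Metric.infDist_nonneg

theorem phaseDist_eq_zero_of_mem {z : Phase n} {s : Set (Phase n)} (hz : z ∈ s) :
    phaseDist z s = 0 :=
  Metric.infDist_zero_of_mem (Set.mem_image_of_mem _ hz)

theorem phaseDist_le_of_mem (z : Phase n) {w : Phase n} {s : Set (Phase n)} (hw : w ∈ s) :
    phaseDist z s ≤ 2 * ‖z - w‖ := by
  refine (Metric.infDist_le_dist_of_mem (Set.mem_image_of_mem _ hw)).trans ?_
  rw [dist_eq_norm, ← WithLp.toLp_sub]
  exact norm_toLp_le _

theorem exists_norm_le_of_continuous {V W : Type*} [NormedAddCommGroup V] [ProperSpace V]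
    [NormedAddCommGroup W] {f : V → W} (hf : Continuous f) (R : ℝ) :
    ∃ B, 0 ≤ B ∧ ∀ v, ‖v‖ ≤ R → ‖f v‖ ≤ B := by
  obtain ⟨B, hB⟩ := (isCompact_closedBall (0 : V) R).exists_bound_of_continuousOn hf.continuousOn
  exact ⟨|B|, abs_nonneg B, fun v hv =>
    (hB v (mem_closedBall_zero_iff.2 hv)).trans (le_abs_self B)⟩

/-- A Lipschitz bound l for κ on a ball containing z and κ⁻¹(p) gives |p - κ(z)| ≤ l|κ⁻¹(p) - z|;
the factor 2 compares the sup and Euclidean norms. -/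
theorem exists_mul_phaseDist_le {κ κinv : Phase n → Phase n} (hκ : ContDiff ℝ ∞ κ)
    (hκinv : Continuous κinv) (hr : Function.RightInverse κinv κ) (R : ℝ) :
    ∃ ε : ℝ, 0 < ε ∧ ∀ p z : Phase n, ‖p‖ ≤ R → ‖z‖ ≤ R → ∀ D : Set (Phase n), z ∈ D →
      ε * phaseDist p (κ '' D) ≤ ‖z - κinv p‖ := by
  obtain ⟨B, hB0, hB⟩ := exists_norm_le_of_continuous hκinv R
  obtain ⟨l, hl0, hl⟩ := exists_norm_le_of_continuous
    (hκ.continuous_fderiv (by norm_num)) (max R B)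
  refine ⟨(2 * (l + 1))⁻¹, by positivity, fun p z hp hz D hzD => ?_⟩
  have h1 := (convex_closedBall (0 : Phase n) (max R B)).norm_image_sub_le_of_norm_fderiv_le
    (𝕜 := ℝ) (f := κ) (C := l) (fun x _ => (hκ.differentiable (by norm_num)).differentiableAt)
    (fun x hx => hl x (mem_closedBall_zero_iff.1 hx))
    (mem_closedBall_zero_iff.2 (hz.trans (le_max_left _ _)))
    (mem_closedBall_zero_iff.2 ((hB p hp).trans (le_max_right _ _)))
  rw [hr p, norm_sub_rev (κinv p)] at h1
  have h2 := phaseDist_le_of_mem p (Set.mem_image_of_mem κ hzD)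
  rw [inv_mul_le_iff₀ (by positivity)]
  have := norm_nonneg (z - κinv p)
  nlinarith

/-- The distance grows at most linearly in p, so decay in |p| is also decay in the distance. An
empty D has distance zero by convention and is harmless. -/
theorem exists_phaseDist_le {κ : Phase n → Phase n} (hκ : Continuous κ) (R : ℝ) :
    ∃ B : ℝ, 0 ≤ B ∧ ∀ D : Set (Phase n), D ⊆ Metric.closedBall 0 R → ∀ p : Phase n,
      phaseDist p (κ '' D) ≤ B * (1 + ‖p‖) := by
  obtain ⟨B, hB0, hB⟩ := exists_norm_le_of_continuous hκ R
  refine ⟨2 + 2 * B, by positivity, fun D hD p => ?_⟩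
  have hp := norm_nonneg p
  rcases D.eq_empty_or_nonempty with rfl | ⟨w, hw⟩
  · have : phaseDist p (κ '' ∅) = 0 := by simp [phaseDist]
    rw [this]
    positivity
  · have h1 := phaseDist_le_of_mem p (Set.mem_image_of_mem κ hw)
    have h2 := norm_sub_le p (κ w)
    have h3 := hB w (mem_closedBall_zero_iff.1 (hD hw))
    nlinarith

/-- Absorbs the remainder into the claimed bound: h ≤ h/θ² serves the M factors, and h/(1+x) ≲
1/(1+h⁻¹θd) the N factors. -/
theorem rapid_decay_le {h θ x d B : ℝ} (hh : 0 < h) (hh1 : h ≤ 1) (hθ : 0 < θ) (hθ1 : θ ≤ 1)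
    (hx : 0 ≤ x) (hd : 0 ≤ d) (_hB : 0 ≤ B) (hdx : d ≤ B * (1 + x)) (k M N : ℕ) :
    h ^ (M + N) * ((1 + x)⁻¹) ^ (M + N) ≤
      (1 + B) ^ N * (θ⁻¹ ^ k * (h / θ ^ 2) ^ M * ((1 + h⁻¹ * θ * d) ^ N)⁻¹) := by
  have ht : 0 < 1 + h⁻¹ * θ * d := by positivity
  have h1 : h ≤ h / θ ^ 2 := by
    rw [le_div_iff₀ (by positivity)]
    exact mul_le_of_le_one_right hh.le (pow_le_one₀ hθ.le hθ1)
  have h2 : h * (1 + x)⁻¹ ≤ (1 + B) * (1 + h⁻¹ * θ * d)⁻¹ := by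
    rw [← div_eq_mul_inv, ← div_eq_mul_inv, div_le_div_iff₀ (by positivity) ht, mul_add]
    have e1 : h * (h⁻¹ * θ * d) = θ * d := by field_simp
    rw [e1]
    have : θ * d ≤ d := mul_le_of_le_one_left hd hθ1
    nlinarith
  have h3 : (1 + x)⁻¹ ≤ 1 := inv_le_one_of_one_le₀ (by linarith)
  have h4 : 1 ≤ θ⁻¹ ^ k := one_le_pow₀ ((one_le_inv₀ hθ).2 hθ1)
  have h5 : 0 ≤ (1 + x)⁻¹ := by positivity
  calc h ^ (M + N) * ((1 + x)⁻¹) ^ (M + N)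
      = 1 * (h ^ M * ((1 + x)⁻¹) ^ M) * (h * (1 + x)⁻¹) ^ N := by rw [mul_pow]; ring
    _ ≤ θ⁻¹ ^ k * ((h / θ ^ 2) ^ M * 1 ^ M) * ((1 + B) * (1 + h⁻¹ * θ * d)⁻¹) ^ N := by
        gcongr
    _ = _ := by rw [mul_pow, inv_pow, one_pow]; ring

end PhaseDist

/-! ### Assembly of the symbol estimates. -/

section ConjugatedSymbol

variable {ι : Type*} {n : ℕ}

/-- The fiber has dimension 4n, so √h^{4n} = h^{2n} cancels the prefactor (2πh)^{-2n}. -/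
theorem norm_normalizing_factor_le {h : ℝ} (hh : 0 < h) :
    ‖((((2 * Real.pi * h) ^ n : ℝ) : ℂ)⁻¹) ^ 2 *
      ((√h ^ Module.finrank ℝ (Phase n × Phase n) : ℝ) : ℂ)‖ ≤ 1 := by
  have hf : Module.finrank ℝ (Phase n × Phase n) = 2 * (2 * n) := by
    rw [Module.finrank_prod, Module.finrank_prod, finrank_euclideanSpace_fin]
    ring
  rw [hf, norm_mul, Complex.norm_real, pow_mul, Real.sq_sqrt hh.le,
    Real.norm_of_nonneg (by positivity)]
  refine (mul_le_mul_of_nonneg_right (norm_prefactor_le hh) (by positivity)).trans ?_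
  rw [← mul_pow, inv_mul_cancel₀ hh.ne', one_pow]

/-- The symbol of the conjugated operator, its size, and its approximations. -/
theorem exists_symbolIntegral_expansion {φ : Phase n → ℝ} (hφ : ContDiff ℝ ∞ φ)
    {κ κinv : Phase n → Phase n} (hκ : ContDiff ℝ ∞ κ) (hκinv : ContDiff ℝ ∞ κinv)
    (hl : Function.LeftInverse κinv κ) (hr : Function.RightInverse κinv κ)
    (hφκ : Generates φ κ) {R : ℝ} {h θ : ι → ℝ} (hh : ∀ i, 0 < h i) (hh1 : ∀ i, h i ≤ 1)
    (hhθ : ∀ i, h i ≤ θ i ^ 2) (hθ : ∀ i, 0 < θ i) (hθ1 : ∀ i, θ i ≤ 1)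
    {a b : ι → Phase n → ℂ} (ha : SymbolOn Set.univ (fun _ _ => 1) (fun _ _ => 1) a)
    (has : ∀ i, tsupport (a i) ⊆ Metric.closedBall 0 R)
    (hb : SymbolOn Set.univ (fun _ _ => 1) (fun i _ => (θ i)⁻¹) b) :
    SymbolOn Set.univ (fun _ _ => 1) (fun i _ => (θ i)⁻¹)
        (fun i => symbolIntegral (h i) φ (a i) (b i) fun _ => 1) ∧
      ∀ M : ℕ, ∃ c : ι → Phase n → ℂ,
        SymbolOn Set.univ (fun _ _ => 1) (fun i _ => (θ i)⁻¹) c ∧ (M = 0 → c = 0) ∧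
        (∀ i D, tsupport (b i) ⊆ D → tsupport (c i) ⊆ κ '' D) ∧
        ∀ (R' : ℝ) (k N : ℕ), ∃ C, 0 ≤ C ∧ ∀ i D, D ⊆ Metric.closedBall 0 R' →
          tsupport (b i) ⊆ D → ∀ p,
          ‖iteratedFDeriv ℝ k
            (fun p => symbolIntegral (h i) φ (a i) (b i) (fun _ => 1) p - c i p) p‖ ≤
            C * ((θ i)⁻¹ ^ k * (h i / θ i ^ 2) ^ M *
              ((1 + (h i)⁻¹ * θ i * phaseDist p (κ '' D)) ^ N)⁻¹) := by
  obtain ⟨Ψ, hΨ, hcrit⟩ := exists_critPhase hφ hκ hκinv hl hφκ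
  obtain ⟨T, hT, hrem⟩ := exists_symbolIntegral_remainder (ι := ι) hφ (R := R)
  obtain ⟨χ, hχ, hχ1, -, hχs⟩ := exists_contDiff_eq_one_on_closedBall (Phase n)
    (r := T + 1) (by linarith)
  have hχc : HasCompactSupport χ := HasCompactSupport.of_support_subset_isCompact
    (isCompact_closedBall _ _) ((subset_tsupport χ).trans hχs)
  obtain ⟨C_b, -, hC_b⟩ := hb.bound 0
  have hb0 : ∀ i z, ‖b i z‖ ≤ C_b := fun i z => by simpa using hC_b i z (Set.mem_univ z)
  obtain ⟨hrc, hrd⟩ := hrem hχ (lt_add_one T) hχ1 hχc hh hh1 (ha.mono_set (Set.subset_univ _))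
    has hb.contDiff hb0
  set g : Phase n → ℂ := fun z => (χ z : ℂ) with hg
  have hgc : ContDiff ℝ ∞ g := Complex.ofRealCLM.contDiff.comp hχ
  have hgs : tsupport g ⊆ Metric.closedBall 0 (T + 1 + 1) :=
    (closure_mono fun z hz => by
      intro h0
      exact hz (by simp [hg, h0])).trans hχs
  have hgcs := hasCompactSupport_of_tsupport_subset_closedBall hgs
  set R₀ : ℝ := max R (T + 1 + 1) with hR₀
  have hR₀pos : 0 < R₀ := lt_of_lt_of_le (by linarith) (le_max_right _ _)
  have has₀ : ∀ i, tsupport (a i) ⊆ Metric.closedBall 0 R₀ := fun i =>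
    (has i).trans (Metric.closedBall_subset_closedBall (le_max_left _ _))
  have hgs₀ : tsupport g ⊆ Metric.closedBall 0 R₀ :=
    hgs.trans (Metric.closedBall_subset_closedBall (le_max_right _ _))
  have hgsym : SymbolOn Set.univ (fun _ _ => 1) (fun _ _ => 1) (fun _ : ι => g) :=
    (SymbolOn.of_isCompact hgc (isCompact_closedBall _ _)).extend (fun _ _ => zero_le_one)
      (fun _ _ => zero_le_one) fun _ => hgs
  set A : ι → Phase n × (Phase n × Phase n) → ℂ :=
    fun i => compositionAmplitude (a i) (b i) g with hA
  have hAsym := symbolOn_compositionAmplitude hθ hθ1 ha hb hgsym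
  have hAs : ∀ i, tsupport (A i) ⊆ Metric.closedBall (0 : Phase n) R₀ ×ˢ
      Metric.closedBall (0 : Phase n × Phase n) R₀ := fun i =>
    tsupport_compositionAmplitude_subset (has₀ i) hgs₀
  change SymbolOn Set.univ (fun _ _ => 1) (fun i _ => (θ i)⁻¹) A at hAsym
  set J : ι → Phase n → ℂ := fun i => normalizedIntegral (h i) Ψ.phase (A i) with hJ
  set γ : ι → ℂ := fun i => ((((2 * Real.pi * h i) ^ n : ℝ) : ℂ)⁻¹) ^ 2 *
      ((√(h i) ^ Module.finrank ℝ (Phase n × Phase n) : ℝ) : ℂ) with hγ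
  have hγ1 : ∀ i, ‖γ i‖ ≤ 1 := fun i => norm_normalizing_factor_le (hh i)
  set c₂ : ι → Phase n → ℂ := fun i => symbolIntegral (h i) φ (a i) (b i) fun z => 1 - g z with hc₂
  have hsplit : ∀ i, symbolIntegral (h i) φ (a i) (b i) (fun _ => 1) =
      fun p => γ i * J i p + c₂ i p := fun i => by
    funext p
    rw [symbolIntegral_split hφ (hh i) (hh1 i) (ha.contDiff i) (has i) (hb.contDiff i) (hb0 i)
      hgc hgcs p, symbolIntegral_eq_oscIntegral hφ (ha.contDiff i) (hb.contDiff i) hgc (has₀ i)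
      hgs₀ p]
    have h1 : ((√(h i) ^ Module.finrank ℝ (Phase n × Phase n) : ℝ) : ℂ) ≠ 0 := by
      exact_mod_cast (pow_pos (Real.sqrt_pos.2 (hh i)) _).ne'
    simp only [hγ, hJ, hc₂, hA, normalizedIntegral, hΨ]
    rw [Complex.ofReal_inv, mul_assoc (_ ^ 2) _ (_ * _), mul_inv_cancel_left₀ h1]
  have hJc : ∀ i, ContDiff ℝ ∞ (J i) := fun i =>
    Ψ.contDiff_normalizedIntegral (hAsym.contDiff i) (hAs i)
  have hJb : ∀ k, ∃ C, 0 ≤ C ∧ ∀ i p, ‖iteratedFDeriv ℝ k (J i) p‖ ≤ C * (θ i)⁻¹ ^ k := fun k => by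
    obtain ⟨C, hC0, hC⟩ := Ψ.norm_iteratedFDeriv_normalizedIntegral_le hh hhθ hθ hθ1 hAsym hAs k 0
    exact ⟨C, hC0, fun i p => by simpa using hC i p 0 (Or.inl rfl)⟩
  have hcomb : ∀ (i : ι) (f : Phase n → ℂ), ContDiff ℝ ∞ f → ∀ (k : ℕ) (p : Phase n),
      ‖iteratedFDeriv ℝ k (fun p => γ i * f p + c₂ i p) p‖ ≤
        ‖iteratedFDeriv ℝ k f p‖ + ‖iteratedFDeriv ℝ k (c₂ i) p‖ := fun i f hf k p => by
    have hk : (k : WithTop ℕ∞) ≤ ∞ := by exact_mod_cast le_top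
    have e1 : (fun p => γ i * f p + c₂ i p) = (fun p => γ i * f p) + c₂ i := rfl
    have hγf : ContDiff ℝ ∞ fun p => γ i * f p := contDiff_const.mul hf
    rw [e1, iteratedFDeriv_add (hγf.of_le hk) ((hrc i).of_le hk), Pi.add_apply]
    refine (norm_add_le _ _).trans (add_le_add ?_ le_rfl)
    rw [norm_iteratedFDeriv_const_mul _ hf]
    exact mul_le_of_le_one_left (norm_nonneg _) (hγ1 i)
  have hθk : ∀ i (k : ℕ), 1 ≤ (θ i)⁻¹ ^ k := fun i k =>
    one_le_pow₀ ((one_le_inv₀ (hθ i)).2 (hθ1 i))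
  refine ⟨⟨fun i => ?_, fun k => ?_⟩, fun M => ?_⟩
  · rw [hsplit i]
    exact (contDiff_const.mul (hJc i)).add (hrc i)
  · obtain ⟨C₁, hC₁0, hC₁⟩ := hJb k
    obtain ⟨C₂, hC₂0, hC₂⟩ := hrd k 0
    refine ⟨C₁ + C₂, by positivity, fun i p _ => ?_⟩
    beta_reduce
    rw [hsplit i]
    refine (hcomb i (J i) (hJc i) k p).trans ?_
    have h1 := hC₁ i p
    have h2 := hC₂ i p
    rw [pow_zero, pow_zero, mul_one, mul_one] at h2
    have h3 := le_mul_of_one_le_right hC₂0 (hθk i k)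
    rw [one_mul, add_mul]
    exact add_le_add h1 (h2.trans h3)
  · have hexp : ∃ e : ι → Phase n → ℂ,
        SymbolOn Set.univ (fun _ _ => 1) (fun i _ => (θ i)⁻¹) e ∧ (M = 0 → e = 0) ∧
        (∀ i p, (p, Ψ.crit p) ∉ tsupport (A i) → p ∉ tsupport (e i)) ∧
        ∀ k, ∃ C, 0 ≤ C ∧ ∀ i p, ‖iteratedFDeriv ℝ k (fun p => J i p - e i p) p‖ ≤
          C * ((θ i)⁻¹ ^ k * (h i / θ i ^ 2) ^ M) := by
      -- At order zero the approximation is chosen to be 0 outright, so that the error bound for M =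
      -- 0 is the bound on the symbol itself.
      rcases Nat.eq_zero_or_pos M with rfl | hM
      · refine ⟨0, SymbolOn.zero,
          fun _ => rfl, fun i p _ => by simp [tsupport], ?_⟩
        simpa using hJb
      · obtain ⟨e, he, hloc, herr⟩ :=
          Ψ.exists_normalized_expansion hR₀pos hh hhθ hθ hθ1 hAsym hAs M
        exact ⟨e, he, fun h0 => absurd h0 hM.ne', hloc, herr⟩
    obtain ⟨e, he, he0, hloc, herr⟩ := hexp
    have hmemA : ∀ i D, tsupport (b i) ⊆ D → ∀ p, p ∉ κ '' D → (p, Ψ.crit p) ∉ tsupport (A i) := by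
      intro i D hD p hp hmem
      have h1 := mem_tsupport_of_mem_tsupport_compositionAmplitude hmem
      rw [hcrit] at h1
      exact hp ⟨κinv p, hD h1, hr p⟩
    refine ⟨fun i p => γ i * e i p, ?_, fun hM => ?_, fun i D hD p hp => ?_, fun R' k N => ?_⟩
    · refine ⟨fun i => contDiff_const.mul (he.contDiff i), fun k => ?_⟩
      obtain ⟨C, hC0, hC⟩ := he.bound k
      refine ⟨C, hC0, fun i p hp => ?_⟩
      rw [norm_iteratedFDeriv_const_mul _ (he.contDiff i)]
      exact (mul_le_of_le_one_left (norm_nonneg _) (hγ1 i)).trans (hC i p hp)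
    · funext i p
      simp [he0 hM]
    · by_contra hn
      exact hloc i p (hmemA i D hD p hn) (tsupport_mul_subset_right hp)
    · obtain ⟨ε, hε, hsep⟩ := exists_mul_phaseDist_le hκ hκinv.continuous hr R₀
      obtain ⟨B, hB0, hB⟩ := exists_phaseDist_le hκ.continuous R'
      obtain ⟨C₀, hC₀0, hC₀⟩ := herr k
      obtain ⟨C₁, hC₁0, hC₁⟩ := Ψ.exists_norm_iteratedFDeriv_error_le hR₀pos hh hhθ hθ hθ1 hAsym
        hAs he.contDiff hloc hC₀0 hC₀ hε N
      obtain ⟨C₂, hC₂0, hC₂⟩ := hrd k (M + N)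
      -- C₁ bounds the oscillatory part; C₂(1+B)^N bounds the part outside the cutoff, where linear
      -- growth of the distance turns decay in p into decay in the distance.
      refine ⟨C₁ + C₂ * (1 + B) ^ N, by positivity, fun i D hDR hD p => ?_⟩
      have e1 : (fun p => symbolIntegral (h i) φ (a i) (b i) (fun _ => 1) p - γ i * e i p) =
          fun p => γ i * (fun p => J i p - e i p) p + c₂ i p := by
        funext p
        rw [hsplit i]
        ring
      rw [e1]
      refine (hcomb i _ ((hJc i).sub (he.contDiff i)) k p).trans ?_
      rw [add_mul]
      refine add_le_add (hC₁ i p _ (phaseDist_nonneg p _) ?_ fun z hz => ?_) ?_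
      · by_cases hp : p ∈ κ '' D
        · exact Or.inl (phaseDist_eq_zero_of_mem hp)
        · exact Or.inr (hmemA i D hD p hp)
      · have h1 := hAs i hz
        have h2 := mem_closedBall_zero_iff.1 h1.1
        have h3 := mem_closedBall_zero_iff.1 h1.2
        have h4 := hsep p z.1 h2 ((norm_fst_le z).trans h3) D
          (hD (mem_tsupport_of_mem_tsupport_compositionAmplitude hz))
        refine h4.trans ?_
        rw [hcrit]
        exact norm_fst_le (z - (κinv p, ((κinv p).2, p.1)))
      · refine (hC₂ i p).trans ?_
        rw [mul_assoc]
        exact mul_le_mul_of_nonneg_left (rapid_decay_le (hh i) (hh1 i) (hθ i) (hθ1 i)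
          (norm_nonneg p) (phaseDist_nonneg p _) hB0 (hB D hDR p) k M N) hC₂0

end ConjugatedSymbol

/-! ### The family of all admissible data. -/

section Family

/-- These three facts are all that is used about θ; the last holds because θ² = h^{1-2δ} with 1 - 2δ
≤ 1. -/
theorem semiclassical_scale {h δ : ℝ} (hh : 0 < h) (hh1 : h ≤ 1) (hδ : 0 ≤ δ)
    (hδ1 : δ ≤ 1 / 2) : 0 < h ^ (1 / 2 - δ) ∧ h ^ (1 / 2 - δ) ≤ 1 ∧ h ≤ (h ^ (1 / 2 - δ)) ^ 2 := by
  refine ⟨Real.rpow_pos_of_pos hh _, Real.rpow_le_one hh.le hh1 (by linarith), ?_⟩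
  rw [← Real.rpow_natCast, ← Real.rpow_mul hh.le]
  calc h = h ^ (1 : ℝ) := (Real.rpow_one h).symm
    _ ≤ _ := Real.rpow_le_rpow_of_exponent_ge hh hh1 (by push_cast; linarith)

/-- The data `(h, θ, a, b)` that share the constants of an estimate. -/
structure ConjugationData {n : ℕ} (K : Set (Phase n)) (Ca Cb : ℕ → ℝ) where
  (h θ : ℝ)
  (a b : Phase n → ℂ)
  h_pos : 0 < h
  h_le_one : h ≤ 1
  θ_pos : 0 < θ
  θ_le_one : θ ≤ 1
  h_le : h ≤ θ ^ 2
  isSymbol_a : IsSymbol 1 Ca a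
  tsupport_a : tsupport a ⊆ K
  isSymbol_b : IsSymbol θ Cb b

theorem symbolOn_of_isSymbol {n : ℕ} {ι : Type*} {θ : ι → ℝ} {C : ℕ → ℝ} {b : ι → Phase n → ℂ}
    (hθ : ∀ i, 0 < θ i) (hb : ∀ i, IsSymbol (θ i) C (b i)) :
    SymbolOn Set.univ (fun _ _ => 1) (fun i _ => (θ i)⁻¹) b :=
  ⟨fun i => (hb i).1, fun k => ⟨|C k|, abs_nonneg _, fun i z _ => by
    rw [one_mul]
    exact ((hb i).2 k z).trans (mul_le_mul_of_nonneg_right (le_abs_self _)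
      (pow_pos (inv_pos.2 (hθ i)) k).le)⟩⟩

theorem SymbolOn.exists_isSymbol {n : ℕ} {ι : Type*} {θ : ι → ℝ} {b : ι → Phase n → ℂ}
    (hb : SymbolOn Set.univ (fun _ _ => 1) (fun i _ => (θ i)⁻¹) b) :
    ∃ C : ℕ → ℝ, ∀ i, IsSymbol (θ i) C (b i) := by
  choose C _ hC using hb.bound
  exact ⟨C, fun i => ⟨hb.contDiff i, fun k z => by simpa using hC k i z (Set.mem_univ z)⟩⟩

end Family

end

/-- Constants are chosen before the semiclassical parameter `h`, the exponent `δ`, the amplitude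
`a`, the symbol `b` and the set `D`. -/
theorem theorem2p1 (n : ℕ) (φ : Phase n → ℝ) (hφ : ContDiff ℝ ∞ φ)
    (κ : Phase n → Phase n) (hκ : IsCanonicalTransformation κ) (hφκ : Generates φ κ)
    (K : Set (Phase n)) (hK : IsCompact K) (Ca Cb : ℕ → ℝ) :
    ∃ (Cc : ℕ → ℝ) (Cdecay : ℝ → ℕ → ℕ → ℝ) (CM : ℕ → ℕ → ℝ) (Capprox : ℝ → ℕ → ℕ → ℕ → ℝ),
      ∀ h δ θ : ℝ, 0 < h → h ≤ 1 → 0 ≤ δ → δ ≤ 1 / 2 → θ = h ^ (1 / 2 - δ) →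
      ∀ a : Phase n → ℂ, IsSymbol 1 Ca a → tsupport a ⊆ K →
      ∀ b : Phase n → ℂ, IsSymbol θ Cb b →
      ∃ c : Phase n → ℂ, IsSymbol θ Cc c ∧
        (∀ g : SchwartzMap (Config n) ℂ,
          conjugatedOp h φ a b (fun x => g x) = standardQuantization h c (fun x => g x)) ∧
        ∀ (R : ℝ) (D : Set (Phase n)), IsCompact D → D ⊆ Metric.closedBall 0 R →
          tsupport b ⊆ D →
          (∀ (k N : ℕ) (z : Phase n),
            ‖iteratedFDeriv ℝ k c z‖ ≤
              Cdecay R k N * θ⁻¹ ^ k * ((1 + h⁻¹ * θ * phaseDist z (κ '' D)) ^ N)⁻¹) ∧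
          ∀ M : ℕ, ∃ cM : Phase n → ℂ, IsSymbol θ (CM M) cM ∧ tsupport cM ⊆ κ '' D ∧
            ∀ (k N : ℕ) (z : Phase n),
              ‖iteratedFDeriv ℝ k (fun w => c w - cM w) z‖ ≤
                Capprox R M k N * θ⁻¹ ^ k * (h * (θ ^ 2)⁻¹) ^ M *
                  ((1 + h⁻¹ * θ * phaseDist z (κ '' D)) ^ N)⁻¹ := by

  obtain ⟨κinv, hκinv, hl, hr⟩ := hκ.smooth_inverse
  obtain ⟨R, hR⟩ := hK.isBounded.subset_closedBall (0 : Phase n)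
  -- The index type is the set of all admissible data, so uniform bounds yield constants depending
  -- only on n, φ, κ, K, `Ca` and `Cb`.
  have ha : SymbolOn Set.univ (fun _ _ => 1) (fun _ _ => 1)
      (fun i : ConjugationData K Ca Cb => i.a) := by
    simpa using symbolOn_of_isSymbol (θ := fun _ => 1) (fun _ => zero_lt_one)
      fun i : ConjugationData K Ca Cb => i.isSymbol_a
  have hb := symbolOn_of_isSymbol (fun i : ConjugationData K Ca Cb => i.θ_pos)
    fun i => i.isSymbol_b
  obtain ⟨hc, hexp⟩ := exists_symbolIntegral_expansion hφ hκ.smooth hκinv hl hr hφκ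
    (fun i : ConjugationData K Ca Cb => i.h_pos) (fun i => i.h_le_one) (fun i => i.h_le)
    (fun i => i.θ_pos) (fun i => i.θ_le_one) ha (fun i => i.tsupport_a.trans hR) hb
  obtain ⟨Cc, hCc⟩ := hc.exists_isSymbol
  -- The approximations depend on the order and the data only; D enters through the conclusions.
  choose cM hcM hcM0 hloc Capprox _ hCapprox using hexp
  choose CM hCM using fun M => (hcM M).exists_isSymbol
  -- The decay of c is the approximation estimate of order 0, whose approximating symbol is zero.
  refine ⟨Cc, Capprox 0, CM, fun R M => Capprox M R, ?_⟩
  intro h δ θ hh hh1 hδ hδ1 hθ a ha haK b hb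
  obtain ⟨hθ0, hθ1, hhθ⟩ := semiclassical_scale hh hh1 hδ hδ1
  rw [← hθ] at hθ0 hθ1 hhθ
  let i : ConjugationData K Ca Cb := ⟨h, θ, a, b, hh, hh1, hθ0, hθ1, hhθ, ha, haK, hb⟩
  refine ⟨symbolIntegral h φ a b fun _ => 1, hCc i, fun g =>
    conjugatedOp_eq_standardQuantization hφ hh hh1 ha.1 (haK.trans hR) hb.1 (fun k => ?_) g,
    fun R' D _ hDR hbD => ⟨fun k N z => ?_, fun M => ⟨cM M i, hCM M i, hloc M i D hbD,
      fun k N z => ?_⟩⟩⟩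
  · exact ⟨|Cb k| * θ⁻¹ ^ k, by positivity, fun z => (hb.2 k z).trans
      (mul_le_mul_of_nonneg_right (le_abs_self _) (by positivity))⟩
  · have h1 := hCapprox 0 R' k N i D hDR hbD z
    simp only [hcM0 0 rfl, Pi.zero_apply, sub_zero, pow_zero, mul_one] at h1
    exact h1.trans (le_of_eq (by ring))
  · exact (hCapprox M R' k N i D hDR hbD z).trans (le_of_eq (by
      change _ * (θ⁻¹ ^ k * (h / θ ^ 2) ^ M * ((1 + h⁻¹ * θ * _) ^ N)⁻¹) = _
      rw [div_eq_mul_inv]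
      ring))
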